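/- Let $C$ be a field of characteristic $0$, let $p$ be a prime and $q=p^r$ with $r\geq 1$. Let $X$ be the affine $C$-scheme representing the functor $$R\longmapsto\{(\phi,N)\in \mathrm{GL}_2(R)\times \mathfrak{gl}_2(R)\mid \phi N\phi^{-1}=q^{-1}N\}$$ on $C$-algebras, with the action of $\mathrm{GL}_2$ by conjugation on $\phi$ and the adjoint action on $N$, and let $[X/\mathrm{GL}_2]$ be the quotient stack; quasi-coherent sheaves on it are $\mathrm{GL}_2$-equivariant quasi-coherent sheaves on $X$. Let $X_0\subset X$ be the closed subscheme defined by $N=0$, and regard $\mathcal{O}_{[X_0/\mathrm{GL}_2]}$ as a quasi-coherent sheaf on $[X/\mathrm{GL}_2]$, a quotient of $\mathcal{O}_{[X/\mathrm{GL}_2]}$. Let $\mathfrak{Z}=\Gamma(\mathrm{GL}_2,\mathcal{O}_{\mathrm{GL}_2})^{\mathrm{GL}_2}$ be the ring of conjugation invariant functions on $\mathrm{GL}_2$, which acts on quasi-coherent sheaves on $[X/\mathrm{GL}_2]$ through the map $(\phi,N)\mapsto\phi$, and let $$f=(1+q)^2\det(\phi)-q\,\mathrm{tr}(\phi)^2\in\mathfrak{Z},$$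 whose vanishing locus consists of the $\phi$ with characteristic polynomial of the form $(T-\lambda)(T-q\lambda)$. For $\mathcal{F},\mathcal{G}\in\{\mathcal{O}_{[X/\mathrm{GL}_2]},\mathcal{O}_{[X_0/\mathrm{GL}_2]}\}$ and $i\in\mathbb{Z}$ let $\mathrm{Ext}^i_{[X/\mathrm{GL}_2]}(\mathcal{F},\mathcal{G})=\mathrm{Hom}(\mathcal{F},\mathcal{G}[i])$ in the derived category of quasi-coherent sheaves on $[X/\mathrm{GL}_2]$. Then $$\mathrm{Ext}^i_{[X/\mathrm{GL}_2]}(\mathcal{F},\mathcal{G})\cong\begin{cases}\mathfrak{Z}, & i=0,\\ 0, & i\neq 0,\end{cases}$$ as $\mathfrak{Z}$-modules, in all four cases. More precisely, a $\mathfrak{Z}$-basis of $\mathrm{Ext}^0(\mathcal{F},\mathcal{G})=\mathrm{Hom}(\mathcal{F},\mathcal{G})$ is given by: 1. the identity, if $\mathcal{F}=\mathcal{G}$; 2. the canonical projection, if $\mathcal{F}=\mathcal{O}_{[X/\mathrm{GL}_2]}$ and $\mathcal{G}=\mathcal{O}_{[X_0/\mathrm{GL}_2]}$; 3. if $\mathcal{F}=\mathcal{O}_{[X_0/\mathrm{GL}_2]}$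 and $\mathcal{G}=\mathcal{O}_{[X/\mathrm{GL}_2]}$, the unique morphism $\mathcal{O}_{[X_0/\mathrm{GL}_2]}\to\mathcal{O}_{[X/\mathrm{GL}_2]}$ whose composition with the canonical projection $\mathcal{O}_{[X/\mathrm{GL}_2]}\to\mathcal{O}_{[X_0/\mathrm{GL}_2]}$ is multiplication by $f$ on $\mathcal{O}_{[X/\mathrm{GL}_2]}$ (multiplication by $f$ does factor through the projection). -/

import Mathlib

open CategoryTheory CategoryTheory.Limits TensorProduct
open scoped MatrixGroups

universe w u

section Equivariant

/-- `G`-equivariant modules on an affine `k`-scheme `Spec A` with an action of an affine group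
scheme `G = Spec H`, i.e. quasi-coherent sheaves on the stack quotient `[Spec A / G]`. The action
is given by `act : A → A ⊗ H`, where `act a`, evaluated at `g ∈ G`, is `g · a = (x ↦ a (g⁻¹ x))`.
An equivariant module is an `A`-module with a `k`-linear coaction of `H`, equivalently a linear
(algebraic) left action of `G`, such that `g · (a m) = (g · a) (g · m)`. -/
structure EquivariantModule {k H A : Type u} [Field k] [CommRing H] [Bialgebra k H]
    [CommRing A] [Algebra k A] (act : A →ₐ[k] A ⊗[k] H) where
  carrier : Type u
  [addCommGroup : AddCommGroup carrier]
  [moduleBase : Module k carrier]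
  [module : Module A carrier]
  [isScalarTower : IsScalarTower k A carrier]
  coact : carrier →ₗ[k] carrier ⊗[k] H
  coassoc : ∀ m : carrier, TensorProduct.assoc k carrier H H (coact.rTensor H (coact m)) =
    (Coalgebra.comul (R := k) (A := H)).lTensor carrier (coact m)
  counit : ∀ m : carrier, TensorProduct.rid k carrier
    ((Coalgebra.counit (R := k) (A := H)).lTensor carrier (coact m)) = m
  coact_smul : ∀ (a : A) (m : carrier), coact (a • m) =
    TensorProduct.map₂ (Algebra.lsmul k k carrier).toLinearMap (LinearMap.mul k H) (act a)
      (coact m)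

namespace EquivariantModule

attribute [instance] addCommGroup moduleBase module isScalarTower

variable {k H A : Type u} [Field k] [CommRing H] [Bialgebra k H] [CommRing A] [Algebra k A]
  {act : A →ₐ[k] A ⊗[k] H}

/-- Morphisms are the `A`-linear maps that commute with the action of `G`. -/
@[ext]
structure Hom (M N : EquivariantModule act) where
  toLin : M.carrier →ₗ[A] N.carrier
  comm : ∀ m : M.carrier, N.coact (toLin m) =
    (toLin.restrictScalars k).rTensor H (M.coact m)

instance : Category (EquivariantModule act) where
  Hom := Hom
  id M := ⟨LinearMap.id, fun m => by
    rw [show (LinearMap.id : M.carrier →ₗ[A] M.carrier).restrictScalars k = LinearMap.id from rfl,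
      LinearMap.rTensor_id]; rfl⟩
  comp {M N P} f g := ⟨g.toLin ∘ₗ f.toLin, fun m => by
    rw [show (g.toLin ∘ₗ f.toLin).restrictScalars k =
      (g.toLin.restrictScalars k) ∘ₗ (f.toLin.restrictScalars k) from rfl,
      LinearMap.rTensor_comp_apply, ← f.comm, ← g.comm]; rfl⟩

@[ext]
theorem hom_ext {M N : EquivariantModule act} {f g : M ⟶ N} (h : ∀ m, f.toLin m = g.toLin m) :
    f = g := Hom.ext (LinearMap.ext h)

@[simp] theorem id_apply {M : EquivariantModule act} (m : M.carrier) :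
    Hom.toLin (𝟙 M) m = m := rfl

@[simp] theorem comp_apply {M N P : EquivariantModule act} (f : M ⟶ N) (g : N ⟶ P)
    (m : M.carrier) : (f ≫ g).toLin m = g.toLin (f.toLin m) := rfl

instance {M N : EquivariantModule act} : Zero (M ⟶ N) :=
  ⟨⟨0, fun m => by
    rw [show (0 : M.carrier →ₗ[A] N.carrier).restrictScalars k = 0 from rfl]; simp⟩⟩

instance {M N : EquivariantModule act} : Add (M ⟶ N) :=
  ⟨fun f g => ⟨f.toLin + g.toLin, fun m => by
    rw [show (f.toLin + g.toLin).restrictScalars k =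
      f.toLin.restrictScalars k + g.toLin.restrictScalars k from rfl, LinearMap.rTensor_add]
    simp [f.comm, g.comm]⟩⟩

instance {M N : EquivariantModule act} : Neg (M ⟶ N) :=
  ⟨fun f => ⟨-f.toLin, fun m => by
    rw [show (-f.toLin).restrictScalars k = -(f.toLin.restrictScalars k) from rfl,
      LinearMap.rTensor_neg]
    simp [f.comm]⟩⟩

@[simp] theorem zero_apply {M N : EquivariantModule act} (m : M.carrier) :
    Hom.toLin (0 : M ⟶ N) m = 0 := rfl

@[simp] theorem add_apply {M N : EquivariantModule act} (f g : M ⟶ N) (m : M.carrier) :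
    (f + g).toLin m = f.toLin m + g.toLin m := rfl

@[simp] theorem neg_apply {M N : EquivariantModule act} (f : M ⟶ N) (m : M.carrier) :
    (-f).toLin m = -f.toLin m := rfl

instance {M N : EquivariantModule act} : AddCommGroup (M ⟶ N) where
  add_assoc f g h := by ext m; simp [add_assoc]
  zero_add f := by ext m; simp
  add_zero f := by ext m; simp
  nsmul := nsmulRec
  zsmul := zsmulRec
  neg_add_cancel f := by ext m; simp
  add_comm f g := by ext m; simp [add_comm]

instance : Preadditive (EquivariantModule act) where
  add_comp _ _ _ f f' g := by ext m; simp
  comp_add _ _ _ f g g' := by ext m; simp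

/-! Transport of the axioms along maps compatible with the coactions. -/

section Transport

variable {K L : Type u} [AddCommGroup K] [Module k K] [AddCommGroup L] [Module k L]
  (c : K →ₗ[k] K ⊗[k] H) (d : L →ₗ[k] L ⊗[k] H) (f : K →ₗ[k] L)

theorem coassoc_left_nat (hf : ∀ x, d (f x) = f.rTensor H (c x)) (x : K) :
    TensorProduct.assoc k L H H (d.rTensor H (d (f x))) =
      f.rTensor (H ⊗[k] H) (TensorProduct.assoc k K H H (c.rTensor H (c x))) := by
  have h1 : d ∘ₗ f = f.rTensor H ∘ₗ c := LinearMap.ext hf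
  rw [hf, ← LinearMap.rTensor_comp_apply, h1, LinearMap.rTensor_comp_apply]
  generalize c.rTensor H (c x) = t
  have : (TensorProduct.assoc k L H H).toLinearMap ∘ₗ (f.rTensor H).rTensor H =
      f.rTensor (H ⊗[k] H) ∘ₗ (TensorProduct.assoc k K H H).toLinearMap := by
    ext; rfl
  exact LinearMap.congr_fun this t

theorem coassoc_right_nat (hf : ∀ x, d (f x) = f.rTensor H (c x)) (x : K) :
    (Coalgebra.comul (R := k) (A := H)).lTensor L (d (f x)) =
      f.rTensor (H ⊗[k] H) ((Coalgebra.comul (R := k) (A := H)).lTensor K (c x)) := by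
  rw [hf]
  generalize c x = t
  induction t with
  | zero => simp
  | tmul x y => simp
  | add x y hx hy => simp only [map_add, hx, hy]

theorem counit_nat (hf : ∀ x, d (f x) = f.rTensor H (c x)) (x : K) :
    TensorProduct.rid k L ((Coalgebra.counit (R := k) (A := H)).lTensor L (d (f x))) =
      f (TensorProduct.rid k K ((Coalgebra.counit (R := k) (A := H)).lTensor K (c x))) := by
  rw [hf]
  generalize c x = t
  induction t with
  | zero => simp
  | tmul x y => simp
  | add x y hx hy => simp only [map_add, hx, hy]

theorem map₂_nat [Module A K] [IsScalarTower k A K] [Module A L] [IsScalarTower k A L]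
    (g : K →ₗ[A] L) (s : A ⊗[k] H) (t : K ⊗[k] H) :
    TensorProduct.map₂ (Algebra.lsmul k k L).toLinearMap (LinearMap.mul k H) s
        ((g.restrictScalars k).rTensor H t) =
      (g.restrictScalars k).rTensor H
        (TensorProduct.map₂ (Algebra.lsmul k k K).toLinearMap (LinearMap.mul k H) s t) := by
  induction s with
  | zero => simp
  | add x y hx hy => simp only [map_add, LinearMap.add_apply, hx, hy]
  | tmul a h =>
    induction t with
    | zero => simp
    | add x y hx hy => simp only [map_add, hx, hy]
    | tmul x y => simp [TensorProduct.map₂_apply_tmul]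

end Transport

/-- An `A`-module with a coaction that embeds compatibly into an equivariant module. -/
def ofInjective (M : EquivariantModule act) (K : Type u) [AddCommGroup K] [Module k K]
    [Module A K] [IsScalarTower k A K] (c : K →ₗ[k] K ⊗[k] H) (f : K →ₗ[A] M.carrier)
    (hf : Function.Injective f)
    (hc : ∀ x, M.coact (f x) = (f.restrictScalars k).rTensor H (c x)) :
    EquivariantModule act where
  carrier := K
  coact := c
  coassoc x := by
    apply Module.Flat.rTensor_preserves_injective_linearMap (M := H ⊗[k] H)
      (f.restrictScalars k) hf
    rw [← coassoc_left_nat c M.coact (f.restrictScalars k) hc,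
      ← coassoc_right_nat c M.coact (f.restrictScalars k) hc]
    exact M.coassoc _
  counit x := by
    apply hf
    exact (counit_nat c M.coact (f.restrictScalars k) hc x).symm.trans (M.counit _)
  coact_smul a x := by
    apply Module.Flat.rTensor_preserves_injective_linearMap (M := H) (f.restrictScalars k) hf
    rw [← hc, map_smul, M.coact_smul, hc, map₂_nat]

/-- An `A`-module with a coaction that is compatibly a quotient of an equivariant module. -/
def ofSurjective (M : EquivariantModule act) (K : Type u) [AddCommGroup K] [Module k K]
    [Module A K] [IsScalarTower k A K] (c : K →ₗ[k] K ⊗[k] H) (f : M.carrier →ₗ[A] K)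
    (hf : Function.Surjective f)
    (hc : ∀ x, c (f x) = (f.restrictScalars k).rTensor H (M.coact x)) :
    EquivariantModule act where
  carrier := K
  coact := c
  coassoc x := by
    obtain ⟨x, rfl⟩ := hf x
    exact (coassoc_left_nat M.coact c (f.restrictScalars k) hc x).trans
      ((congrArg _ (M.coassoc x)).trans
        (coassoc_right_nat M.coact c (f.restrictScalars k) hc x).symm)
  counit x := by
    obtain ⟨x, rfl⟩ := hf x
    exact (counit_nat M.coact c (f.restrictScalars k) hc x).trans (congrArg f (M.counit x))
  coact_smul a x := by
    obtain ⟨x, rfl⟩ := hf x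
    rw [← map_smul, hc, M.coact_smul, hc, map₂_nat]

section Ker

variable {M N : EquivariantModule act} (f : M ⟶ N)

theorem exists_coact_ker (x : LinearMap.ker f.toLin) :
    ∃ y, (((LinearMap.ker f.toLin).subtype).restrictScalars k).rTensor H y = M.coact x := by
  have hex : Function.Exact (((LinearMap.ker f.toLin).subtype).restrictScalars k)
      (f.toLin.restrictScalars k) := f.toLin.exact_subtype_ker_map
  have := Module.Flat.rTensor_exact H hex
  refine (this (M.coact x)).1 ?_
  rw [← f.comm, x.2, map_zero]

theorem ker_subtype_rTensor_injective : Function.Injective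
    ((((LinearMap.ker f.toLin).subtype).restrictScalars k).rTensor H) :=
  Module.Flat.rTensor_preserves_injective_linearMap _ Subtype.val_injective

/-- The coaction on the kernel. -/
noncomputable def kerCoact :
    LinearMap.ker f.toLin →ₗ[k] (LinearMap.ker f.toLin) ⊗[k] H where
  toFun x := (exists_coact_ker f x).choose
  map_add' x y := by
    apply ker_subtype_rTensor_injective f
    rw [map_add, (exists_coact_ker f _).choose_spec, (exists_coact_ker f _).choose_spec,
      (exists_coact_ker f _).choose_spec, Submodule.coe_add, map_add]
  map_smul' a x := by
    apply ker_subtype_rTensor_injective f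
    rw [map_smul, (exists_coact_ker f _).choose_spec, (exists_coact_ker f _).choose_spec]
    exact map_smul M.coact a x.1

theorem kerCoact_spec (x : LinearMap.ker f.toLin) :
    M.coact ((LinearMap.ker f.toLin).subtype x) =
      (((LinearMap.ker f.toLin).subtype).restrictScalars k).rTensor H (kerCoact f x) :=
  (exists_coact_ker f x).choose_spec.symm

/-- The kernel as an equivariant module. -/
noncomputable def kerObj : EquivariantModule act :=
  ofInjective M (LinearMap.ker f.toLin) (kerCoact f) (LinearMap.ker f.toLin).subtype
    Subtype.val_injective (kerCoact_spec f)

/-- The inclusion of the kernel. -/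
noncomputable def kerι : kerObj f ⟶ M := ⟨(LinearMap.ker f.toLin).subtype, kerCoact_spec f⟩

theorem kerι_comp : kerι f ≫ f = 0 := by
  ext x; exact x.2

/-- A morphism killed by a second one factors through any injective morphism onto its kernel. -/
theorem exists_lift {K P : EquivariantModule act} (i : K ⟶ M) (hi : Function.Injective i.toLin)
    (hif : ∀ x, f.toLin x = 0 → ∃ y, i.toLin y = x) (g : P ⟶ M) (hg : g ≫ f = 0) :
    ∃ l : P ⟶ K, l ≫ i = g := by
  have h1 : ∀ x, ∃ y, i.toLin y = g.toLin x := fun x =>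
    hif _ (congrArg (fun t => Hom.toLin t x) hg)
  choose l hl using h1
  let L : P.carrier →ₗ[A] K.carrier :=
    { toFun := l
      map_add' := fun x y => hi (by simp [hl])
      map_smul' := fun a x => hi (by simp [hl]) }
  have hL : i.toLin ∘ₗ L = g.toLin := LinearMap.ext hl
  refine ⟨⟨L, fun x => ?_⟩, by ext x; exact hl x⟩
  apply Module.Flat.rTensor_preserves_injective_linearMap (M := H) (i.toLin.restrictScalars k) hi
  rw [← i.comm, ← LinearMap.rTensor_comp_apply]
  have : (i.toLin.restrictScalars k) ∘ₗ (L.restrictScalars k) = g.toLin.restrictScalars k := by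
    rw [← hL]; rfl
  rw [this, ← g.comm]
  exact congrArg _ (hl x)

/-- A morphism killing a second one factors through any surjective morphism with that kernel. -/
theorem exists_desc {Q P : EquivariantModule act} (p : N ⟶ Q) (hp : Function.Surjective p.toLin)
    (hpf : ∀ x, p.toLin x = 0 → ∃ y, f.toLin y = x) (g : N ⟶ P) (hg : f ≫ g = 0) :
    ∃ l : Q ⟶ P, p ≫ l = g := by
  have hker : LinearMap.ker p.toLin ≤ LinearMap.ker g.toLin := by
    intro x hx
    obtain ⟨y, rfl⟩ := hpf x hx
    exact congrArg (fun t => Hom.toLin t y) hg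
  have hdiff : ∀ x y, p.toLin x = p.toLin y → g.toLin x = g.toLin y := by
    intro x y h
    have : x - y ∈ LinearMap.ker g.toLin := hker (by simp [h])
    simpa [sub_eq_zero] using this
  choose s hs using hp
  let L : Q.carrier →ₗ[A] P.carrier :=
    { toFun := fun x => g.toLin (s x)
      map_add' := fun x y => by rw [← map_add]; exact hdiff _ _ (by simp [hs])
      map_smul' := fun a x => by
        rw [RingHom.id_apply, ← map_smul]; exact hdiff _ _ (by simp [hs]) }
  have hL : ∀ x, L (p.toLin x) = g.toLin x := fun x => hdiff _ _ (hs _)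
  refine ⟨⟨L, fun x => ?_⟩, by ext x; exact hL x⟩
  obtain ⟨x, rfl⟩ : ∃ y, p.toLin y = x := ⟨s x, hs x⟩
  rw [hL, g.comm, p.comm, ← LinearMap.rTensor_comp_apply]
  have : (L.restrictScalars k) ∘ₗ (p.toLin.restrictScalars k) = g.toLin.restrictScalars k :=
    LinearMap.ext hL
  rw [this]

end Ker

section Coker

variable {M N : EquivariantModule act} (f : M ⟶ N)

/-- The coaction on the cokernel. -/
noncomputable def cokerCoact : (N.carrier ⧸ LinearMap.range f.toLin) →ₗ[k]
    (N.carrier ⧸ LinearMap.range f.toLin) ⊗[k] H :=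
  ((LinearMap.range f.toLin).restrictScalars k).liftQ
    (((LinearMap.range f.toLin).mkQ.restrictScalars k).rTensor H ∘ₗ N.coact) (by
      rintro _ ⟨x, rfl⟩
      rw [LinearMap.mem_ker, LinearMap.comp_apply, f.comm, ← LinearMap.rTensor_comp_apply]
      have : ((LinearMap.range f.toLin).mkQ.restrictScalars k) ∘ₗ (f.toLin.restrictScalars k)
          = 0 := by
        ext y; simp
      rw [this]; simp)

/-- The cokernel as an equivariant module. -/
noncomputable def cokerObj : EquivariantModule act :=
  ofSurjective N (N.carrier ⧸ LinearMap.range f.toLin) (cokerCoact f)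
    (LinearMap.range f.toLin).mkQ (Submodule.mkQ_surjective _) (fun _ => rfl)

/-- The projection to the cokernel. -/
noncomputable def cokerπ : N ⟶ cokerObj f :=
  ⟨(LinearMap.range f.toLin).mkQ, fun _ => rfl⟩

theorem cokerπ_surjective : Function.Surjective (cokerπ f).toLin := Submodule.mkQ_surjective _

theorem comp_cokerπ : f ≫ cokerπ f = 0 := by
  ext x
  exact (Submodule.Quotient.mk_eq_zero _).2 ⟨x, rfl⟩

theorem cokerπ_eq_zero (x : N.carrier) (hx : (cokerπ f).toLin x = 0) :
    ∃ y, f.toLin y = x :=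
  (Submodule.Quotient.mk_eq_zero _).1 hx

end Coker

theorem mono_of_injective {M N : EquivariantModule act} (f : M ⟶ N)
    (hf : Function.Injective f.toLin) : Mono f :=
  ⟨fun g h e => by ext x; exact hf (congrArg (fun t => Hom.toLin t x) e)⟩

theorem epi_of_surjective {M N : EquivariantModule act} (f : M ⟶ N)
    (hf : Function.Surjective f.toLin) : Epi f :=
  ⟨fun g h e => by
    ext x
    obtain ⟨x, rfl⟩ := hf x
    exact congrArg (fun t => Hom.toLin t x) e⟩

theorem injective_of_mono {M N : EquivariantModule act} (f : M ⟶ N) [Mono f] :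
    Function.Injective f.toLin := by
  have h0 : kerι f = 0 := by
    rw [← cancel_mono f, kerι_comp, zero_comp]
  refine (injective_iff_map_eq_zero f.toLin).2 fun x hx => ?_
  exact congrArg (fun t => Hom.toLin t (⟨x, hx⟩ : LinearMap.ker f.toLin)) h0

theorem surjective_of_epi {M N : EquivariantModule act} (f : M ⟶ N) [Epi f] :
    Function.Surjective f.toLin := by
  have h0 : cokerπ f = 0 := by
    rw [← cancel_epi f, comp_cokerπ, comp_zero]
  intro x
  exact cokerπ_eq_zero f x (congrArg (fun t => Hom.toLin t x) h0)

/-- An injective morphism onto the kernel of `f` is a kernel of `f`. -/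
noncomputable def isKernel {K M N : EquivariantModule act} (f : M ⟶ N) (i : K ⟶ M)
    (w : i ≫ f = 0) (hi : Function.Injective i.toLin)
    (hif : ∀ x, f.toLin x = 0 → ∃ y, i.toLin y = x) : IsLimit (KernelFork.ofι i w) :=
  haveI := mono_of_injective i hi
  KernelFork.IsLimit.ofι' i w fun g hg =>
    ⟨(exists_lift f i hi hif g hg).choose, (exists_lift f i hi hif g hg).choose_spec⟩

/-- A surjective morphism whose kernel is the image of `f` is a cokernel of `f`. -/
noncomputable def isCokernel {M N Q : EquivariantModule act} (f : M ⟶ N) (p : N ⟶ Q)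
    (w : f ≫ p = 0) (hp : Function.Surjective p.toLin)
    (hpf : ∀ x, p.toLin x = 0 → ∃ y, f.toLin y = x) : IsColimit (CokernelCofork.ofπ p w) :=
  haveI := epi_of_surjective p hp
  CokernelCofork.IsColimit.ofπ' p w fun g hg =>
    ⟨(exists_desc f p hp hpf g hg).choose, (exists_desc f p hp hpf g hg).choose_spec⟩

instance : HasKernels (EquivariantModule act) where
  has_limit f := HasLimit.mk ⟨_, isKernel f (kerι f) (kerι_comp f) Subtype.val_injective
    fun (x : _) (hx : f.toLin x = 0) =>
      ⟨(⟨x, hx⟩ : LinearMap.ker f.toLin), rfl⟩⟩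

instance : HasCokernels (EquivariantModule act) where
  has_colimit f := HasColimit.mk ⟨_, isCokernel f (cokerπ f) (comp_cokerπ f)
    (cokerπ_surjective f) (cokerπ_eq_zero f)⟩

instance : IsNormalMonoCategory (EquivariantModule act) where
  normalMonoOfMono f _ := ⟨⟨cokerObj f, cokerπ f, comp_cokerπ f,
    isKernel _ f _ (injective_of_mono f) (cokerπ_eq_zero f)⟩⟩

instance : IsNormalEpiCategory (EquivariantModule act) where
  normalEpiOfEpi f _ := ⟨⟨kerObj f, kerι f, kerι_comp f,
    isCokernel _ f _ (surjective_of_epi f)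
      fun x hx => ⟨(⟨x, hx⟩ : LinearMap.ker f.toLin), rfl⟩⟩⟩

/-- The zero module. -/
noncomputable def zeroObj (act : A →ₐ[k] A ⊗[k] H) : EquivariantModule act where
  carrier := PUnit.{u + 1}
  coact := 0
  coassoc m := by simp
  counit m := rfl
  coact_smul a m := by simp

instance : HasZeroObject (EquivariantModule act) where
  zero := ⟨zeroObj act, fun M => ⟨⟨⟨0⟩, fun f => by
      ext x
      rw [show x = 0 from rfl, map_zero, map_zero]⟩⟩,
    fun M => ⟨⟨⟨0⟩, fun f => by ext x; rfl⟩⟩⟩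

section Prod

variable (M N : EquivariantModule act)

/-- The coaction on a direct sum. -/
noncomputable def prodCoact :
    (M.carrier × N.carrier) →ₗ[k] (M.carrier × N.carrier) ⊗[k] H :=
  LinearMap.coprod ((LinearMap.inl k M.carrier N.carrier).rTensor H ∘ₗ M.coact)
    ((LinearMap.inr k M.carrier N.carrier).rTensor H ∘ₗ N.coact)

theorem prodCoact_inl (x : M.carrier) : prodCoact M N (LinearMap.inl k M.carrier N.carrier x) =
    (LinearMap.inl k M.carrier N.carrier).rTensor H (M.coact x) := by
  simp [prodCoact]

theorem prodCoact_inr (x : N.carrier) : prodCoact M N (LinearMap.inr k M.carrier N.carrier x) =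
    (LinearMap.inr k M.carrier N.carrier).rTensor H (N.coact x) := by
  simp [prodCoact]

/-- The direct sum of two equivariant modules. -/
noncomputable def prodObj : EquivariantModule act where
  carrier := M.carrier × N.carrier
  coact := prodCoact M N
  coassoc m := by
    obtain ⟨x, y⟩ := m
    have h1 := (coassoc_left_nat M.coact _ _ (prodCoact_inl M N) x).trans
      ((congrArg _ (M.coassoc x)).trans
        (coassoc_right_nat M.coact _ _ (prodCoact_inl M N) x).symm)
    have h2 := (coassoc_left_nat N.coact _ _ (prodCoact_inr M N) y).trans
      ((congrArg _ (N.coassoc y)).trans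
        (coassoc_right_nat N.coact _ _ (prodCoact_inr M N) y).symm)
    have : (x, y) = LinearMap.inl k M.carrier N.carrier x +
      LinearMap.inr k M.carrier N.carrier y := by simp
    rw [this]
    simp only [map_add, h1, h2]
  counit m := by
    obtain ⟨x, y⟩ := m
    have h1 := (counit_nat M.coact _ _ (prodCoact_inl M N) x).trans (congrArg _ (M.counit x))
    have h2 := (counit_nat N.coact _ _ (prodCoact_inr M N) y).trans (congrArg _ (N.counit y))
    have : (x, y) = LinearMap.inl k M.carrier N.carrier x +
      LinearMap.inr k M.carrier N.carrier y := by simp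
    rw [this]
    simp only [map_add, h1, h2]
  coact_smul a m := by
    obtain ⟨x, y⟩ := m
    have h1 : prodCoact M N (LinearMap.inl k M.carrier N.carrier (a • x)) = _ :=
      (prodCoact_inl M N (a • x)).trans
        ((congrArg _ (M.coact_smul a x)).trans
          (map₂_nat (LinearMap.inl A M.carrier N.carrier) (act a) (M.coact x)).symm)
    have h2 : prodCoact M N (LinearMap.inr k M.carrier N.carrier (a • y)) = _ :=
      (prodCoact_inr M N (a • y)).trans
        ((congrArg _ (N.coact_smul a y)).trans
          (map₂_nat (LinearMap.inr A M.carrier N.carrier) (act a) (N.coact y)).symm)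
    have e1 : a • (x, y) = LinearMap.inl k M.carrier N.carrier (a • x) +
      LinearMap.inr k M.carrier N.carrier (a • y) := by simp
    have e2 : (x, y) = LinearMap.inl k M.carrier N.carrier x +
      LinearMap.inr k M.carrier N.carrier y := by simp
    rw [e1, e2, map_add, map_add, h1, h2, map_add, prodCoact_inl, prodCoact_inr]
    rfl

/-- The inclusions and projections of the direct sum. -/
noncomputable def inlHom : M ⟶ prodObj M N :=
  ⟨LinearMap.inl A M.carrier N.carrier, prodCoact_inl M N⟩

/-- The second inclusion. -/
noncomputable def inrHom : N ⟶ prodObj M N :=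
  ⟨LinearMap.inr A M.carrier N.carrier, prodCoact_inr M N⟩

/-- The first projection. -/
noncomputable def fstHom : prodObj M N ⟶ M :=
  ⟨LinearMap.fst A M.carrier N.carrier, fun m => by
    have h : ∀ t, (LinearMap.fst k M.carrier N.carrier).rTensor H (prodCoact M N t) =
        M.coact t.1 := fun t => by
      obtain ⟨x, y⟩ := t
      simp only [prodCoact, LinearMap.coprod_apply, LinearMap.comp_apply, map_add,
        ← LinearMap.rTensor_comp_apply, LinearMap.fst_comp_inl, LinearMap.fst_comp_inr]
      simp
    exact (h m).symm⟩

/-- The second projection. -/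
noncomputable def sndHom : prodObj M N ⟶ N :=
  ⟨LinearMap.snd A M.carrier N.carrier, fun m => by
    have h : ∀ t, (LinearMap.snd k M.carrier N.carrier).rTensor H (prodCoact M N t) =
        N.coact t.2 := fun t => by
      obtain ⟨x, y⟩ := t
      simp only [prodCoact, LinearMap.coprod_apply, LinearMap.comp_apply, map_add,
        ← LinearMap.rTensor_comp_apply, LinearMap.snd_comp_inl, LinearMap.snd_comp_inr]
      simp
    exact (h m).symm⟩

end Prod

instance : HasBinaryBiproducts (EquivariantModule act) where
  has_binary_biproduct M N := HasBinaryBiproduct.mk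
    { bicone :=
        { pt := prodObj M N
          fst := fstHom M N
          snd := sndHom M N
          inl := inlHom M N
          inr := inrHom M N
          inl_fst := rfl
          inl_snd := rfl
          inr_fst := rfl
          inr_snd := rfl }
      isBilimit := isBinaryBilimitOfTotal _ (by
        ext x
        refine Prod.ext ?_ ?_
        · exact add_zero x.1
        · exact zero_add x.2) }

instance : HasFiniteProducts (EquivariantModule act) :=
  hasFiniteProducts_of_has_binary_and_terminal

noncomputable instance : Abelian (EquivariantModule act) where

/-- Multiplication of a morphism by a `G`-invariant function. -/
noncomputable def smulHom {M N : EquivariantModule act} (a : A) (ha : act a = a ⊗ₜ 1)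
    (f : M ⟶ N) : M ⟶ N :=
  ⟨a • f.toLin, fun m => by
    rw [LinearMap.smul_apply, N.coact_smul, ha, f.comm, map₂_nat]
    generalize M.coact m = t
    induction t with
    | zero => simp
    | add x y hx hy => simp only [map_add, hx, hy]
    | tmul x y => simp [TensorProduct.map₂_apply_tmul]⟩

end EquivariantModule

end Equivariant

section LParameters

open Matrix

/-- The image of an invertible matrix under a homomorphism of algebras. -/
noncomputable def mapGL {C R S : Type*} [CommRing C] [CommRing R] [Algebra C R] [CommRing S]
    [Algebra C S] (f : R →ₐ[C] S) : GL (Fin 2) R →* GL (Fin 2) S :=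
  Matrix.GeneralLinearGroup.map f.toRingHom

section mapGL

variable {C R S T : Type*} [CommRing C] [CommRing R] [Algebra C R] [CommRing S] [Algebra C S]
  [CommRing T] [Algebra C T]

theorem mapGL_apply (f : R →ₐ[C] S) (g : GL (Fin 2) R) (i j : Fin 2) :
    mapGL f g i j = f (g i j) := rfl

theorem mapGL_val (f : R →ₐ[C] S) (g : GL (Fin 2) R) :
    (mapGL f g : Matrix (Fin 2) (Fin 2) S) =
      (g : Matrix (Fin 2) (Fin 2) R).map f := rfl

theorem mapGL_inv_val (f : R →ₐ[C] S) (g : GL (Fin 2) R) :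
    (((mapGL f g)⁻¹ : GL (Fin 2) S) : Matrix (Fin 2) (Fin 2) S) =
      ((g⁻¹ : GL (Fin 2) R) : Matrix (Fin 2) (Fin 2) R).map f := by
  rw [← map_inv]; rfl

theorem mapGL_comp (f : S →ₐ[C] T) (g : R →ₐ[C] S) (x : GL (Fin 2) R) :
    mapGL (f.comp g) x = mapGL f (mapGL g x) := rfl

theorem mapGL_id (x : GL (Fin 2) R) : mapGL (AlgHom.id C R) x = x := rfl

end mapGL

/-- The map `a ↦ a ⊗ 1`. -/
noncomputable abbrev inL (C R S : Type*) [CommRing C] [CommRing R] [Algebra C R] [CommRing S]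
    [Algebra C S] : R →ₐ[C] R ⊗[C] S := Algebra.TensorProduct.includeLeft

/-- The map `b ↦ 1 ⊗ b`. -/
noncomputable abbrev inR (C R S : Type*) [CommRing C] [CommRing R] [Algebra C R] [CommRing S]
    [Algebra C S] : S →ₐ[C] R ⊗[C] S := Algebra.TensorProduct.includeRight

section TensorLemmas

variable {C R S R' S' : Type*} [CommRing C] [CommRing R] [Algebra C R] [CommRing S] [Algebra C S]
  [CommRing R'] [Algebra C R'] [CommRing S'] [Algebra C S']

theorem mapGL_map_left (f : R →ₐ[C] R') (g : S →ₐ[C] S') (x : GL (Fin 2) R) :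
    mapGL (Algebra.TensorProduct.map f g) (mapGL (inL C R S) x) =
      mapGL (inL C R' S') (mapGL f x) := by
  ext i j; simp [mapGL_apply]

theorem mapGL_map_right (f : R →ₐ[C] R') (g : S →ₐ[C] S') (x : GL (Fin 2) S) :
    mapGL (Algebra.TensorProduct.map f g) (mapGL (inR C R S) x) =
      mapGL (inR C R' S') (mapGL g x) := by
  ext i j; simp [mapGL_apply]

theorem mapGL_assoc_left_left (x : GL (Fin 2) R) :
    mapGL (Algebra.TensorProduct.assoc C C C R S R').toAlgHom
      (mapGL (inL C (R ⊗[C] S) R') (mapGL (inL C R S) x)) = mapGL (inL C R (S ⊗[C] R')) x := by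
  ext i j
  simp [mapGL_apply, Algebra.TensorProduct.one_def]

theorem mapGL_assoc_left_right (x : GL (Fin 2) S) :
    mapGL (Algebra.TensorProduct.assoc C C C R S R').toAlgHom
      (mapGL (inL C (R ⊗[C] S) R') (mapGL (inR C R S) x)) =
        mapGL (inR C R (S ⊗[C] R')) (mapGL (inL C S R') x) := by
  ext i j
  simp [mapGL_apply]

theorem mapGL_assoc_right (x : GL (Fin 2) R') :
    mapGL (Algebra.TensorProduct.assoc C C C R S R').toAlgHom (mapGL (inR C (R ⊗[C] S) R') x) =
      mapGL (inR C R (S ⊗[C] R')) (mapGL (inR C S R') x) := by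
  ext i j
  simp [mapGL_apply, Algebra.TensorProduct.one_def]

end TensorLemmas

/-- The coordinate ring `C[x_ij, det⁻¹]` of the algebraic group `GL₂` over `C`. -/
def CoordGL (C : Type u) [Field C] : Type u :=
  Localization.Away (Matrix.mvPolynomialX (Fin 2) (Fin 2) C).det

namespace CoordGL

variable (C : Type u) [Field C]

noncomputable instance : CommRing (CoordGL C) :=
  inferInstanceAs (CommRing (Localization.Away (Matrix.mvPolynomialX (Fin 2) (Fin 2) C).det))

noncomputable instance : Algebra (MvPolynomial (Fin 2 × Fin 2) C) (CoordGL C) :=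
  inferInstanceAs (Algebra (MvPolynomial (Fin 2 × Fin 2) C)
    (Localization.Away (Matrix.mvPolynomialX (Fin 2) (Fin 2) C).det))

noncomputable instance : Algebra C (CoordGL C) :=
  inferInstanceAs (Algebra C (Localization.Away (Matrix.mvPolynomialX (Fin 2) (Fin 2) C).det))

instance : IsScalarTower C (MvPolynomial (Fin 2 × Fin 2) C) (CoordGL C) :=
  inferInstanceAs (IsScalarTower C (MvPolynomial (Fin 2 × Fin 2) C)
    (Localization.Away (Matrix.mvPolynomialX (Fin 2) (Fin 2) C).det))

instance : IsLocalization.Away (Matrix.mvPolynomialX (Fin 2) (Fin 2) C).det (CoordGL C) :=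
  inferInstanceAs (IsLocalization.Away _
    (Localization.Away (Matrix.mvPolynomialX (Fin 2) (Fin 2) C).det))

/-- The universal invertible matrix, over the coordinate ring. -/
noncomputable def univ : GL (Fin 2) (CoordGL C) :=
  Matrix.GeneralLinearGroup.mk''
    ((algebraMap (MvPolynomial (Fin 2 × Fin 2) C) (CoordGL C)).mapMatrix
      (Matrix.mvPolynomialX (Fin 2) (Fin 2) C))
    (by
      rw [← RingHom.map_det]
      exact IsLocalization.Away.algebraMap_isUnit _)

variable {C} {R S : Type*} [CommRing R] [Algebra C R] [CommRing S] [Algebra C S]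

/-- The homomorphism `C[GL₂] → R` given by an `R`-valued point of `GL₂`. -/
noncomputable def lift (g : GL (Fin 2) R) : CoordGL C →ₐ[C] R :=
  IsLocalization.liftAlgHom (M := Submonoid.powers (Matrix.mvPolynomialX (Fin 2) (Fin 2) C).det)
    (f := MvPolynomial.aeval fun p : Fin 2 × Fin 2 => (g : Matrix (Fin 2) (Fin 2) R) p.1 p.2)
    (by
      rintro ⟨_, n, rfl⟩
      rw [map_pow]
      refine IsUnit.pow n ?_
      have : MvPolynomial.aeval (fun p : Fin 2 × Fin 2 => (g : Matrix (Fin 2) (Fin 2) R) p.1 p.2)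
          (Matrix.mvPolynomialX (Fin 2) (Fin 2) C).det =
          (g : Matrix (Fin 2) (Fin 2) R).det := by
        simp [Matrix.det_fin_two]
      rw [this]
      exact (Matrix.isUnit_iff_isUnit_det _).1 g.isUnit)

theorem lift_univ (g : GL (Fin 2) R) (i j : Fin 2) : lift (C := C) g (univ C i j) = g i j := by
  have : univ C i j = algebraMap (MvPolynomial (Fin 2 × Fin 2) C) (CoordGL C) (MvPolynomial.X (i, j)) := rfl
  rw [this]
  exact (IsLocalization.lift_eq _ _).trans (by simp)

@[simp]
theorem mapGL_lift (g : GL (Fin 2) R) : mapGL (lift (C := C) g) (univ C) = g := by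
  ext i j
  exact lift_univ g i j

theorem hom_ext {f g : CoordGL C →ₐ[C] R} (h : mapGL f (univ C) = mapGL g (univ C)) :
    f = g := by
  refine IsLocalization.algHom_ext
    (Submonoid.powers (Matrix.mvPolynomialX (Fin 2) (Fin 2) C).det) ?_
  refine MvPolynomial.algHom_ext fun p => ?_
  exact congrArg (fun M : GL (Fin 2) R => M p.1 p.2) h

/-- The comultiplication `Δ(h)(g, g') = h(g g')` and the counit `h ↦ h(1)`. -/
noncomputable instance : Bialgebra C (CoordGL C) :=
  Bialgebra.ofAlgHom (lift (mapGL (inL C (CoordGL C) (CoordGL C)) (univ C) * mapGL (inR C (CoordGL C) (CoordGL C)) (univ C))) (lift 1)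
    (by
      apply hom_ext
      simp only [mapGL_comp, mapGL_lift, map_mul, mapGL_map_left, mapGL_map_right,
        mapGL_assoc_left_left, mapGL_assoc_left_right, mapGL_assoc_right, mapGL_id, mul_assoc])
    (by
      apply hom_ext
      simp only [mapGL_comp, mapGL_lift, map_mul, mapGL_map_left, mapGL_map_right, mapGL_id,
        map_one, one_mul]
      ext i j
      simp [mapGL_apply])
    (by
      apply hom_ext
      simp only [mapGL_comp, mapGL_lift, map_mul, mapGL_map_left, mapGL_map_right, mapGL_id,
        map_one, mul_one]
      ext i j
      simp [mapGL_apply])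

theorem comulAlgHom_eq : Bialgebra.comulAlgHom C (CoordGL C) =
    lift (mapGL (inL C (CoordGL C) (CoordGL C)) (univ C) *
      mapGL (inR C (CoordGL C) (CoordGL C)) (univ C)) := rfl

theorem counitAlgHom_eq : Bialgebra.counitAlgHom C (CoordGL C) = lift 1 := rfl

end CoordGL

/-! The space of L-parameters `X = {(φ, N) ∈ GL₂ × 𝔤𝔩₂ | Ad(φ)(N) = q⁻¹ N}`. -/

section PolyRing

variable (C : Type u) [Field C] (q : ℕ)

/-- The universal invertible matrix over the coordinate ring of `GL₂ × 𝔤𝔩₂`. -/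
noncomputable def polyφ : GL (Fin 2) (MvPolynomial (Fin 2 × Fin 2) (CoordGL C)) :=
  mapGL (IsScalarTower.toAlgHom C (CoordGL C) (MvPolynomial (Fin 2 × Fin 2) (CoordGL C)))
    (CoordGL.univ C)

/-- The universal matrix of `𝔤𝔩₂` over the coordinate ring of `GL₂ × 𝔤𝔩₂`. -/
noncomputable def polyN :
    Matrix (Fin 2) (Fin 2) (MvPolynomial (Fin 2 × Fin 2) (CoordGL C)) :=
  Matrix.mvPolynomialX (Fin 2) (Fin 2) (CoordGL C)

/-- The ideal generated by the entries of `φ N φ⁻¹ - q⁻¹ N`. -/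
noncomputable def relIdeal : Ideal (MvPolynomial (Fin 2 × Fin 2) (CoordGL C)) :=
  Ideal.span (Set.range fun p : Fin 2 × Fin 2 =>
    ((polyφ C).val * polyN C * (polyφ C)⁻¹.val - (q : C)⁻¹ • polyN C) p.1 p.2)

/-- The coordinate ring of the space `X` of L-parameters. -/
def CoordX : Type u := MvPolynomial (Fin 2 × Fin 2) (CoordGL C) ⧸ relIdeal C q

end PolyRing

namespace CoordX

variable (C : Type u) [Field C] (q : ℕ)

noncomputable instance : CommRing (CoordX C q) :=
  inferInstanceAs (CommRing (MvPolynomial (Fin 2 × Fin 2) (CoordGL C) ⧸ relIdeal C q))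

noncomputable instance : Algebra C (CoordX C q) :=
  inferInstanceAs (Algebra C (MvPolynomial (Fin 2 × Fin 2) (CoordGL C) ⧸ relIdeal C q))

/-- The quotient map from the coordinate ring of `GL₂ × 𝔤𝔩₂`. -/
noncomputable def mk : MvPolynomial (Fin 2 × Fin 2) (CoordGL C) →ₐ[C] CoordX C q :=
  Ideal.Quotient.mkₐ C (relIdeal C q)

/-- The map `C[GL₂] → C[X]` given by the projection `(φ, N) ↦ φ`. -/
noncomputable def proj : CoordGL C →ₐ[C] CoordX C q :=
  (mk C q).comp
    (IsScalarTower.toAlgHom C (CoordGL C) (MvPolynomial (Fin 2 × Fin 2) (CoordGL C)))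

/-- The universal `φ` on `X`. -/
noncomputable def φ : GL (Fin 2) (CoordX C q) := mapGL (proj C q) (CoordGL.univ C)

/-- The universal `N` on `X`. -/
noncomputable def N : Matrix (Fin 2) (Fin 2) (CoordX C q) := (polyN C).map (mk C q)

theorem φ_N : (φ C q).val * N C q * (φ C q)⁻¹.val = (q : C)⁻¹ • N C q := by
  have h1 : (φ C q).val = (polyφ C).val.map (mk C q) := rfl
  have h2 : (φ C q)⁻¹.val = (polyφ C)⁻¹.val.map (mk C q) := mapGL_inv_val (mk C q) (polyφ C)
  ext i j
  have h3 : mk C q (((polyφ C).val * polyN C * (polyφ C)⁻¹.val - (q : C)⁻¹ • polyN C) i j) = 0 :=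
    Ideal.Quotient.eq_zero_iff_mem.2 (Ideal.subset_span ⟨(i, j), rfl⟩)
  have h4 : ((polyφ C).val * polyN C * (polyφ C)⁻¹.val).map (mk C q) =
      (φ C q).val * N C q * (φ C q)⁻¹.val := by
    rw [h1, h2, N, ← Matrix.map_mul, ← Matrix.map_mul]
  rw [Matrix.sub_apply, map_sub, sub_eq_zero] at h3
  rw [← h4, Matrix.map_apply, h3]
  simp [N]

variable {C q} {R S : Type*} [CommRing R] [Algebra C R] [CommRing S] [Algebra C S]

/-- The homomorphism `C[X] → R` given by an `R`-valued point `(g, n)` of `X`. -/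
noncomputable def lift (g : GL (Fin 2) R) (n : Matrix (Fin 2) (Fin 2) R)
    (h : g.val * n * g⁻¹.val = (q : C)⁻¹ • n) : CoordX C q →ₐ[C] R :=
  let F : MvPolynomial (Fin 2 × Fin 2) (CoordGL C) →ₐ[C] R :=
    { MvPolynomial.eval₂Hom (CoordGL.lift (C := C) g).toRingHom (fun p => n p.1 p.2) with
      commutes' := fun c => by
        rw [IsScalarTower.algebraMap_apply C (CoordGL C)
          (MvPolynomial (Fin 2 × Fin 2) (CoordGL C)), MvPolynomial.algebraMap_eq]
        simp }
  Ideal.Quotient.liftₐ (relIdeal C q) F (by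
    have hφ : (polyφ C).val.map F = g.val := by
      ext i j
      have : F (polyφ C i j) = CoordGL.lift g (CoordGL.univ C i j) :=
        MvPolynomial.eval₂_C _ _ _
      exact this.trans (CoordGL.lift_univ g i j)
    have hφ' : mapGL F (polyφ C) = g := Units.ext hφ
    have hφi : (polyφ C)⁻¹.val.map F = g⁻¹.val := by
      rw [← mapGL_inv_val, hφ']
    have hN : (polyN C).map F = n := by
      ext i j
      exact MvPolynomial.eval₂_X _ _ _
    have key : ((polyφ C).val * polyN C * (polyφ C)⁻¹.val).map F =
        g.val * n * g⁻¹.val := by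
      rw [Matrix.map_mul, Matrix.map_mul, hφ, hφi, hN]
    intro a ha
    have : relIdeal C q ≤ RingHom.ker F.toRingHom := by
      refine Ideal.span_le.2 ?_
      rintro _ ⟨⟨i, j⟩, rfl⟩
      change F _ = 0
      have h3 := congrFun (congrFun (key.trans h) i) j
      rw [Matrix.map_apply] at h3
      change F ((_ - (q : C)⁻¹ • polyN C) i j) = 0
      rw [Matrix.sub_apply, map_sub, h3, sub_eq_zero, Matrix.smul_apply, Matrix.smul_apply,
        map_smul, ← hN, Matrix.map_apply]
    exact this ha)

theorem lift_proj (g : GL (Fin 2) R) (n : Matrix (Fin 2) (Fin 2) R)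
    (h : g.val * n * g⁻¹.val = (q : C)⁻¹ • n) :
    (lift g n h).comp (proj C q) = CoordGL.lift g := by
  refine AlgHom.ext fun x => ?_
  exact MvPolynomial.eval₂_C _ _ _

@[simp]
theorem mapGL_lift_φ (g : GL (Fin 2) R) (n : Matrix (Fin 2) (Fin 2) R)
    (h : g.val * n * g⁻¹.val = (q : C)⁻¹ • n) : mapGL (lift g n h) (φ C q) = g := by
  rw [φ, ← mapGL_comp, lift_proj, CoordGL.mapGL_lift]

@[simp]
theorem map_lift_N (g : GL (Fin 2) R) (n : Matrix (Fin 2) (Fin 2) R)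
    (h : g.val * n * g⁻¹.val = (q : C)⁻¹ • n) : (N C q).map (lift g n h) = n := by
  ext i j
  exact MvPolynomial.eval₂_X _ _ _

theorem hom_ext {f g : CoordX C q →ₐ[C] R} (h1 : mapGL f (φ C q) = mapGL g (φ C q))
    (h2 : (N C q).map f = (N C q).map g) : f = g := by
  have h3 : f.comp (proj C q) = g.comp (proj C q) := CoordGL.hom_ext h1
  refine Ideal.Quotient.algHom_ext C ?_
  refine AlgHom.ext fun x => ?_
  induction x using MvPolynomial.induction_on with
  | C a => exact AlgHom.congr_fun h3 a
  | add p r hp hr => rw [map_add, map_add, hp, hr]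
  | mul_X p i hp =>
    rw [map_mul, map_mul, hp]
    exact congrArg _ (congrFun (congrFun h2 i.1) i.2)

theorem conj_point {g γ : GL (Fin 2) R} {n : Matrix (Fin 2) (Fin 2) R}
    (h : g.val * n * g⁻¹.val = (q : C)⁻¹ • n) :
    (γ⁻¹ * g * γ).val * (γ⁻¹.val * n * γ.val) * (γ⁻¹ * g * γ)⁻¹.val =
      (q : C)⁻¹ • (γ⁻¹.val * n * γ.val) := by
  have h1 : γ.val * γ⁻¹.val = 1 := by rw [← Units.val_mul, mul_inv_cancel]; rfl
  have : (γ⁻¹ * g * γ).val * (γ⁻¹.val * n * γ.val) * (γ⁻¹ * g * γ)⁻¹.val =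
      γ⁻¹.val * (g.val * n * g⁻¹.val) * γ.val := by
    rw [_root_.mul_inv_rev, _root_.mul_inv_rev, inv_inv]
    simp only [Units.val_mul, mul_assoc]
    rw [← mul_assoc γ.val γ⁻¹.val, h1, one_mul, ← mul_assoc γ.val γ⁻¹.val, h1, one_mul]
  rw [this, h]
  simp

theorem map_point {g : GL (Fin 2) R} {n : Matrix (Fin 2) (Fin 2) R}
    (h : g.val * n * g⁻¹.val = (q : C)⁻¹ • n) (f : R →ₐ[C] S) :
    (mapGL f g).val * n.map f * (mapGL f g)⁻¹.val = (q : C)⁻¹ • n.map f := by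
  rw [mapGL_inv_val, mapGL_val, ← Matrix.map_mul, ← Matrix.map_mul, h]
  ext i j
  simp

variable (C q)

/-- The action of `GL₂` on functions on `X`, `(g · a)(φ, N) = a (g⁻¹ φ g, g⁻¹ N g)`, for the
action of `GL₂` on `X` by conjugation on `φ` and the adjoint action on `N`. -/
noncomputable def act : CoordX C q →ₐ[C] CoordX C q ⊗[C] CoordGL C :=
  lift ((mapGL (inR C (CoordX C q) (CoordGL C)) (CoordGL.univ C))⁻¹ * mapGL (inL C (CoordX C q) (CoordGL C)) (φ C q) *
      mapGL (inR C (CoordX C q) (CoordGL C)) (CoordGL.univ C))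
    ((mapGL (inR C (CoordX C q) (CoordGL C)) (CoordGL.univ C))⁻¹.val * (N C q).map (inL C (CoordX C q) (CoordGL C)) *
      (mapGL (inR C (CoordX C q) (CoordGL C)) (CoordGL.univ C)).val)
    (conj_point (map_point (φ_N C q) (inL C (CoordX C q) (CoordGL C))))

theorem mapGL_act_φ : mapGL (act C q) (φ C q) =
    (mapGL (inR C (CoordX C q) (CoordGL C)) (CoordGL.univ C))⁻¹ * mapGL (inL C (CoordX C q) (CoordGL C)) (φ C q) *
      mapGL (inR C (CoordX C q) (CoordGL C)) (CoordGL.univ C) := mapGL_lift_φ _ _ _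

theorem map_act_N : (N C q).map (act C q) =
    (mapGL (inR C (CoordX C q) (CoordGL C)) (CoordGL.univ C))⁻¹.val * (N C q).map (inL C (CoordX C q) (CoordGL C)) *
      (mapGL (inR C (CoordX C q) (CoordGL C)) (CoordGL.univ C)).val := map_lift_N _ _ _

theorem map_comp_mat {R S T : Type*} [CommRing R] [CommRing S] [CommRing T] [Algebra C R]
    [Algebra C S] [Algebra C T] (f : S →ₐ[C] T) (g : R →ₐ[C] S) (n : Matrix (Fin 2) (Fin 2) R) :
    n.map (f.comp g) = (n.map g).map f := rfl

theorem map_sandwich {R S : Type*} [CommRing R] [CommRing S] [Algebra C R] [Algebra C S]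
    (f : R →ₐ[C] S) (γ : GL (Fin 2) R) (n : Matrix (Fin 2) (Fin 2) R) :
    (γ⁻¹.val * n * γ.val).map f = (mapGL f γ)⁻¹.val * n.map f * (mapGL f γ).val := by
  rw [Matrix.map_mul, Matrix.map_mul, mapGL_inv_val, mapGL_val]

theorem act_coassoc : (Algebra.TensorProduct.assoc C C C (CoordX C q) (CoordGL C)
      (CoordGL C)).toAlgHom.comp
      ((Algebra.TensorProduct.map (act C q) (AlgHom.id C (CoordGL C))).comp (act C q)) =
    (Algebra.TensorProduct.map (AlgHom.id C (CoordX C q))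
      (Bialgebra.comulAlgHom C (CoordGL C))).comp (act C q) := by
  apply hom_ext
  · simp only [mapGL_comp, mapGL_act_φ, map_mul, map_inv, mapGL_map_right, mapGL_map_left,
      mapGL_id, mapGL_assoc_left_left, mapGL_assoc_left_right, mapGL_assoc_right,
      CoordGL.comulAlgHom_eq, CoordGL.mapGL_lift, _root_.mul_inv_rev, mul_assoc]
  · have e2 : ((N C q).map (inL C (CoordX C q) (CoordGL C))).map
        (Algebra.TensorProduct.map (act C q) (AlgHom.id C (CoordGL C))) =
        ((N C q).map (act C q)).map (inL C _ _) := by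
      ext i j; simp
    have e3 : ((N C q).map (inL C (CoordX C q) (CoordGL C))).map
        (Algebra.TensorProduct.map (AlgHom.id C (CoordX C q))
          (Bialgebra.comulAlgHom C (CoordGL C))) = (N C q).map (inL C _ _) := by
      ext i j; simp
    have e4 : (((N C q).map (inL C (CoordX C q) (CoordGL C))).map
        (inL C (CoordX C q ⊗[C] CoordGL C) (CoordGL C))).map
        (Algebra.TensorProduct.assoc C C C (CoordX C q) (CoordGL C) (CoordGL C)).toAlgHom =
        (N C q).map (inL C _ _) := by
      ext i j; simp [Algebra.TensorProduct.one_def]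
    rw [map_comp_mat, map_comp_mat, map_comp_mat, map_act_N, map_sandwich, map_sandwich,
      map_sandwich, e2, e3, map_act_N, map_sandwich, map_sandwich, e4]
    simp only [mapGL_map_right, mapGL_id, mapGL_assoc_left_right, mapGL_assoc_right,
      CoordGL.comulAlgHom_eq, CoordGL.mapGL_lift, map_mul, _root_.mul_inv_rev, Units.val_mul,
      mul_assoc]

theorem act_counit : (Algebra.TensorProduct.rid C C (CoordX C q)).toAlgHom.comp
      ((Algebra.TensorProduct.map (AlgHom.id C (CoordX C q))
      (Bialgebra.counitAlgHom C (CoordGL C))).comp (act C q)) = AlgHom.id C (CoordX C q) := by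
  apply hom_ext
  · simp only [mapGL_comp, mapGL_act_φ, map_mul, map_inv, mapGL_map_right, mapGL_map_left,
      CoordGL.counitAlgHom_eq, CoordGL.mapGL_lift, map_one, inv_one, one_mul, mul_one]
    ext i j
    simp [mapGL_apply]
  · rw [map_comp_mat, map_comp_mat, map_act_N, map_sandwich, map_sandwich]
    simp only [mapGL_map_right, CoordGL.counitAlgHom_eq, CoordGL.mapGL_lift, map_one, inv_one,
      Units.val_one, one_mul, mul_one]
    ext i j
    simp

end CoordX

/-- The category of quasi-coherent sheaves on the quotient stack `[X / GL₂]`. -/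
abbrev QCohXModG (C : Type u) [Field C] (q : ℕ) : Type (u + 1) :=
  EquivariantModule (CoordX.act C q)

/-- The structure sheaf of `[X / GL₂]`. -/
noncomputable def structureSheafX (C : Type u) [Field C] (q : ℕ) : QCohXModG C q where
  carrier := CoordX C q
  coact := (CoordX.act C q).toLinearMap
  coassoc m := AlgHom.congr_fun (CoordX.act_coassoc C q) m
  counit m := AlgHom.congr_fun (CoordX.act_counit C q) m
  coact_smul a m := by
    rw [smul_eq_mul, AlgHom.toLinearMap_apply, map_mul, AlgHom.toLinearMap_apply]
    generalize CoordX.act C q a = s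
    generalize CoordX.act C q m = t
    induction s with
    | zero => simp
    | add x y hx hy => simp only [map_add, add_mul, LinearMap.add_apply, hx, hy]
    | tmul a h =>
      induction t with
      | zero => simp
      | add x y hx hy => simp only [map_add, mul_add, hx, hy]
      | tmul x y => simp [TensorProduct.map₂_apply_tmul]

/-- The ideal of the closed subscheme `X₀ ⊆ X` defined by `N = 0`. -/
noncomputable def idealX₀ (C : Type u) [Field C] (q : ℕ) : Ideal (CoordX C q) :=
  Ideal.span (Set.range fun p : Fin 2 × Fin 2 => CoordX.N C q p.1 p.2)

/-- The quotient map `C[X] → C[X₀]`. -/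
noncomputable def mkX₀ (C : Type u) [Field C] (q : ℕ) :
    CoordX C q →ₗ[CoordX C q] CoordX C q ⧸ idealX₀ C q := (idealX₀ C q).mkQ

theorem act_mem_idealX₀ (C : Type u) [Field C] (q : ℕ) (a : CoordX C q) (ha : a ∈ idealX₀ C q) :
    ((mkX₀ C q).restrictScalars C).rTensor (CoordGL C) (CoordX.act C q a) = 0 := by
  let F : CoordX C q →ₐ[C] (CoordX C q ⧸ idealX₀ C q) ⊗[C] CoordGL C :=
    (Algebra.TensorProduct.map (Ideal.Quotient.mkₐ C (idealX₀ C q))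
      (AlgHom.id C (CoordGL C))).comp (CoordX.act C q)
  have hF : idealX₀ C q ≤ RingHom.ker F.toRingHom := by
    refine Ideal.span_le.2 ?_
    rintro _ ⟨⟨i, j⟩, rfl⟩
    have h0 : ((CoordX.N C q).map (inL C (CoordX C q) (CoordGL C))).map
        (Algebra.TensorProduct.map (Ideal.Quotient.mkₐ C (idealX₀ C q))
          (AlgHom.id C (CoordGL C))) = 0 := by
      ext i j
      have : Ideal.Quotient.mkₐ C (idealX₀ C q) (CoordX.N C q i j) = 0 :=
        Ideal.Quotient.eq_zero_iff_mem.2 (Ideal.subset_span ⟨(i, j), rfl⟩)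
      simp only [Matrix.map_apply, Algebra.TensorProduct.includeLeft_apply,
        Algebra.TensorProduct.map_tmul, this, TensorProduct.zero_tmul, Matrix.zero_apply]
    have h1 : ((CoordX.N C q).map (CoordX.act C q)).map
        (Algebra.TensorProduct.map (Ideal.Quotient.mkₐ C (idealX₀ C q))
          (AlgHom.id C (CoordGL C))) = 0 := by
      rw [CoordX.map_act_N, Matrix.map_mul, Matrix.map_mul, h0, mul_zero, zero_mul]
    exact congrFun (congrFun h1 i) j
  exact hF ha

/-- The structure sheaf of `[X₀ / GL₂]`, as a quasi-coherent sheaf on `[X / GL₂]`. -/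
noncomputable def structureSheafX₀ (C : Type u) [Field C] (q : ℕ) : QCohXModG C q :=
  EquivariantModule.ofSurjective (structureSheafX C q) (CoordX C q ⧸ idealX₀ C q)
    (((idealX₀ C q).restrictScalars C).liftQ
      (((mkX₀ C q).restrictScalars C).rTensor (CoordGL C) ∘ₗ
        (CoordX.act C q).toLinearMap)
      (fun a ha => act_mem_idealX₀ C q a ha))
    (mkX₀ C q) (Submodule.mkQ_surjective (idealX₀ C q)) (fun _ => rfl)

/-- The canonical projection from the structure sheaf of `[X / GL₂]` to that of `[X₀ / GL₂]`. -/
noncomputable def projX₀ (C : Type u) [Field C] (q : ℕ) :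
    structureSheafX C q ⟶ structureSheafX₀ C q :=
  ⟨mkX₀ C q, fun _ => rfl⟩

/-! The ring `ℨ` of conjugation invariant functions on `GL₂`. -/

section Center

variable (C : Type u) [Field C]

/-- The conjugation action of `GL₂` on functions on itself, `(g · h)(φ) = h (g⁻¹ φ g)`. -/
noncomputable def conjAct : CoordGL C →ₐ[C] CoordGL C ⊗[C] CoordGL C :=
  CoordGL.lift ((mapGL (inR C (CoordGL C) (CoordGL C)) (CoordGL.univ C))⁻¹ *
    mapGL (inL C (CoordGL C) (CoordGL C)) (CoordGL.univ C) *
      mapGL (inR C (CoordGL C) (CoordGL C)) (CoordGL.univ C))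

/-- The ring `ℨ = C[GL₂]^GL₂` of conjugation invariant functions on `GL₂`, the ring of functions
on the adjoint quotient of `GL₂`. -/
noncomputable def InvariantRing : Subalgebra C (CoordGL C) :=
  AlgHom.equalizer (conjAct C) (inL C (CoordGL C) (CoordGL C))

theorem mem_invariantRing (h : CoordGL C) : h ∈ InvariantRing C ↔ conjAct C h = h ⊗ₜ 1 := Iff.rfl

theorem act_proj (q : ℕ) (z : InvariantRing C) :
    CoordX.act C q (CoordX.proj C q z) = CoordX.proj C q z ⊗ₜ 1 := by
  have h : (CoordX.act C q).comp (CoordX.proj C q) =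
      (Algebra.TensorProduct.map (CoordX.proj C q) (AlgHom.id C (CoordGL C))).comp
        (conjAct C) := by
    apply CoordGL.hom_ext
    rw [mapGL_comp, mapGL_comp, conjAct, CoordGL.mapGL_lift]
    simp only [map_mul, map_inv, mapGL_map_left, mapGL_map_right, mapGL_id]
    exact CoordX.mapGL_act_φ C q
  have h1 := AlgHom.congr_fun h z
  rw [AlgHom.comp_apply, AlgHom.comp_apply, (mem_invariantRing C z).1 z.2] at h1
  simpa using h1

noncomputable instance (q : ℕ) (F G : QCohXModG C q) : SMul (InvariantRing C) (F ⟶ G) :=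
  ⟨fun z f => EquivariantModule.smulHom (CoordX.proj C q z) (act_proj C q z) f⟩

theorem invariantRing_smul_apply {q : ℕ} {F G : QCohXModG C q} (z : InvariantRing C) (f : F ⟶ G)
    (m : F.carrier) : (z • f).toLin m = CoordX.proj C q z • f.toLin m := rfl

noncomputable instance (q : ℕ) (F G : QCohXModG C q) : Module (InvariantRing C) (F ⟶ G) where
  one_smul f := by ext m; simp [invariantRing_smul_apply]
  mul_smul x y f := by ext m; simp [invariantRing_smul_apply, mul_smul]
  smul_zero x := by ext m; simp [invariantRing_smul_apply]
  smul_add x f g := by ext m; simp [invariantRing_smul_apply]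
  add_smul x y f := by ext m; simp [invariantRing_smul_apply, add_smul]
  zero_smul f := by ext m; simp [invariantRing_smul_apply]

/-- `QCoh([X / GL₂])` is a `ℨ`-linear category, through the map `X → GL₂`, `(φ, N) ↦ φ`. -/
noncomputable instance (q : ℕ) : Linear (InvariantRing C) (QCohXModG C q) where
  smul_comp F G K z f g := by ext m; simp [invariantRing_smul_apply]
  comp_smul F G z K f g := by ext m; simp [invariantRing_smul_apply]

/-- The function `φ ↦ (1 + q)² det φ - q (tr φ)²` on `GL₂`. In terms of the eigenvalues of `φ` it is
`(λ₁ - q λ₂) (λ₂ - q λ₁)`, so it cuts out the locus of the characteristic polynomials of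
the form `(T - λ) (T - q λ)`. -/
noncomputable def invariantF (q : ℕ) : InvariantRing C :=
  ⟨(1 + (q : CoordGL C)) ^ 2 * (CoordGL.univ C).val.det -
      (q : CoordGL C) * (CoordGL.univ C).val.trace ^ 2, by
    have hm : (CoordGL.univ C).val.map (conjAct C) =
        (mapGL (inR C (CoordGL C) (CoordGL C)) (CoordGL.univ C))⁻¹.val *
          (CoordGL.univ C).val.map (inL C (CoordGL C) (CoordGL C)) *
            (mapGL (inR C (CoordGL C) (CoordGL C)) (CoordGL.univ C)).val :=
      congrArg Units.val (CoordGL.mapGL_lift _)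
    have hd : conjAct C (CoordGL.univ C).val.det =
        inL C (CoordGL C) (CoordGL C) (CoordGL.univ C).val.det := by
      rw [AlgHom.map_det, AlgHom.map_det, AlgHom.mapMatrix_apply, AlgHom.mapMatrix_apply, hm]
      exact Matrix.det_units_conj' _ _
    have ht : conjAct C (CoordGL.univ C).val.trace =
        inL C (CoordGL C) (CoordGL C) (CoordGL.univ C).val.trace := by
      rw [Matrix.trace_fin_two, map_add, map_add]
      have h := Matrix.trace_units_conj' (mapGL (inR C (CoordGL C) (CoordGL C)) (CoordGL.univ C))
        ((CoordGL.univ C).val.map (inL C (CoordGL C) (CoordGL C)))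
      rw [← hm, Matrix.trace_fin_two, Matrix.trace_fin_two] at h
      exact h
    change conjAct C _ = inL C (CoordGL C) (CoordGL C) _
    simp only [map_sub, map_mul, map_pow, map_add, map_one, map_natCast, hd, ht]⟩

end Center

/-- `Ext^i(F, G) = Hom(F, G[i])`, computed in the derived category of `QCoh([X / GL₂])`. -/
abbrev ExtX {C : Type u} [Field C] {q : ℕ} [HasDerivedCategory.{w} (QCohXModG C q)]
    (F G : QCohXModG C q) (i : ℤ) : Type w :=
  ShiftedHom ((DerivedCategory.singleFunctor (QCohXModG C q) 0).obj F)
    ((DerivedCategory.singleFunctor (QCohXModG C q) 0).obj G) i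

/-- The class in `Ext^0(F, G)` of a morphism `F ⟶ G`. -/
noncomputable def extXMk {C : Type u} [Field C] {q : ℕ}
    [HasDerivedCategory.{w} (QCohXModG C q)] {F G : QCohXModG C q} (f : F ⟶ G) : ExtX F G 0 :=
  ShiftedHom.mk₀ (0 : ℤ) rfl ((DerivedCategory.singleFunctor (QCohXModG C q) 0).map f)

end LParameters

/-! ### Cayley's Omega process and the Haar functional of `GL₂` -/

section Omega

open MvPolynomial Matrix

/-! Write `A = C[X]` and let `I` be the ideal of `X₀`. Two mechanisms carry the proof.

The first is linear reductivity of `GL₂` in characteristic `0`. Cayley's Omega operator yields an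
invariant integral on `C[GL₂]` (`haarLeft_comul`), and averaging with it makes a linear lift
equivariant (`comp_average`). Hence `A ⊗ V` is projective for every representation `V`; in
particular `𝒪_X` is projective, and there are enough projectives.

The second is a theory of weights. Conjugation by `φ` itself fixes `φ` and only rescales `N`.
Evaluating the coaction of an equivariant module `M` at the universal `φ` therefore gives an
operator `inertia M`, natural in `M`, which on `A` is the substitution `N ↦ q N`. A function of
degree `d` in `N` has weight `q ^ d`, so `I` has weights `q ^ d` with `d ≥ 1` while `𝒪_{X₀}` has the
single weight `1`. The operator is only semilinear over the scaling of `N`, so orthogonality of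
weights needs an argument. It is `HasWeightsGE.ext_subsingleton`: if `F` has weights `q ^ d`, `d ≥
b`, and `W` has one weight `c` outside this set, then all `Ext^n(F, W)` vanish. On the free cover `A
⊗ F` there are two `A`-linear actions of `φ`, through `F` as a representation and through `inertia
F`. Their difference `v` has kernel and cokernel with weights again `≥ b`, the cokernel surjects
onto `F`, and maps to `W` extend along `v` because `c - inertia F` is invertible. Induction on the
degree concludes. Applied to `I` and `𝒪_{X₀}`, this removes the higher self-extensions of `𝒪_{X₀}`.

For `Ext(𝒪_{X₀}, 𝒪_X)`, note that `f` kills `N`, so multiplication by `f` embeds `𝒪_{X₀}` into `𝒪_X`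
with cokernel `A / f`. Over `f = 0` the eigenvalues of `φ` are `s` and `q s`, the spectral
projections are defined, and `N` must carry one eigenline to the other. Thus that part of `X` is the
total space of a line bundle over a subscheme of `GL₂`, and a function killing `N` is zero there
(`mkX_eq_zero_of_mul_N`). It follows that `1 ↦ N` embeds `A / f` into the quotient `L` of `A ⊗ 𝔤𝔩₂`
by `f` and `Ad(φ) - q⁻¹`. The cokernel has weight `q⁻¹`, so it receives no extensions from `𝒪_{X₀}`.
The map `1 ↦ N` belongs to a natural transformation from the identity to the exact functor `- ⊗
𝔤𝔩₂`, which vanishes at `𝒪_{X₀}`; sliding it through a class `α` (`Ext.exists_comp_natTrans`) shows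
that `α` dies in `L`. So `α` comes from a positive degree self-extension of `𝒪_{X₀}`, and is zero.

In degree `0`, an invariant function on `X` is fixed by the scaling of `N`, hence depends on `φ`
only (`exists_invariant_of_act_eq`). A map `𝒪_{X₀} → 𝒪_X` is an invariant function that kills `N`,
hence a multiple of `f`. -/

theorem pderiv_pderiv_comm {σ R : Type*} [CommRing R] (i j : σ) (P : MvPolynomial σ R) :
    pderiv i (pderiv j P) = pderiv j (pderiv i P) := by
  classical
  have h : ⁅pderiv (R := R) i, pderiv (R := R) j⁆ = 0 := by
    refine MvPolynomial.derivation_ext fun k => ?_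
    rw [Derivation.commutator_apply, pderiv_X, pderiv_X, Pi.single_apply, Pi.single_apply]
    split_ifs <;> simp
  have := congrArg (fun D => D P) h
  simpa [Derivation.commutator_apply, sub_eq_zero] using this

variable (R : Type*) [CommRing R]

/-- Cayley's Omega operator on functions on `2 × 2` matrices. -/
noncomputable def omegaOp :
    MvPolynomial (Fin 2 × Fin 2) R →ₗ[R] MvPolynomial (Fin 2 × Fin 2) R :=
  (pderiv (0, 0)).toLinearMap ∘ₗ (pderiv (1, 1)).toLinearMap -
    (pderiv (0, 1)).toLinearMap ∘ₗ (pderiv (1, 0)).toLinearMap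

/-- The Euler operator on functions on `2 × 2` matrices. -/
noncomputable def eulerOp :
    MvPolynomial (Fin 2 × Fin 2) R →ₗ[R] MvPolynomial (Fin 2 × Fin 2) R :=
  ∑ p, LinearMap.mulLeft R (X p) ∘ₗ (pderiv p).toLinearMap

variable {R}

theorem omegaOp_apply (P : MvPolynomial (Fin 2 × Fin 2) R) :
    omegaOp R P = pderiv (0, 0) (pderiv (1, 1) P) - pderiv (0, 1) (pderiv (1, 0) P) := rfl

theorem eulerOp_apply (P : MvPolynomial (Fin 2 × Fin 2) R) :
    eulerOp R P = ∑ p, X p * pderiv p P := by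
  simp [eulerOp]

theorem pderiv_eulerOp (i : Fin 2 × Fin 2) (P : MvPolynomial (Fin 2 × Fin 2) R) :
    pderiv i (eulerOp R P) = eulerOp R (pderiv i P) + pderiv i P := by
  classical
  have h : ∀ p, pderiv i (X p * pderiv p P) =
      X p * pderiv p (pderiv i P) + if p = i then pderiv p P else 0 := fun p => by
    rw [Derivation.leibniz, pderiv_pderiv_comm, pderiv_X, Pi.single_apply]
    by_cases hp : p = i
    · simp [hp]
    · simp [hp]
  rw [eulerOp_apply, eulerOp_apply, map_sum, Finset.sum_congr rfl fun p _ => h p,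
    Finset.sum_add_distrib, Finset.sum_ite_eq' Finset.univ i]
  simp

/-- `Ω` lowers degrees by two, so its commutator with the degree operator is `2 Ω`. -/
theorem omegaOp_eulerOp (P : MvPolynomial (Fin 2 × Fin 2) R) :
    omegaOp R (eulerOp R P) = eulerOp R (omegaOp R P) + 2 * omegaOp R P := by
  simp only [omegaOp_apply, pderiv_eulerOp, map_add, map_sub]
  ring

/-- The commutator of `Ω` with multiplication by `det` is `E + 2`, with `E` the Euler operator.
Together with the commutator of `Ω` and `E` it determines all the commutators of powers of `Ω` with
`det`. -/
theorem omegaOp_det_mul (P : MvPolynomial (Fin 2 × Fin 2) R) :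
    omegaOp R ((mvPolynomialX (Fin 2) (Fin 2) R).det * P) =
      (mvPolynomialX (Fin 2) (Fin 2) R).det * omegaOp R P + (eulerOp R P + 2 * P) := by
  rw [eulerOp_apply, Fintype.sum_prod_type]
  simp only [Fin.sum_univ_two, Matrix.det_fin_two, omegaOp_apply, Matrix.mvPolynomialX_apply]
  simp [Derivation.leibniz, pderiv_X]
  ring

theorem omegaOp_pow_det_mul (n : ℕ) (P : MvPolynomial (Fin 2 × Fin 2) R) :
    (omegaOp R ^ (n + 1)) ((mvPolynomialX (Fin 2) (Fin 2) R).det * P) =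
      (mvPolynomialX (Fin 2) (Fin 2) R).det * (omegaOp R ^ (n + 1)) P +
        ((n : MvPolynomial (Fin 2 × Fin 2) R) + 1) * (eulerOp R ((omegaOp R ^ n) P) +
          ((n : MvPolynomial (Fin 2 × Fin 2) R) + 2) * (omegaOp R ^ n) P) := by
  have hnat : ∀ (k : ℕ) (Q : MvPolynomial (Fin 2 × Fin 2) R),
      omegaOp R ((k : MvPolynomial (Fin 2 × Fin 2) R) * Q) = k * omegaOp R Q := fun k Q => by
    rw [← nsmul_eq_mul, map_nsmul, nsmul_eq_mul]
  induction n with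
  | zero => simp [omegaOp_det_mul]
  | succ n ih =>
    have e1 : (omegaOp R ^ (n + 1)) P = omegaOp R ((omegaOp R ^ n) P) := by
      rw [pow_succ', Module.End.mul_apply]
    have e2 : (omegaOp R ^ (n + 1 + 1)) P = omegaOp R (omegaOp R ((omegaOp R ^ n) P)) := by
      rw [pow_succ', Module.End.mul_apply, e1]
    rw [pow_succ', Module.End.mul_apply, ih, map_add, omegaOp_det_mul, ← pow_succ', e2, e1]
    have h1 := hnat (n + 1) (eulerOp R ((omegaOp R ^ n) P) +
          ((n : MvPolynomial (Fin 2 × Fin 2) R) + 2) * (omegaOp R ^ n) P)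
    have h2 := hnat (n + 2) ((omegaOp R ^ n) P)
    push_cast at h1 h2 ⊢
    rw [h1, map_add, h2, omegaOp_eulerOp]
    ring

/-- At the origin the terms with `det` and `E` vanish. The remaining factors `(n + 1)(n + 2)`
multiply up to `n! (n + 1)!`, which explains the normalization of `omegaFunctional`. -/
theorem constantCoeff_omegaOp_pow_det_mul (n : ℕ) (P : MvPolynomial (Fin 2 × Fin 2) R) :
    constantCoeff ((omegaOp R ^ (n + 1)) ((mvPolynomialX (Fin 2) (Fin 2) R).det * P)) =
      ((n : R) + 1) * ((n : R) + 2) * constantCoeff ((omegaOp R ^ n) P) := by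
  rw [omegaOp_pow_det_mul, eulerOp_apply, ← map_ofNat (C (R := R)) 2]
  simp [Matrix.det_fin_two, mul_assoc]

section Translate

variable {k : Type*} [CommRing k] [Algebra k R]

/-- The substitution `P(y) ↦ P(y g)`. -/
noncomputable def mulRightSubst (g : Matrix (Fin 2) (Fin 2) R) :
    MvPolynomial (Fin 2 × Fin 2) k →ₐ[k] MvPolynomial (Fin 2 × Fin 2) R :=
  aeval fun p => ∑ j, X (p.1, j) * C (g j p.2)

theorem pderiv_mulRightSubst (g : Matrix (Fin 2) (Fin 2) R) (i j : Fin 2)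
    (P : MvPolynomial (Fin 2 × Fin 2) k) :
    pderiv (i, j) (mulRightSubst g P) =
      ∑ l, C (g j l) * mulRightSubst g (pderiv (i, l) P) := by
  classical
  induction P using MvPolynomial.induction_on with
  | C a =>
    simp [mulRightSubst, IsScalarTower.algebraMap_apply k R (MvPolynomial (Fin 2 × Fin 2) R),
      MvPolynomial.algebraMap_eq]
  | add p q hp hq => simp only [map_add, hp, hq, mul_add, Finset.sum_add_distrib]
  | mul_X p x hp =>
    obtain ⟨a, b⟩ := x
    have hX : mulRightSubst (k := k) g (X (a, b)) = ∑ j, X (a, j) * C (g j b) := by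
      simp [mulRightSubst]
    rw [map_mul, Derivation.leibniz, hp, hX]
    simp only [Derivation.leibniz, map_add, smul_eq_mul, map_mul, hX, pderiv_X, mul_add,
      Finset.sum_add_distrib, map_sum, pderiv_C, mul_zero, zero_add]
    congr 1
    · fin_cases a <;> fin_cases b <;> fin_cases i <;> fin_cases j <;>
        simp [Pi.single_apply, mul_comm]
    · rw [Finset.mul_sum]
      exact Finset.sum_congr rfl fun l _ => by ring

/-- `Ω` is the determinant of the matrix of partial derivatives, and by the chain rule each row of
that matrix is transformed by `g`. -/
theorem omegaOp_mulRightSubst (g : Matrix (Fin 2) (Fin 2) R)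
    (P : MvPolynomial (Fin 2 × Fin 2) k) :
    omegaOp R (mulRightSubst g P) = C g.det * mulRightSubst g (omegaOp k P) := by
  have hC : ∀ (i : Fin 2 × Fin 2) (a : R) (Q : MvPolynomial (Fin 2 × Fin 2) R),
      pderiv i (C a * Q) = C a * pderiv i Q := fun i a Q => by
    simp [Derivation.leibniz]
  simp only [omegaOp_apply, pderiv_mulRightSubst, Fin.sum_univ_two, map_add, hC, map_sub,
    Matrix.det_fin_two, map_mul]
  ring

theorem omegaOp_pow_mulRightSubst (g : Matrix (Fin 2) (Fin 2) R) (n : ℕ)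
    (P : MvPolynomial (Fin 2 × Fin 2) k) :
    (omegaOp R ^ n) (mulRightSubst g P) =
      C (g.det ^ n) * mulRightSubst g ((omegaOp k ^ n) P) := by
  induction n generalizing P with
  | zero => simp
  | succ n ih =>
    rw [pow_succ, Module.End.mul_apply, omegaOp_mulRightSubst, ← smul_eq_C_mul, map_smul, ih,
      pow_succ (omegaOp k), Module.End.mul_apply, smul_eq_C_mul, ← mul_assoc, ← C_mul,
      pow_succ' g.det]

theorem constantCoeff_mulRightSubst (g : Matrix (Fin 2) (Fin 2) R)
    (P : MvPolynomial (Fin 2 × Fin 2) k) :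
    constantCoeff (mulRightSubst g P) = algebraMap k R (constantCoeff P) := by
  induction P using MvPolynomial.induction_on with
  | C a =>
    simp [mulRightSubst, IsScalarTower.algebraMap_apply k R (MvPolynomial (Fin 2 × Fin 2) R),
      MvPolynomial.algebraMap_eq]
  | add p q hp hq => simp [hp, hq]
  | mul_X p i hp => simp [mulRightSubst]

end Translate

section Field

variable (k : Type*) [Field k]

/-- The functional `P ↦ Ω^n P(0) / Ω^n det^n` on functions on `2 × 2` matrices. -/
noncomputable def omegaFunctional (n : ℕ) : MvPolynomial (Fin 2 × Fin 2) k →ₗ[k] k :=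
  ((n.factorial : k) * ((n + 1).factorial : k))⁻¹ •
    ((lcoeff k 0) ∘ₗ (omegaOp k ^ n))

variable {k}

theorem omegaFunctional_apply (n : ℕ) (P : MvPolynomial (Fin 2 × Fin 2) k) :
    omegaFunctional k n P = ((n.factorial : k) * ((n + 1).factorial : k))⁻¹ *
      constantCoeff ((omegaOp k ^ n) P) := rfl

variable [CharZero k]

/-- This makes the functional depend only on the fraction `P / det ^ n`, so that it descends to
`C[GL₂]`. -/
theorem omegaFunctional_det_mul (n : ℕ) (P : MvPolynomial (Fin 2 × Fin 2) k) :
    omegaFunctional k (n + 1) ((mvPolynomialX (Fin 2) (Fin 2) k).det * P) =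
      omegaFunctional k n P := by
  have h1 : (n.factorial : k) ≠ 0 := Nat.cast_ne_zero.2 n.factorial_ne_zero
  have h2 : (n : k) + 1 ≠ 0 := by exact_mod_cast Nat.succ_ne_zero n
  have h3 : (n : k) + 2 ≠ 0 := by exact_mod_cast Nat.succ_ne_zero (n + 1)
  have h4 : (n : k) + 1 + 1 ≠ 0 := by exact_mod_cast Nat.succ_ne_zero (n + 1)
  rw [omegaFunctional_apply, omegaFunctional_apply, constantCoeff_omegaOp_pow_det_mul]
  simp only [Nat.factorial_succ]
  push_cast
  field_simp
  ring

theorem omegaFunctional_det_pow_mul (n m : ℕ) (P : MvPolynomial (Fin 2 × Fin 2) k) :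
    omegaFunctional k (n + m) ((mvPolynomialX (Fin 2) (Fin 2) k).det ^ m * P) =
      omegaFunctional k n P := by
  induction m with
  | zero => simp
  | succ m ih => rw [pow_succ', mul_assoc, ← add_assoc, omegaFunctional_det_mul, ih]

end Field

end Omega

/-! ### The invariant integral on `C[GL₂]` -/

section Haar

open MvPolynomial Matrix

theorem map_omegaOp {R S : Type*} [CommRing R] [CommRing S] (f : R →+* S) (n : ℕ)
    (P : MvPolynomial (Fin 2 × Fin 2) R) :
    (omegaOp S ^ n) (MvPolynomial.map f P) = MvPolynomial.map f ((omegaOp R ^ n) P) := by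
  induction n generalizing P with
  | zero => rfl
  | succ n ih =>
    rw [pow_succ, Module.End.mul_apply, pow_succ, Module.End.mul_apply, ← ih]
    simp only [omegaOp_apply, pderiv_map, map_sub]

namespace CoordGL

variable (C : Type u) [Field C]

/-- The determinant, as a function on `GL₂`. -/
noncomputable def detFun : CoordGL C :=
  algebraMap (MvPolynomial (Fin 2 × Fin 2) C) (CoordGL C) (mvPolynomialX (Fin 2) (Fin 2) C).det

theorem isUnit_detFun : IsUnit (detFun C) := IsLocalization.Away.algebraMap_isUnit _

theorem univ_det : (univ C).val.det = detFun C := by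
  rw [detFun, RingHom.map_det]; rfl

theorem powers_det_le : Submonoid.powers (mvPolynomialX (Fin 2) (Fin 2) C).det ≤
    nonZeroDivisors (MvPolynomial (Fin 2 × Fin 2) C) :=
  powers_le_nonZeroDivisors_of_noZeroDivisors (Matrix.det_mvPolynomialX_ne_zero _ _)

instance : IsDomain (CoordGL C) :=
  IsLocalization.isDomain_of_le_nonZeroDivisors (S := CoordGL C) (powers_det_le C)

theorem algebraMap_injective :
    Function.Injective (algebraMap (MvPolynomial (Fin 2 × Fin 2) C) (CoordGL C)) :=
  IsLocalization.injective _ (powers_det_le C)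

variable {C}

theorem exists_mul_detFun_pow (h : CoordGL C) :
    ∃ (n : ℕ) (P : MvPolynomial (Fin 2 × Fin 2) C), h * detFun C ^ n =
      algebraMap (MvPolynomial (Fin 2 × Fin 2) C) (CoordGL C) P :=
  IsLocalization.Away.surj (mvPolynomialX (Fin 2) (Fin 2) C).det h

variable (C) in
/-- Polynomial functions of the first variable with coefficients in the second one. -/
noncomputable def evalLeft :
    MvPolynomial (Fin 2 × Fin 2) (CoordGL C) →+* CoordGL C ⊗[C] CoordGL C :=
  MvPolynomial.eval₂Hom (inR C (CoordGL C) (CoordGL C)).toRingHom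
    fun p => inL C (CoordGL C) (CoordGL C) (univ C p.1 p.2)

theorem evalLeft_map (P : MvPolynomial (Fin 2 × Fin 2) C) :
    evalLeft C (MvPolynomial.map (algebraMap C (CoordGL C)) P) =
      inL C (CoordGL C) (CoordGL C)
        (algebraMap (MvPolynomial (Fin 2 × Fin 2) C) (CoordGL C) P) := by
  induction P using MvPolynomial.induction_on with
  | C a =>
    rw [map_C, ← MvPolynomial.algebraMap_eq, ← IsScalarTower.algebraMap_apply]
    refine (MvPolynomial.eval₂_C _ _ _).trans ?_
    exact (AlgHom.commutes (inR C (CoordGL C) (CoordGL C)) a).trans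
      (AlgHom.commutes (inL C (CoordGL C) (CoordGL C)) a).symm
  | add p q hp hq => simp only [map_add, hp, hq]
  | mul_X p i hp =>
    simp only [map_mul, hp, map_X]
    congr 1
    exact MvPolynomial.eval₂_X _ _ _

/-- The comultiplication is `P(y) ↦ P(y g)`. Seen as a polynomial in `y` with coefficients in
functions of `g`, the result can be fed to `Ω` in the variable `y`. -/
theorem evalLeft_mulRightSubst (P : MvPolynomial (Fin 2 × Fin 2) C) :
    evalLeft C (mulRightSubst (univ C).val P) = Bialgebra.comulAlgHom C (CoordGL C)
      (algebraMap (MvPolynomial (Fin 2 × Fin 2) C) (CoordGL C) P) := by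
  induction P using MvPolynomial.induction_on with
  | C a =>
    have h1 : mulRightSubst (univ C).val (MvPolynomial.C a) =
        MvPolynomial.map (algebraMap C (CoordGL C)) (MvPolynomial.C a) := by
      rw [map_C, ← MvPolynomial.algebraMap_eq, AlgHom.commutes]; rfl
    rw [h1, evalLeft_map, ← MvPolynomial.algebraMap_eq, ← IsScalarTower.algebraMap_apply,
      AlgHom.commutes, AlgHom.commutes]
  | add p q hp hq => simp only [map_add, hp, hq]
  | mul_X p i hp =>
    rw [map_mul, map_mul, hp, map_mul, map_mul]
    congr 1
    have h1 : mulRightSubst (univ C).val (X i : MvPolynomial (Fin 2 × Fin 2) C) =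
        ∑ j, X (i.1, j) * MvPolynomial.C (univ C j i.2) := aeval_X _ _
    have h2 : Bialgebra.comulAlgHom C (CoordGL C) (univ C i.1 i.2) = _ := lift_univ _ i.1 i.2
    rw [h1]
    refine Eq.trans ?_ h2.symm
    rw [map_sum]
    refine Eq.trans (Finset.sum_congr rfl fun j _ => ?_) (Matrix.mul_apply).symm
    rw [map_mul]
    congr 1
    · exact MvPolynomial.eval₂_X _ _ _
    · exact MvPolynomial.eval₂_C _ _ _

variable [CharZero C]

theorem omegaFunctional_eq_of_eq {h : CoordGL C} {n m : ℕ}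
    {P Q : MvPolynomial (Fin 2 × Fin 2) C}
    (hP : h * detFun C ^ n = algebraMap (MvPolynomial (Fin 2 × Fin 2) C) (CoordGL C) P)
    (hQ : h * detFun C ^ m = algebraMap (MvPolynomial (Fin 2 × Fin 2) C) (CoordGL C) Q) :
    omegaFunctional C n P = omegaFunctional C m Q := by
  have key : (mvPolynomialX (Fin 2) (Fin 2) C).det ^ m * P =
      (mvPolynomialX (Fin 2) (Fin 2) C).det ^ n * Q := by
    apply algebraMap_injective C
    rw [map_mul, map_mul, map_pow, map_pow, ← hP, ← hQ]
    change detFun C ^ m * _ = detFun C ^ n * _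
    ring
  rw [← omegaFunctional_det_pow_mul n m P, key, add_comm, omegaFunctional_det_pow_mul]

/-- The Haar functional of `GL₂`, as a function. -/
noncomputable def haarFun (h : CoordGL C) : C :=
  omegaFunctional C (exists_mul_detFun_pow h).choose
    (exists_mul_detFun_pow h).choose_spec.choose

theorem haarFun_eq {h : CoordGL C} {n : ℕ} {P : MvPolynomial (Fin 2 × Fin 2) C}
    (hP : h * detFun C ^ n = algebraMap (MvPolynomial (Fin 2 × Fin 2) C) (CoordGL C) P) :
    haarFun h = omegaFunctional C n P :=
  omegaFunctional_eq_of_eq (exists_mul_detFun_pow h).choose_spec.choose_spec hP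

variable (C) in
/-- The Haar functional `h ↦ ∫ h(γ) dγ` of `GL₂`. -/
noncomputable def haar : CoordGL C →ₗ[C] C where
  toFun := haarFun
  map_add' x y := by
    obtain ⟨n, P, hP⟩ := exists_mul_detFun_pow x
    obtain ⟨m, Q, hQ⟩ := exists_mul_detFun_pow y
    have hP' : x * detFun C ^ (n + m) = algebraMap (MvPolynomial (Fin 2 × Fin 2) C) (CoordGL C)
        ((mvPolynomialX (Fin 2) (Fin 2) C).det ^ m * P) := by
      rw [map_mul, map_pow, ← hP]; change _ = detFun C ^ m * _; ring
    have hQ' : y * detFun C ^ (n + m) = algebraMap (MvPolynomial (Fin 2 × Fin 2) C) (CoordGL C)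
        ((mvPolynomialX (Fin 2) (Fin 2) C).det ^ n * Q) := by
      rw [map_mul, map_pow, ← hQ]; change _ = detFun C ^ n * _; ring
    rw [haarFun_eq hP', haarFun_eq hQ', ← map_add]
    exact haarFun_eq (by rw [add_mul, hP', hQ', map_add])
  map_smul' a x := by
    obtain ⟨n, P, hP⟩ := exists_mul_detFun_pow x
    rw [haarFun_eq hP, RingHom.id_apply, ← map_smul]
    refine haarFun_eq ?_
    rw [smul_mul_assoc, hP, ← IsScalarTower.coe_toAlgHom' C, map_smul]

theorem haar_eq {h : CoordGL C} {n : ℕ} {P : MvPolynomial (Fin 2 × Fin 2) C}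
    (hP : h * detFun C ^ n = algebraMap (MvPolynomial (Fin 2 × Fin 2) C) (CoordGL C) P) :
    haar C h = omegaFunctional C n P := haarFun_eq hP

theorem haar_one : haar C 1 = 1 := by
  rw [haar_eq (n := 0) (P := 1) (by simp), omegaFunctional_apply]
  simp

variable (C) in
/-- The partial integral `H ⊗ H → H` over the first variable. -/
noncomputable def haarLeft : CoordGL C ⊗[C] CoordGL C →ₗ[C] CoordGL C :=
  (TensorProduct.lid C (CoordGL C)).toLinearMap ∘ₗ (haar C).rTensor (CoordGL C)

theorem haarLeft_mul_inR (t : CoordGL C ⊗[C] CoordGL C) (b : CoordGL C) :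
    haarLeft C (inR C (CoordGL C) (CoordGL C) b * t) = b * haarLeft C t := by
  induction t with
  | zero => simp
  | add x y hx hy => simp only [mul_add, map_add, hx, hy]
  | tmul x y => simp [haarLeft]

/-- Partial integration over `y` is given by the same Omega formula, with functions of `g` as
constants. By linearity only a monomial with coefficient matters, and the coefficient pulls out. -/
theorem haarLeft_evalLeft {d : CoordGL C} (hd : d * detFun C = 1) (n : ℕ)
    (Q : MvPolynomial (Fin 2 × Fin 2) (CoordGL C)) :
    haarLeft C (evalLeft C Q * inL C (CoordGL C) (CoordGL C) (d ^ n)) =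
      algebraMap C (CoordGL C) ((n.factorial : C) * ((n + 1).factorial : C))⁻¹ *
        constantCoeff ((omegaOp (CoordGL C) ^ n) Q) := by
  induction Q using MvPolynomial.induction_on' with
  | add p q hp hq => simp only [map_add, add_mul, mul_add, hp, hq]
  | monomial m a =>
    have h1 : monomial m a = MvPolynomial.C a *
        MvPolynomial.map (algebraMap C (CoordGL C)) (monomial m (1 : C)) := by
      rw [map_monomial, C_mul_monomial, map_one, mul_one]
    have h2 : evalLeft C (MvPolynomial.C a) = inR C (CoordGL C) (CoordGL C) a :=
      MvPolynomial.eval₂_C _ _ _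
    have h3 : haarLeft C (inL C (CoordGL C) (CoordGL C)
        (algebraMap (MvPolynomial (Fin 2 × Fin 2) C) (CoordGL C) (monomial m 1) * d ^ n)) =
        algebraMap C (CoordGL C) (omegaFunctional C n (monomial m 1)) := by
      rw [← haar_eq (h := algebraMap (MvPolynomial (Fin 2 × Fin 2) C) (CoordGL C)
        (monomial m 1) * d ^ n) (by rw [mul_assoc, ← mul_pow, hd, one_pow, mul_one])]
      simp [haarLeft, Algebra.algebraMap_eq_smul_one]
    rw [h1, map_mul (evalLeft C), h2, evalLeft_map, mul_assoc, ← map_mul, haarLeft_mul_inR, h3,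
      ← smul_eq_C_mul, map_smul, map_omegaOp, omegaFunctional_apply, map_mul, smul_eq_C_mul,
      map_mul, constantCoeff_C, constantCoeff_map]
    ring

/-- Invariance, `∫ h(y g) dy = ∫ h(y) dy`. The operator `Ω ^ n` sends `P(y g)` to `det(g) ^ n` times
`(Ω ^ n P)(y g)`, and at `y = 0` the dependence on `g` is reduced to this factor, which cancels the
denominator. -/
theorem haarLeft_comul (h : CoordGL C) :
    haarLeft C (Bialgebra.comulAlgHom C (CoordGL C) h) = algebraMap C (CoordGL C) (haar C h) := by
  obtain ⟨n, P, hP⟩ := exists_mul_detFun_pow h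
  obtain ⟨d, hd⟩ := (isUnit_detFun C).exists_left_inv
  have hdet : Bialgebra.comulAlgHom C (CoordGL C) (detFun C) =
      inL C (CoordGL C) (CoordGL C) (detFun C) * inR C (CoordGL C) (CoordGL C) (detFun C) := by
    have h1 : (univ C).val.map (Bialgebra.comulAlgHom C (CoordGL C)) =
        (univ C).val.map (inL C (CoordGL C) (CoordGL C)) *
          (univ C).val.map (inR C (CoordGL C) (CoordGL C)) :=
      congrArg Units.val (mapGL_lift (C := C) _)
    rw [← univ_det, AlgHom.map_det, AlgHom.map_det, AlgHom.map_det, AlgHom.mapMatrix_apply,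
      AlgHom.mapMatrix_apply, AlgHom.mapMatrix_apply, h1, Matrix.det_mul]
  -- If `h = P / det ^ n`, then `P(y g) det(y)⁻ⁿ = det(g) ^ n h(y g)`.
  have h1 : evalLeft C (mulRightSubst (univ C).val P) * inL C (CoordGL C) (CoordGL C) (d ^ n) =
      inR C (CoordGL C) (CoordGL C) (detFun C ^ n) * Bialgebra.comulAlgHom C (CoordGL C) h := by
    rw [evalLeft_mulRightSubst, ← hP, map_mul, map_pow, hdet, mul_pow, ← map_pow, ← map_pow]
    calc _ = Bialgebra.comulAlgHom C (CoordGL C) h *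
          (inL C (CoordGL C) (CoordGL C) (detFun C ^ n * d ^ n) *
            inR C (CoordGL C) (CoordGL C) (detFun C ^ n)) := by rw [map_mul]; ring
      _ = _ := by rw [mul_comm (detFun C ^ n), ← mul_pow, hd, one_pow, map_one, one_mul, mul_comm]
  have h2 := haarLeft_evalLeft hd n (mulRightSubst (univ C).val P)
  rw [h1, haarLeft_mul_inR, omegaOp_pow_mulRightSubst, map_mul, constantCoeff_C,
    constantCoeff_mulRightSubst, univ_det] at h2
  rw [haar_eq hP, omegaFunctional_apply, map_mul]
  have hu : IsUnit (detFun C ^ n) := (isUnit_detFun C).pow n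
  refine hu.mul_left_cancel (h2.trans ?_)
  ring

end CoordGL

end Haar

/-! ### Comodules and linear reductivity of `GL₂` -/

/-- Right comodules over a bialgebra, i.e. linear representations of an affine monoid scheme. -/
structure RightComodule (k H : Type u) [Field k] [CommRing H] [Bialgebra k H] where
  carrier : Type u
  [addCommGroup : AddCommGroup carrier]
  [module : Module k carrier]
  coact : carrier →ₗ[k] carrier ⊗[k] H
  coassoc : ∀ m : carrier, TensorProduct.assoc k carrier H H (coact.rTensor H (coact m)) =
    (Coalgebra.comul (R := k) (A := H)).lTensor carrier (coact m)
  counit : ∀ m : carrier, TensorProduct.rid k carrier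
    ((Coalgebra.counit (R := k) (A := H)).lTensor carrier (coact m)) = m

attribute [instance] RightComodule.addCommGroup RightComodule.module

/-- The representation underlying an equivariant module. -/
def EquivariantModule.toComodule {k H A : Type u} [Field k] [CommRing H] [Bialgebra k H]
    [CommRing A] [Algebra k A] {act : A →ₐ[k] A ⊗[k] H} (M : EquivariantModule act) :
    RightComodule k H where
  carrier := M.carrier
  coact := M.coact
  coassoc := M.coassoc
  counit := M.counit

/-- The trivial one-dimensional representation. -/
noncomputable def RightComodule.trivial (k H : Type u) [Field k] [CommRing H] [Bialgebra k H] :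
    RightComodule k H where
  carrier := k
  coact := (TensorProduct.mk k k H).flip 1
  coassoc m := by simp [Algebra.TensorProduct.one_def]
  counit m := by simp

namespace CoordGL

variable (C : Type u) [Field C]

/-- The antipode `h ↦ (γ ↦ h (γ⁻¹))`. -/
noncomputable def antipode : CoordGL C →ₐ[C] CoordGL C := lift (univ C)⁻¹

/-- The function `(γ, g) ↦ x (g γ⁻¹)`. -/
noncomputable def divRight : CoordGL C →ₐ[C] CoordGL C ⊗[C] CoordGL C :=
  lift (mapGL (inR C (CoordGL C) (CoordGL C)) (univ C) *
    (mapGL (inL C (CoordGL C) (CoordGL C)) (univ C))⁻¹)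

theorem divRight_eq : divRight C = ((Algebra.TensorProduct.map (antipode C)
    (AlgHom.id C (CoordGL C))).comp
      (Algebra.TensorProduct.comm C (CoordGL C) (CoordGL C)).toAlgHom).comp
        (Bialgebra.comulAlgHom C (CoordGL C)) := by
  apply hom_ext
  have h1 : ∀ x : GL (Fin 2) (CoordGL C),
      mapGL (Algebra.TensorProduct.comm C (CoordGL C) (CoordGL C)).toAlgHom
        (mapGL (inL C (CoordGL C) (CoordGL C)) x) = mapGL (inR C (CoordGL C) (CoordGL C)) x := by
    intro x; ext i j; simp [mapGL_apply]
  have h2 : ∀ x : GL (Fin 2) (CoordGL C),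
      mapGL (Algebra.TensorProduct.comm C (CoordGL C) (CoordGL C)).toAlgHom
        (mapGL (inR C (CoordGL C) (CoordGL C)) x) = mapGL (inL C (CoordGL C) (CoordGL C)) x := by
    intro x; ext i j; simp [mapGL_apply]
  rw [divRight, mapGL_lift, mapGL_comp, mapGL_comp, comulAlgHom_eq, mapGL_lift, map_mul, h1, h2,
    map_mul, mapGL_map_right, mapGL_map_left, mapGL_id, antipode, mapGL_lift, map_inv]

variable [CharZero C]

/-- The pairing `(x, h) ↦ ∫ x(γ⁻¹) h(γ) dγ`. -/
noncomputable def pairing : CoordGL C →ₗ[C] CoordGL C →ₗ[C] C :=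
  (((LinearMap.mul C (CoordGL C)).compr₂ (haar C))) ∘ₗ (antipode C).toLinearMap

variable {C}

theorem pairing_apply (x h : CoordGL C) : pairing C x h = haar C (antipode C x * h) := rfl

/-- The change of variables `γ ↦ γ g` in an integrand that may itself depend on `g`. -/
theorem haarLeft_comul_mul_inR (t : CoordGL C ⊗[C] CoordGL C) :
    haarLeft C (Algebra.TensorProduct.productMap (Bialgebra.comulAlgHom C (CoordGL C))
      (inR C (CoordGL C) (CoordGL C)) t) = haarLeft C t := by
  induction t with
  | zero => simp
  | add x y hx hy => simp only [map_add, hx, hy]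
  | tmul a b =>
    rw [Algebra.TensorProduct.productMap_apply_tmul, mul_comm, haarLeft_mul_inR, haarLeft_comul]
    simp [haarLeft, Algebra.algebraMap_eq_smul_one]

/-- The function `∫ x(g γ⁻¹) h(γ) dγ = ∫ x(γ⁻¹) h(γ g) dγ` of `g`. -/
theorem haarLeft_divRight_mul (x h : CoordGL C) :
    haarLeft C (divRight C x * inL C (CoordGL C) (CoordGL C) h) =
      haarLeft C (inL C (CoordGL C) (CoordGL C) (antipode C x) *
        Bialgebra.comulAlgHom C (CoordGL C) h) := by
  rw [← haarLeft_comul_mul_inR, map_mul]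
  congr 2
  · have : (Algebra.TensorProduct.productMap (Bialgebra.comulAlgHom C (CoordGL C))
        (inR C (CoordGL C) (CoordGL C))).comp (divRight C) =
        (inL C (CoordGL C) (CoordGL C)).comp (antipode C) := by
      apply hom_ext
      have h1 : ∀ x : GL (Fin 2) (CoordGL C),
          mapGL (Algebra.TensorProduct.productMap (Bialgebra.comulAlgHom C (CoordGL C))
            (inR C (CoordGL C) (CoordGL C))) (mapGL (inL C (CoordGL C) (CoordGL C)) x) =
          mapGL (Bialgebra.comulAlgHom C (CoordGL C)) x := by
        intro x; ext i j; simp [mapGL_apply, ← Algebra.TensorProduct.one_def]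
      have h2 : ∀ x : GL (Fin 2) (CoordGL C),
          mapGL (Algebra.TensorProduct.productMap (Bialgebra.comulAlgHom C (CoordGL C))
            (inR C (CoordGL C) (CoordGL C))) (mapGL (inR C (CoordGL C) (CoordGL C)) x) =
          mapGL (inR C (CoordGL C) (CoordGL C)) x := by
        intro x; ext i j; simp [mapGL_apply]
      rw [mapGL_comp, mapGL_comp, divRight, antipode, mapGL_lift, mapGL_lift, map_mul, map_inv,
        h1, h2, comulAlgHom_eq, mapGL_lift, _root_.mul_inv_rev, mul_inv_cancel_left, map_inv]
    exact AlgHom.congr_fun this x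
  · simp [← Algebra.TensorProduct.one_def]

/-- Translation by `g` can be moved from one argument of the pairing to the other. This is
invariance of the integral in the form needed for the equivariance of `retract`. -/
theorem sum_smul_pairing (x h : CoordGL C) :
    TensorProduct.rid C (CoordGL C) (((pairing C).flip h).lTensor (CoordGL C)
        (Coalgebra.comul (R := C) x)) =
      TensorProduct.lid C (CoordGL C) ((pairing C x).rTensor (CoordGL C)
        (Coalgebra.comul (R := C) h)) := by
  have h1 : TensorProduct.rid C (CoordGL C) (((pairing C).flip h).lTensor (CoordGL C)
      (Coalgebra.comul (R := C) x)) =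
      haarLeft C (divRight C x * inL C (CoordGL C) (CoordGL C) h) := by
    rw [divRight_eq, AlgHom.comp_apply]
    change _ = haarLeft C (_ * _)
    rw [Bialgebra.comulAlgHom_apply]
    generalize Coalgebra.comul (R := C) x = t
    induction t with
    | zero => simp
    | add x y hx hy => simp only [map_add, add_mul, hx, hy]
    | tmul y z => simp [haarLeft, pairing_apply]
  have h2 : TensorProduct.lid C (CoordGL C) ((pairing C x).rTensor (CoordGL C)
        (Coalgebra.comul (R := C) h)) = haarLeft C (inL C (CoordGL C) (CoordGL C) (antipode C x) *
        Bialgebra.comulAlgHom C (CoordGL C) h) := by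
    rw [Bialgebra.comulAlgHom_apply]
    generalize Coalgebra.comul (R := C) h = t
    induction t with
    | zero => simp
    | add x y hx hy => simp only [map_add, mul_add, hx, hy]
    | tmul y z => simp [haarLeft, pairing_apply]
  rw [h1, h2, haarLeft_divRight_mul]

/-- Here the integrand is `h(γ⁻¹ γ) = h(1)`, and the total mass is one. -/
theorem lift_pairing_comul (h : CoordGL C) :
    TensorProduct.lift (pairing C) (Coalgebra.comul (R := C) h) =
      Coalgebra.counit (R := C) h := by
  have h1 : (Algebra.TensorProduct.productMap (antipode C) (AlgHom.id C (CoordGL C))).comp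
      (Bialgebra.comulAlgHom C (CoordGL C)) =
      (Algebra.ofId C (CoordGL C)).comp (Bialgebra.counitAlgHom C (CoordGL C)) := by
    apply hom_ext
    have h1 : ∀ x : GL (Fin 2) (CoordGL C),
        mapGL (Algebra.TensorProduct.productMap (antipode C) (AlgHom.id C (CoordGL C)))
          (mapGL (inL C (CoordGL C) (CoordGL C)) x) = mapGL (antipode C) x := by
      intro x; ext i j; simp [mapGL_apply]
    have h2 : ∀ x : GL (Fin 2) (CoordGL C),
        mapGL (Algebra.TensorProduct.productMap (antipode C) (AlgHom.id C (CoordGL C)))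
          (mapGL (inR C (CoordGL C) (CoordGL C)) x) = x := by
      intro x; ext i j; simp [mapGL_apply]
    rw [mapGL_comp, mapGL_comp, comulAlgHom_eq, mapGL_lift, map_mul, h1, h2, antipode, mapGL_lift,
      counitAlgHom_eq, mapGL_lift, map_one, inv_mul_cancel]
  have h2 := AlgHom.congr_fun h1 h
  have h3 : ∀ t : CoordGL C ⊗[C] CoordGL C, TensorProduct.lift (pairing C) t =
      haar C (Algebra.TensorProduct.productMap (antipode C) (AlgHom.id C (CoordGL C)) t) := by
    intro t
    induction t with
    | zero => simp
    | add x y hx hy => simp only [map_add, hx, hy]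
    | tmul y z => simp [pairing_apply]
  rw [h3]
  rw [AlgHom.comp_apply, Bialgebra.comulAlgHom_apply] at h2
  rw [h2, AlgHom.comp_apply, Bialgebra.counitAlgHom_apply, Algebra.ofId_apply,
    Algebra.algebraMap_eq_smul_one, map_smul, haar_one, smul_eq_mul, mul_one]

end CoordGL

namespace RightComodule

variable {C : Type u} [Field C] [CharZero C] (V M N : RightComodule C (CoordGL C))

/-- The map `m ⊗ h ↦ ∫ (γ⁻¹ · m) h(γ) dγ`. -/
noncomputable def retract : M.carrier ⊗[C] CoordGL C →ₗ[C] M.carrier :=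
  (TensorProduct.rid C M.carrier).toLinearMap ∘ₗ
    (TensorProduct.lift (CoordGL.pairing C)).lTensor M.carrier ∘ₗ
      (TensorProduct.assoc C M.carrier (CoordGL C) (CoordGL C)).toLinearMap ∘ₗ
        M.coact.rTensor (CoordGL C)

theorem retract_tmul (m : M.carrier) (h : CoordGL C) : M.retract (m ⊗ₜ h) =
    TensorProduct.rid C M.carrier (((CoordGL.pairing C).flip h).lTensor M.carrier (M.coact m)) := by
  simp only [retract, LinearMap.comp_apply, LinearMap.rTensor_tmul, LinearEquiv.coe_coe]
  generalize M.coact m = t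
  induction t with
  | zero => simp
  | add x y hx hy => simp only [map_add, TensorProduct.add_tmul, hx, hy]
  | tmul x y => simp

/-- The integral is `∫ γ⁻¹ γ m dγ = m`. So the coaction embeds `M` as a direct summand of `M ⊗ H`,
once `retract` is known to be equivariant. -/
theorem retract_coact (m : M.carrier) : M.retract (M.coact m) = m := by
  simp only [retract, LinearMap.comp_apply, LinearEquiv.coe_coe]
  rw [M.coassoc, ← LinearMap.lTensor_comp_apply]
  have : TensorProduct.lift (CoordGL.pairing C) ∘ₗ Coalgebra.comul (R := C) (A := CoordGL C) =
      Coalgebra.counit := LinearMap.ext CoordGL.lift_pairing_comul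
  rw [this, M.counit]

/-- The group acts on `M ⊗ H` by right translation of `H` alone. Substituting `γ g` for `γ` turns `g
∫ γ⁻¹ m h(γ) dγ` into `∫ γ⁻¹ m h(γ g) dγ`. -/
theorem coact_retract (t : M.carrier ⊗[C] CoordGL C) :
    M.coact (M.retract t) = M.retract.rTensor (CoordGL C)
      ((TensorProduct.assoc C M.carrier (CoordGL C) (CoordGL C)).symm
        ((Coalgebra.comul (R := C) (A := CoordGL C)).lTensor M.carrier t)) := by
  induction t with
  | zero => simp
  | add x y hx hy => simp only [map_add, hx, hy]
  | tmul m h =>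
    have h1 : M.coact (M.retract (m ⊗ₜ h)) = TensorProduct.rid C (M.carrier ⊗[C] CoordGL C)
        (((CoordGL.pairing C).flip h).lTensor (M.carrier ⊗[C] CoordGL C)
          ((TensorProduct.assoc C M.carrier (CoordGL C) (CoordGL C)).symm
            ((Coalgebra.comul (R := C) (A := CoordGL C)).lTensor M.carrier (M.coact m)))) := by
      rw [← M.coassoc, LinearEquiv.symm_apply_apply, retract_tmul]
      generalize M.coact m = t
      induction t with
      | zero => simp
      | add x y hx hy => simp only [map_add, hx, hy]
      | tmul x y => simp
    have h2 : M.retract.rTensor (CoordGL C)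
      ((TensorProduct.assoc C M.carrier (CoordGL C) (CoordGL C)).symm
        ((Coalgebra.comul (R := C) (A := CoordGL C)).lTensor M.carrier (m ⊗ₜ h))) =
        (LinearMap.lTensor M.carrier ((TensorProduct.lid C (CoordGL C)).toLinearMap ∘ₗ
          LinearMap.rTensor (CoordGL C) (TensorProduct.lift (CoordGL.pairing C)) ∘ₗ
          (TensorProduct.assoc C _ _ _).symm.toLinearMap ∘ₗ
          (TensorProduct.mk C (CoordGL C) (CoordGL C ⊗[C] CoordGL C)).flip
            (Coalgebra.comul (R := C) h))) (M.coact m) := by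
      rw [LinearMap.lTensor_tmul]
      generalize Coalgebra.comul (R := C) h = s
      induction s with
      | zero => simp
      | add x y hx hy =>
        simp only [TensorProduct.tmul_add, map_add, hx, hy, LinearMap.comp_add,
          LinearMap.lTensor_add, LinearMap.add_apply]
      | tmul a b =>
        rw [TensorProduct.assoc_symm_tmul, LinearMap.rTensor_tmul, retract_tmul]
        generalize M.coact m = t
        induction t with
        | zero => simp
        | add x y hx hy => simp only [map_add, TensorProduct.add_tmul, hx, hy]
        | tmul x y => simp [TensorProduct.smul_tmul]
    rw [h1, h2]
    generalize M.coact m = t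
    induction t with
    | zero => simp
    | add x y hx hy => simp only [map_add, hx, hy]
    | tmul x y =>
      have h3 := congrArg (fun z => x ⊗ₜ[C] z) (CoordGL.sum_smul_pairing y h)
      simp only [LinearMap.lTensor_tmul, LinearMap.comp_apply, LinearEquiv.coe_coe,
        LinearMap.flip_apply, TensorProduct.mk_apply] at h3 ⊢
      refine Eq.trans ?_ (h3.trans ?_)
      · generalize Coalgebra.comul (R := C) y = s
        induction s with
        | zero => simp
        | add x y hx hy => simp only [TensorProduct.tmul_add, map_add, hx, hy]
        | tmul a b => simp
      · congr 1
        generalize Coalgebra.comul (R := C) h = s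
        induction s with
        | zero => simp
        | add x y hx hy => simp only [TensorProduct.tmul_add, map_add, hx, hy]
        | tmul a b => simp

variable {V M N}

/-- The average of a linear map between representations. -/
noncomputable def average (l : V.carrier →ₗ[C] M.carrier) : V.carrier →ₗ[C] M.carrier :=
  M.retract ∘ₗ l.rTensor (CoordGL C) ∘ₗ V.coact

theorem coact_average (l : V.carrier →ₗ[C] M.carrier) (v : V.carrier) :
    M.coact (average l v) = (average l).rTensor (CoordGL C) (V.coact v) := by
  rw [average, LinearMap.comp_apply, LinearMap.comp_apply, coact_retract,
    LinearMap.rTensor_comp_apply, LinearMap.rTensor_comp_apply]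
  congr 1
  have h1 := V.coassoc v
  rw [← LinearEquiv.eq_symm_apply] at h1
  rw [h1]
  generalize V.coact v = t
  induction t with
  | zero => simp
  | add x y hx hy => simp only [map_add, hx, hy]
  | tmul x h =>
    simp only [LinearMap.rTensor_tmul, LinearMap.lTensor_tmul]
    generalize Coalgebra.comul (R := C) h = s
    induction s with
    | zero => simp
    | add x y hx hy => simp only [TensorProduct.tmul_add, map_add, hx, hy]
    | tmul a b => simp

/-- Averaging commutes with the equivariant map `p` and fixes the map `p ∘ l`, which is already
equivariant. So an arbitrary linear lift of an equivariant map becomes an equivariant lift. -/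
theorem comp_average (l : V.carrier →ₗ[C] M.carrier) (p : M.carrier →ₗ[C] N.carrier)
    (hp : ∀ m, N.coact (p m) = p.rTensor (CoordGL C) (M.coact m))
    (hpl : ∀ v, N.coact (p (l v)) = (p ∘ₗ l).rTensor (CoordGL C) (V.coact v)) (v : V.carrier) :
    p (average l v) = p (l v) := by
  have h1 : ∀ t, p (M.retract t) = N.retract (p.rTensor (CoordGL C) t) := by
    intro t
    induction t with
    | zero => simp
    | add x y hx hy => simp only [map_add, hx, hy]
    | tmul m h =>
      rw [LinearMap.rTensor_tmul, retract_tmul, retract_tmul, hp]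
      generalize M.coact m = t
      induction t with
      | zero => simp
      | add x y hx hy => simp only [map_add, hx, hy]
      | tmul x y => simp
  rw [average, LinearMap.comp_apply, LinearMap.comp_apply, h1, ← LinearMap.rTensor_comp_apply,
    ← hpl, retract_coact]

end RightComodule

/-! ### Twists of equivariant modules by representations -/

namespace EquivariantModule

section Star

variable {k : Type*} [CommRing k] (M V : Type*) [AddCommGroup M] [Module k M] [AddCommGroup V]
  [Module k V] (L : Type*) [CommRing L] [Algebra k L]

/-- The map `(m ⊗ a, v ⊗ b) ↦ (m ⊗ v) ⊗ a b`. -/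
noncomputable def star : M ⊗[k] L →ₗ[k] V ⊗[k] L →ₗ[k] (M ⊗[k] V) ⊗[k] L :=
  TensorProduct.map₂ (TensorProduct.mk k M V) (LinearMap.mul k L)

variable {M V L}

@[simp] theorem star_tmul (m : M) (a : L) (v : V) (b : L) :
    star M V L (m ⊗ₜ[k] a) (v ⊗ₜ[k] b) = (m ⊗ₜ[k] v) ⊗ₜ[k] (a * b) := by
  simp [star, TensorProduct.map₂_apply_tmul]

variable (M V L)

/-- The coaction on a tensor product. -/
noncomputable def tensorCoact (c : M →ₗ[k] M ⊗[k] L) (d : V →ₗ[k] V ⊗[k] L) :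
    M ⊗[k] V →ₗ[k] (M ⊗[k] V) ⊗[k] L :=
  TensorProduct.lift ((star M V L).compl₁₂ c d)

variable {M V L}

@[simp] theorem tensorCoact_tmul (c : M →ₗ[k] M ⊗[k] L) (d : V →ₗ[k] V ⊗[k] L) (m : M) (v : V) :
    tensorCoact M V L c d (m ⊗ₜ v) = star M V L (c m) (d v) := by
  simp [tensorCoact]

theorem assoc_tensorCoact_star (c : M →ₗ[k] M ⊗[k] L) (d : V →ₗ[k] V ⊗[k] L) (t : M ⊗[k] L)
    (s : V ⊗[k] L) :
    TensorProduct.assoc k (M ⊗[k] V) L L ((tensorCoact M V L c d).rTensor L (star M V L t s)) =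
      star M V (L ⊗[k] L) (TensorProduct.assoc k M L L (c.rTensor L t))
        (TensorProduct.assoc k V L L (d.rTensor L s)) := by
  induction t with
  | zero => simp
  | add x y hx hy => simp only [map_add, LinearMap.add_apply, hx, hy]
  | tmul m a =>
    induction s with
    | zero => simp
    | add x y hx hy => simp only [map_add, hx, hy]
    | tmul v b =>
      simp only [star_tmul, LinearMap.rTensor_tmul, tensorCoact_tmul]
      generalize c m = t
      generalize d v = s
      induction t with
      | zero => simp
      | add x y hx hy => simp only [map_add, LinearMap.add_apply, TensorProduct.add_tmul, hx, hy]
      | tmul m a =>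
        induction s with
        | zero => simp
        | add x y hx hy => simp only [map_add, TensorProduct.add_tmul, hx, hy]
        | tmul v b => simp

theorem lTensor_star {L' : Type*} [CommRing L'] [Algebra k L'] (f : L →ₐ[k] L') (t : M ⊗[k] L)
    (s : V ⊗[k] L) : f.toLinearMap.lTensor (M ⊗[k] V) (star M V L t s) =
      star M V L' (f.toLinearMap.lTensor M t) (f.toLinearMap.lTensor V s) := by
  induction t with
  | zero => simp
  | add x y hx hy => simp only [map_add, LinearMap.add_apply, hx, hy]
  | tmul m a =>
    induction s with
    | zero => simp
    | add x y hx hy => simp only [map_add, hx, hy]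
    | tmul v b => simp

theorem rid_star (t : M ⊗[k] k) (s : V ⊗[k] k) :
    TensorProduct.rid k (M ⊗[k] V) (star M V k t s) =
      TensorProduct.rid k M t ⊗ₜ TensorProduct.rid k V s := by
  induction t with
  | zero => simp
  | add x y hx hy => simp only [map_add, LinearMap.add_apply, TensorProduct.add_tmul, hx, hy]
  | tmul m a =>
    induction s with
    | zero => simp
    | add x y hx hy => simp only [map_add, TensorProduct.tmul_add, hx, hy]
    | tmul v b => simp [TensorProduct.smul_tmul', mul_comm a b, mul_smul]

theorem star_rTensor {M' V' : Type*} [AddCommGroup M'] [Module k M'] [AddCommGroup V']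
    [Module k V'] (f : M →ₗ[k] M') (g : V →ₗ[k] V') (t : M ⊗[k] L) (s : V ⊗[k] L) :
    star M' V' L (f.rTensor L t) (g.rTensor L s) =
      (TensorProduct.map f g).rTensor L (star M V L t s) := by
  induction t with
  | zero => simp
  | add x y hx hy => simp only [map_add, LinearMap.add_apply, hx, hy]
  | tmul m a =>
    induction s with
    | zero => simp
    | add x y hx hy => simp only [map_add, hx, hy]
    | tmul v b => simp

theorem tensorCoact_map {M' V' : Type*} [AddCommGroup M'] [Module k M'] [AddCommGroup V']
    [Module k V'] (c : M →ₗ[k] M ⊗[k] L) (c' : M' →ₗ[k] M' ⊗[k] L) (d : V →ₗ[k] V ⊗[k] L)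
    (d' : V' →ₗ[k] V' ⊗[k] L) (f : M →ₗ[k] M') (g : V →ₗ[k] V')
    (hf : ∀ m, c' (f m) = f.rTensor L (c m)) (hg : ∀ v, d' (g v) = g.rTensor L (d v))
    (x : M ⊗[k] V) : tensorCoact M' V' L c' d' (TensorProduct.map f g x) =
      (TensorProduct.map f g).rTensor L (tensorCoact M V L c d x) := by
  induction x with
  | zero => simp
  | add x y hx hy => simp only [map_add, hx, hy]
  | tmul m v => rw [TensorProduct.map_tmul, tensorCoact_tmul, tensorCoact_tmul, hf, hg,
      star_rTensor]

theorem star_map₂_smul {A : Type*} [CommRing A] [Algebra k A] [Module A M] [IsScalarTower k A M]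
    (r : A ⊗[k] L) (t : M ⊗[k] L) (s : V ⊗[k] L) :
    star M V L (TensorProduct.map₂ (Algebra.lsmul k k M).toLinearMap (LinearMap.mul k L) r t) s =
      TensorProduct.map₂ (Algebra.lsmul k k (M ⊗[k] V)).toLinearMap (LinearMap.mul k L) r
        (star M V L t s) := by
  induction r with
  | zero => simp
  | add x y hx hy => simp only [map_add, LinearMap.add_apply, hx, hy]
  | tmul a b =>
    induction t with
    | zero => simp
    | add x y hx hy => simp only [map_add, LinearMap.add_apply, hx, hy]
    | tmul m a =>
      induction s with
      | zero => simp
      | add x y hx hy => simp only [map_add, hx, hy]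
      | tmul v b =>
        simp [TensorProduct.map₂_apply_tmul, TensorProduct.smul_tmul', mul_assoc]

end Star

variable {k H A : Type u} [Field k] [CommRing H] [Bialgebra k H] [CommRing A] [Algebra k A]
  {act : A →ₐ[k] A ⊗[k] H}

/-- The twist of an equivariant module by a representation. -/
noncomputable def twist (M : EquivariantModule act) (V : RightComodule k H) :
    EquivariantModule act where
  carrier := M.carrier ⊗[k] V.carrier
  coact := tensorCoact _ _ _ M.coact V.coact
  coassoc x := by
    induction x with
    | zero => simp
    | add x y hx hy => simp only [map_add, hx, hy]
    | tmul m v =>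
      rw [tensorCoact_tmul, assoc_tensorCoact_star, M.coassoc, V.coassoc]
      exact (lTensor_star (Bialgebra.comulAlgHom k H) _ _).symm
  counit x := by
    induction x with
    | zero => simp
    | add x y hx hy => simp only [map_add, hx, hy]
    | tmul m v =>
      rw [tensorCoact_tmul]
      refine (congrArg _ (lTensor_star (Bialgebra.counitAlgHom k H) _ _)).trans ?_
      rw [rid_star]
      exact congrArg₂ _ (M.counit m) (V.counit v)
  coact_smul a x := by
    induction x with
    | zero => simp
    | add x y hx hy => simp only [smul_add, map_add, hx, hy]
    | tmul m v =>
      rw [TensorProduct.smul_tmul', tensorCoact_tmul, tensorCoact_tmul, M.coact_smul,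
        star_map₂_smul]

theorem twist_coact_tmul (M : EquivariantModule act) (V : RightComodule k H) (m : M.carrier)
    (v : V.carrier) : (twist M V).coact (m ⊗ₜ v) = star _ _ _ (M.coact m) (V.coact v) :=
  tensorCoact_tmul _ _ _ _

/-- Functoriality of the twist. -/
noncomputable def twistMap {M N : EquivariantModule act} (f : M ⟶ N) (V : RightComodule k H) :
    twist M V ⟶ twist N V where
  toLin := TensorProduct.AlgebraTensorModule.map f.toLin LinearMap.id
  comm x := tensorCoact_map M.coact N.coact V.coact V.coact (f.toLin.restrictScalars k)
    LinearMap.id f.comm (fun v => by rw [LinearMap.rTensor_id]; rfl) x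

/-- A morphism out of a twist, checked on pure tensors. -/
theorem twist_hom_ext {M N : EquivariantModule act} {V : RightComodule k H}
    {f g : twist M V ⟶ N} (h : ∀ m v, f.toLin (m ⊗ₜ v) = g.toLin (m ⊗ₜ v)) : f = g := by
  ext x
  refine TensorProduct.induction_on x ?_ h fun x y hx hy => ?_
  · exact (map_zero f.toLin).trans (map_zero g.toLin).symm
  · exact (map_add f.toLin x y).trans ((congrArg₂ _ hx hy).trans (map_add g.toLin x y).symm)

end EquivariantModule

/-! ### Free equivariant modules and their projectivity -/

section Free

variable {C : Type u} [Field C] {q : ℕ}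

open EquivariantModule

theorem coact_smul_of_invariant {M : QCohXModG C q} (m : M.carrier) (hm : M.coact m = m ⊗ₜ 1)
    (a : CoordX C q) : M.coact (a • m) =
      ((LinearMap.toSpanSingleton (CoordX C q) M.carrier m).restrictScalars C).rTensor
        (CoordGL C) (CoordX.act C q a) := by
  rw [M.coact_smul, hm]
  generalize CoordX.act C q a = t
  induction t with
  | zero => simp
  | add x y hx hy => simp only [map_add, LinearMap.add_apply, hx, hy]
  | tmul x y => simp [TensorProduct.map₂_apply_tmul]

/-- The morphism from the structure sheaf given by an invariant section. -/
noncomputable def ofInvariant {M : QCohXModG C q} (m : M.carrier) (hm : M.coact m = m ⊗ₜ 1) :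
    structureSheafX C q ⟶ M where
  toLin := LinearMap.toSpanSingleton (CoordX C q) M.carrier m
  comm := coact_smul_of_invariant m hm

theorem coact_apply_one {M : QCohXModG C q} (f : structureSheafX C q ⟶ M) :
    M.coact (f.toLin (1 : CoordX C q)) = f.toLin (1 : CoordX C q) ⊗ₜ 1 := by
  refine (f.comm (1 : CoordX C q)).trans ?_
  have : (structureSheafX C q).coact (1 : CoordX C q) = (1 : CoordX C q) ⊗ₜ (1 : CoordGL C) :=
    map_one (CoordX.act C q)
  rw [this]
  rfl

theorem structureSheafX_hom_ext {M : QCohXModG C q} {f g : structureSheafX C q ⟶ M}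
    (h : f.toLin (1 : CoordX C q) = g.toLin (1 : CoordX C q)) : f = g := by
  ext (a : CoordX C q)
  have hf : f.toLin (a • (1 : CoordX C q)) = a • f.toLin (1 : CoordX C q) := map_smul f.toLin a _
  have hg : g.toLin (a • (1 : CoordX C q)) = a • g.toLin (1 : CoordX C q) := map_smul g.toLin a _
  rw [smul_eq_mul, mul_one] at hf hg
  rw [hf, hg, h]

variable (q) in
/-- The free equivariant module on a representation. -/
noncomputable abbrev freeOn (V : RightComodule C (CoordGL C)) : QCohXModG C q :=
  twist (structureSheafX C q) V

theorem freeOn_coact_one_tmul (V : RightComodule C (CoordGL C)) (v : V.carrier) :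
    (freeOn q V).coact ((1 : CoordX C q) ⊗ₜ[C] v) =
      (TensorProduct.mk C (CoordX C q) V.carrier 1).rTensor (CoordGL C) (V.coact v) := by
  refine (twist_coact_tmul (structureSheafX C q) V (1 : CoordX C q) v).trans ?_
  have : (structureSheafX C q).coact (1 : CoordX C q) = (1 : CoordX C q) ⊗ₜ (1 : CoordGL C) :=
    map_one (CoordX.act C q)
  rw [this]
  generalize V.coact v = t
  induction t with
  | zero => exact (map_zero _).trans (map_zero _).symm
  | add x y hx hy => exact (map_add _ x y).trans ((congrArg₂ _ hx hy).trans (map_add _ x y).symm)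
  | tmul x y =>
    refine (star_tmul _ _ _ _).trans ?_
    rw [one_mul]
    rfl

theorem coact_liftBaseChange {V : RightComodule C (CoordGL C)} {M : QCohXModG C q}
    (g : V.carrier →ₗ[C] M.carrier)
    (hg : ∀ v, M.coact (g v) = g.rTensor (CoordGL C) (V.coact v))
    (x : CoordX C q ⊗[C] V.carrier) :
    M.coact (g.liftBaseChange (CoordX C q) x) =
      ((g.liftBaseChange (CoordX C q)).restrictScalars C).rTensor (CoordGL C)
        (tensorCoact (CoordX C q) V.carrier (CoordGL C) (CoordX.act C q).toLinearMap V.coact x) := by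
  induction x with
  | zero => simp
  | add x y hx hy => simp only [map_add, hx, hy]
  | tmul a v =>
    rw [LinearMap.liftBaseChange_tmul, M.coact_smul, hg, tensorCoact_tmul,
      AlgHom.toLinearMap_apply]
    generalize CoordX.act C q a = t
    generalize V.coact v = s
    induction t with
    | zero => simp
    | add x y hx hy => simp only [map_add, LinearMap.add_apply, hx, hy]
    | tmul a h =>
      induction s with
      | zero => simp
      | add x y hx hy => simp only [map_add, hx, hy]
      | tmul v b => simp [TensorProduct.map₂_apply_tmul]

/-- The morphism from a free equivariant module given by a map of representations. -/
noncomputable def freeLift {V : RightComodule C (CoordGL C)} {M : QCohXModG C q}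
    (g : V.carrier →ₗ[C] M.carrier)
    (hg : ∀ v, M.coact (g v) = g.rTensor (CoordGL C) (V.coact v)) : freeOn q V ⟶ M where
  toLin := LinearMap.liftBaseChange (CoordX C q) g
  comm := coact_liftBaseChange g hg

theorem freeLift_tmul {V : RightComodule C (CoordGL C)} {M : QCohXModG C q}
    (g : V.carrier →ₗ[C] M.carrier)
    (hg : ∀ v, M.coact (g v) = g.rTensor (CoordGL C) (V.coact v)) (a : CoordX C q)
    (v : V.carrier) : (freeLift g hg).toLin (a ⊗ₜ[C] v) = a • g v :=
  LinearMap.liftBaseChange_tmul _ _ _ _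

/-- The restriction of a morphism to the generating representation. -/
noncomputable def freeRestrict {V : RightComodule C (CoordGL C)} {M : QCohXModG C q}
    (f : freeOn q V ⟶ M) : V.carrier →ₗ[C] M.carrier :=
  f.toLin.restrictScalars C ∘ₗ TensorProduct.mk C (CoordX C q) V.carrier 1

theorem coact_freeRestrict {V : RightComodule C (CoordGL C)} {M : QCohXModG C q}
    (f : freeOn q V ⟶ M) (v : V.carrier) : M.coact (freeRestrict f v) =
      (freeRestrict f).rTensor (CoordGL C) (V.coact v) := by
  refine (f.comm ((1 : CoordX C q) ⊗ₜ[C] v)).trans ?_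
  refine (congrArg _ (freeOn_coact_one_tmul V v)).trans ?_
  exact (LinearMap.rTensor_comp_apply (CoordGL C) (f.toLin.restrictScalars C)
    (TensorProduct.mk C (CoordX C q) V.carrier 1) (V.coact v)).symm

theorem freeOn_hom_ext {V : RightComodule C (CoordGL C)} {M : QCohXModG C q}
    {f g : freeOn q V ⟶ M} (h : ∀ v, freeRestrict f v = freeRestrict g v) : f = g := by
  refine twist_hom_ext fun (a : CoordX C q) v => ?_
  have h1 : (a ⊗ₜ[C] v : CoordX C q ⊗[C] V.carrier) = a • ((1 : CoordX C q) ⊗ₜ[C] v) := by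
    rw [TensorProduct.smul_tmul', smul_eq_mul, mul_one]
  have hf : f.toLin (a ⊗ₜ[C] v) = a • f.toLin ((1 : CoordX C q) ⊗ₜ[C] v) :=
    (congrArg f.toLin h1).trans (map_smul f.toLin a _)
  have hg : g.toLin (a ⊗ₜ[C] v) = a • g.toLin ((1 : CoordX C q) ⊗ₜ[C] v) :=
    (congrArg g.toLin h1).trans (map_smul g.toLin a _)
  exact hf.trans ((congrArg (a • ·) (h v)).trans hg.symm)

theorem coact_smul_toSpanSingleton {M : QCohXModG C q} (m : M.carrier)
    (hm : M.coact m = m ⊗ₜ 1) (c : C) : M.coact (c • m) =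
      (LinearMap.toSpanSingleton C M.carrier m).rTensor (CoordGL C) (c ⊗ₜ 1) := by
  rw [map_smul, hm]
  simp [TensorProduct.smul_tmul']

variable [CharZero C]

/-- A map of representations to a quotient lifts, by linear reductivity. -/
theorem exists_lift_of_epi {V : RightComodule C (CoordGL C)} {E X : QCohXModG C q} (e : E ⟶ X)
    [Epi e] (g : V.carrier →ₗ[C] X.carrier)
    (hg : ∀ v, X.coact (g v) = g.rTensor (CoordGL C) (V.coact v)) :
    ∃ l : V.carrier →ₗ[C] E.carrier, (∀ v, e.toLin (l v) = g v) ∧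
      ∀ v, E.coact (l v) = l.rTensor (CoordGL C) (V.coact v) := by
  -- A section that is merely `C`-linear; averaging `s ∘ g` then repairs equivariance.
  obtain ⟨s, hs⟩ := (e.toLin.restrictScalars C).exists_rightInverse_of_surjective
    (LinearMap.range_eq_top.2 (surjective_of_epi e))
  have hs' : ∀ x, e.toLin (s x) = x := fun x => LinearMap.congr_fun hs x
  have hes : (e.toLin.restrictScalars C) ∘ₗ (s ∘ₗ g) = g := by
    ext v; exact hs' _
  refine ⟨RightComodule.average (V := V) (M := E.toComodule) (s ∘ₗ g), fun v => ?_,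
    fun v => RightComodule.coact_average (V := V) (M := E.toComodule) (s ∘ₗ g) v⟩
  refine (RightComodule.comp_average (V := V) (M := E.toComodule) (N := X.toComodule) (s ∘ₗ g)
    (e.toLin.restrictScalars C) e.comm (fun v => ?_) v).trans (hs' _)
  exact ((congrArg X.coact (hs' (g v))).trans (hg v)).trans
    (congrArg (fun t : V.carrier →ₗ[C] X.carrier => t.rTensor (CoordGL C) (V.coact v)) hes.symm)

/-- Morphisms out of `A ⊗ V` are equivariant maps out of `V`, so projectivity is the lifting
property of the representation `V`. -/
instance projective_freeOn (V : RightComodule C (CoordGL C)) : Projective (freeOn q V) where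
  factors {E X} f e _ := by
    obtain ⟨l, hl, hl'⟩ := exists_lift_of_epi e (freeRestrict f) (coact_freeRestrict f)
    refine ⟨freeLift l hl', freeOn_hom_ext fun v => ?_⟩
    exact (congrArg e.toLin ((freeLift_tmul l hl' 1 v).trans (one_smul _ _))).trans (hl v)

instance projective_structureSheafX : Projective (structureSheafX C q) where
  factors {E X} f e _ := by
    obtain ⟨l, hl, hl'⟩ := exists_lift_of_epi (V := RightComodule.trivial C (CoordGL C)) e
      (LinearMap.toSpanSingleton C X.carrier (f.toLin (1 : CoordX C q)))
      (fun v : C => coact_smul_toSpanSingleton (f.toLin (1 : CoordX C q)) (coact_apply_one f) v)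
    refine ⟨ofInvariant (l (1 : C)) (hl' (1 : C)), structureSheafX_hom_ext ?_⟩
    exact (congrArg e.toLin (one_smul (CoordX C q) (l (1 : C)))).trans
      ((hl (1 : C)).trans (one_smul C _))

end Free

/-! ### The action of the universal `φ` on equivariant modules -/

section Inertia

variable {C : Type u} [Field C] {q : ℕ}

open EquivariantModule

theorem act_proj_eq (h : CoordGL C) : CoordX.act C q (CoordX.proj C q h) =
    Algebra.TensorProduct.map (CoordX.proj C q) (AlgHom.id C (CoordGL C)) (conjAct C h) := by
  have h1 : (CoordX.act C q).comp (CoordX.proj C q) =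
      (Algebra.TensorProduct.map (CoordX.proj C q) (AlgHom.id C (CoordGL C))).comp
        (conjAct C) := by
    apply CoordGL.hom_ext
    rw [mapGL_comp, mapGL_comp, conjAct, CoordGL.mapGL_lift]
    simp only [map_mul, map_inv, mapGL_map_left, mapGL_map_right, mapGL_id]
    exact CoordX.mapGL_act_φ C q
  exact AlgHom.congr_fun h1 h

/-- The identity `γ (γ⁻¹ φ γ) = φ γ`. It is the reason why acting by the universal `φ` commutes with
the group. -/
theorem inR_mul_conjAct_comul (h : CoordGL C) :
    Algebra.TensorProduct.productMap (inR C (CoordGL C) (CoordGL C)) (conjAct C)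
      (Coalgebra.comul (R := C) h) = Coalgebra.comul (R := C) h := by
  have : (Algebra.TensorProduct.productMap (inR C (CoordGL C) (CoordGL C)) (conjAct C)).comp
      (Bialgebra.comulAlgHom C (CoordGL C)) = Bialgebra.comulAlgHom C (CoordGL C) := by
    apply CoordGL.hom_ext
    have h1 : ∀ x : GL (Fin 2) (CoordGL C), mapGL (Algebra.TensorProduct.productMap
        (inR C (CoordGL C) (CoordGL C)) (conjAct C)) (mapGL (inL C (CoordGL C) (CoordGL C)) x) =
          mapGL (inR C (CoordGL C) (CoordGL C)) x := by
      intro x; ext i j; simp [mapGL_apply]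
    have h2 : ∀ x : GL (Fin 2) (CoordGL C), mapGL (Algebra.TensorProduct.productMap
        (inR C (CoordGL C) (CoordGL C)) (conjAct C)) (mapGL (inR C (CoordGL C) (CoordGL C)) x) =
          mapGL (conjAct C) x := by
      intro x; ext i j; simp [mapGL_apply, ← Algebra.TensorProduct.one_def]
    rw [mapGL_comp, CoordGL.comulAlgHom_eq, CoordGL.mapGL_lift, map_mul, h1, h2, conjAct,
      CoordGL.mapGL_lift, mul_assoc, mul_inv_cancel_left]
  exact AlgHom.congr_fun this h

section Eval

variable (q) (X : Type u) [AddCommGroup X] [Module C X] [Module (CoordX C q) X]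
  [IsScalarTower C (CoordX C q) X]

/-- The map `x ⊗ h ↦ h(φ) x`. -/
noncomputable def evalφ : X ⊗[C] CoordGL C →ₗ[C] X :=
  TensorProduct.lift ((Algebra.lsmul C C X).toLinearMap ∘ₗ (CoordX.proj C q).toLinearMap).flip

@[simp] theorem evalφ_tmul (x : X) (h : CoordGL C) :
    evalφ q X (x ⊗ₜ h) = CoordX.proj C q h • x := by
  simp [evalφ]

variable {X} {Y : Type u} [AddCommGroup Y] [Module C Y] [Module (CoordX C q) Y]
  [IsScalarTower C (CoordX C q) Y]

theorem evalφ_rTensor (f : X →ₗ[CoordX C q] Y) (t : X ⊗[C] CoordGL C) :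
    evalφ q Y ((f.restrictScalars C).rTensor (CoordGL C) t) = f (evalφ q X t) := by
  induction t with
  | zero => simp
  | add x y hx hy => simp only [map_add, hx, hy]
  | tmul x h => simp

variable (X) {V : Type u} [AddCommGroup V] [Module C V]

/-- The action of the universal `φ` on `V`, extended to `X ⊗ V` linearly over functions. -/
noncomputable def twistInertia (d : V →ₗ[C] V ⊗[C] CoordGL C) : X ⊗[C] V →ₗ[C] X ⊗[C] V :=
  evalφ q (X ⊗[C] V) ∘ₗ (TensorProduct.assoc C X V (CoordGL C)).symm.toLinearMap ∘ₗ d.lTensor X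

variable {X}

theorem twistInertia_tmul (d : V →ₗ[C] V ⊗[C] CoordGL C) (x : X) (v : V) :
    twistInertia q X d (x ⊗ₜ v) =
      evalφ q (X ⊗[C] V) ((TensorProduct.assoc C X V (CoordGL C)).symm (x ⊗ₜ d v)) := rfl

theorem twistInertia_smul (d : V →ₗ[C] V ⊗[C] CoordGL C) (a : CoordX C q) (z : X ⊗[C] V) :
    twistInertia q X d (a • z) = a • twistInertia q X d z := by
  induction z with
  | zero => simp
  | add x y hx hy => simp only [smul_add, map_add, hx, hy]
  | tmul x v =>
    rw [TensorProduct.smul_tmul', twistInertia_tmul, twistInertia_tmul]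
    generalize d v = t
    induction t with
    | zero => simp
    | add x y hx hy => simp only [TensorProduct.tmul_add, map_add, smul_add, hx, hy]
    | tmul w h => simp [TensorProduct.smul_tmul', smul_smul, mul_comm]

end Eval

section Coact

variable (M : QCohXModG C q) (V : RightComodule C (CoordGL C))

/-- An auxiliary form of the coaction on `h(φ) m ⊗ v`, as a function of `v` and `h`. -/
noncomputable def coactSmulTmul (t : M.carrier ⊗[C] CoordGL C) :
    (V.carrier ⊗[C] CoordGL C) ⊗[C] CoordGL C →ₗ[C]
      (M.carrier ⊗[C] V.carrier) ⊗[C] CoordGL C :=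
  TensorProduct.lift (star M.carrier V.carrier (CoordGL C) ∘ₗ
    (TensorProduct.map₂ (Algebra.lsmul C C M.carrier).toLinearMap
      (LinearMap.mul C (CoordGL C))).flip t ∘ₗ
    ((Algebra.TensorProduct.map (CoordX.proj C q) (AlgHom.id C (CoordGL C))).comp
      (conjAct C)).toLinearMap).flip

theorem coactSmulTmul_tmul (t : M.carrier ⊗[C] CoordGL C) (s : V.carrier ⊗[C] CoordGL C)
    (h : CoordGL C) : coactSmulTmul M V t (s ⊗ₜ h) = star M.carrier V.carrier (CoordGL C)
      (TensorProduct.map₂ (Algebra.lsmul C C M.carrier).toLinearMap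
        (LinearMap.mul C (CoordGL C)) (Algebra.TensorProduct.map (CoordX.proj C q)
          (AlgHom.id C (CoordGL C)) (conjAct C h)) t) s := rfl

theorem coactSmulTmul_add (t t' : M.carrier ⊗[C] CoordGL C) :
    coactSmulTmul M V (t + t') = coactSmulTmul M V t + coactSmulTmul M V t' := by
  refine TensorProduct.ext' fun s h => ?_
  rw [LinearMap.add_apply, coactSmulTmul_tmul, coactSmulTmul_tmul, coactSmulTmul_tmul, map_add,
    map_add, LinearMap.add_apply]

theorem coactSmulTmul_zero : coactSmulTmul M V 0 = 0 := by
  refine TensorProduct.ext' fun s h => ?_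
  rw [coactSmulTmul_tmul, map_zero, map_zero]
  rfl

theorem tensorCoact_evalφ (m : M.carrier) (s : V.carrier ⊗[C] CoordGL C) :
    tensorCoact M.carrier V.carrier (CoordGL C) M.coact V.coact
      (evalφ q (M.carrier ⊗[C] V.carrier) ((TensorProduct.assoc C _ _ _).symm (m ⊗ₜ s))) =
      coactSmulTmul M V (M.coact m) (V.coact.rTensor (CoordGL C) s) := by
  induction s with
  | zero => simp
  | add x y hx hy => simp only [TensorProduct.tmul_add, map_add, hx, hy]
  | tmul v h =>
    rw [TensorProduct.assoc_symm_tmul, evalφ_tmul, TensorProduct.smul_tmul', tensorCoact_tmul,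
      LinearMap.rTensor_tmul, coactSmulTmul_tmul, M.coact_smul, act_proj_eq]

/-- Coassociativity of `V` has turned two successive coactions into a comultiplication. What is left
is an identity in `H ⊗ H`, supplied by `inR_mul_conjAct_comul`. -/
theorem coactSmulTmul_comul (m : M.carrier) (a : CoordGL C) (s : V.carrier ⊗[C] CoordGL C) :
    coactSmulTmul M V (m ⊗ₜ a) ((TensorProduct.assoc C _ _ _).symm
      ((Coalgebra.comul (R := C) (A := CoordGL C)).lTensor V.carrier s)) =
      (evalφ q (M.carrier ⊗[C] V.carrier) ∘ₗ
        (TensorProduct.assoc C _ _ _).symm.toLinearMap ∘ₗ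
          TensorProduct.mk C M.carrier (V.carrier ⊗[C] CoordGL C) m).rTensor (CoordGL C)
      ((LinearMap.mulLeft C a).lTensor _ ((TensorProduct.assoc C _ _ _).symm
      ((Coalgebra.comul (R := C) (A := CoordGL C)).lTensor V.carrier s))) := by
  induction s with
  | zero => simp
  | add x y hx hy => simp only [map_add, hx, hy]
  | tmul v h =>
    let G : CoordGL C ⊗[C] CoordGL C →ₗ[C] (M.carrier ⊗[C] V.carrier) ⊗[C] CoordGL C :=
      TensorProduct.map ((((TensorProduct.mk C M.carrier V.carrier).flip v) ∘ₗ
        (Algebra.lsmul C C M.carrier).toLinearMap.flip m) ∘ₗ (CoordX.proj C q).toLinearMap)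
        (LinearMap.mulLeft C a)
    have h1 : ∀ t : CoordGL C ⊗[C] CoordGL C, coactSmulTmul M V (m ⊗ₜ a)
        ((TensorProduct.assoc C _ _ _).symm (v ⊗ₜ t)) = G (Algebra.TensorProduct.productMap
          (inR C (CoordGL C) (CoordGL C)) (conjAct C) t) := by
      intro t
      induction t with
      | zero => simp
      | add x y hx hy => simp only [TensorProduct.tmul_add, map_add, hx, hy]
      | tmul x y =>
        rw [TensorProduct.assoc_symm_tmul, coactSmulTmul_tmul,
          Algebra.TensorProduct.productMap_apply_tmul]
        generalize conjAct C y = r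
        induction r with
        | zero => simp
        | add x y hx hy => simp only [map_add, LinearMap.add_apply, mul_add, hx, hy]
        | tmul y z =>
          simp only [Algebra.TensorProduct.map_tmul, TensorProduct.map₂_apply_tmul,
            TensorProduct.map_tmul, EquivariantModule.star_tmul, AlgHom.id_apply,
            Algebra.TensorProduct.includeRight_apply, Algebra.TensorProduct.tmul_mul_tmul, one_mul,
            G]
          simp only [LinearMap.mul_apply', LinearMap.mulLeft_apply, LinearMap.comp_apply,
            LinearMap.flip_apply, AlgHom.toLinearMap_apply, TensorProduct.mk_apply]
          congr 1
          ring
    have h2 : ∀ t : CoordGL C ⊗[C] CoordGL C, (evalφ q (M.carrier ⊗[C] V.carrier) ∘ₗ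
        (TensorProduct.assoc C _ _ _).symm.toLinearMap ∘ₗ
          TensorProduct.mk C M.carrier (V.carrier ⊗[C] CoordGL C) m).rTensor (CoordGL C)
      ((LinearMap.mulLeft C a).lTensor _ ((TensorProduct.assoc C _ _ _).symm (v ⊗ₜ t))) =
        G t := by
      intro t
      induction t with
      | zero => simp
      | add x y hx hy => simp only [TensorProduct.tmul_add, map_add, hx, hy]
      | tmul x y => simp [G, TensorProduct.smul_tmul']
    rw [LinearMap.lTensor_tmul, h1, h2, inR_mul_conjAct_comul]

/-- Applying `γ` after `φ` moves the function `φ` to `γ⁻¹ φ γ`, and `γ (γ⁻¹ φ γ) = φ γ` on `V`. -/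
theorem tensorCoact_twistInertia (z : M.carrier ⊗[C] V.carrier) :
    tensorCoact M.carrier V.carrier (CoordGL C) M.coact V.coact
      (twistInertia q M.carrier V.coact z) =
      (twistInertia q M.carrier V.coact).rTensor (CoordGL C)
        (tensorCoact M.carrier V.carrier (CoordGL C) M.coact V.coact z) := by
  induction z with
  | zero => simp
  | add x y hx hy => simp only [map_add, hx, hy]
  | tmul m v =>
    have h1 := V.coassoc v
    rw [← LinearEquiv.eq_symm_apply] at h1
    rw [twistInertia_tmul, tensorCoact_evalφ, tensorCoact_tmul, h1]
    generalize M.coact m = t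
    induction t with
    | zero => simp [coactSmulTmul_zero]
    | add x y hx hy =>
      rw [coactSmulTmul_add, LinearMap.add_apply, map_add, LinearMap.add_apply, map_add, hx, hy]
    | tmul m a =>
      rw [coactSmulTmul_comul, ← h1]
      generalize V.coact v = s
      induction s with
      | zero => simp
      | add x y hx hy => simp only [map_add, hx, hy]
      | tmul w h => simp [twistInertia_tmul]

/-- The action of the universal `φ` on the representation `V`, as an endomorphism of the twist. -/
noncomputable def twistInertiaHom : twist M V ⟶ twist M V where
  toLin :=
    { toFun := twistInertia q M.carrier V.coact
      map_add' := map_add _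
      map_smul' := twistInertia_smul q V.coact }
  comm := tensorCoact_twistInertia M V

/-- The action of the universal `φ` on an equivariant module. -/
noncomputable def inertia : M.carrier →ₗ[C] M.carrier := evalφ q M.carrier ∘ₗ M.coact

theorem inertia_apply (m : M.carrier) : inertia M m = evalφ q M.carrier (M.coact m) := rfl

variable {M} in
theorem map_inertia {N : QCohXModG C q} (f : M ⟶ N) (m : M.carrier) :
    f.toLin (inertia M m) = inertia N (f.toLin m) := by
  rw [inertia_apply, inertia_apply, f.comm, evalφ_rTensor]

/-- The canonical morphism `a ⊗ m ↦ a m`. -/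
noncomputable def freeCounit : freeOn q M.toComodule ⟶ M :=
  freeLift (V := M.toComodule) LinearMap.id fun m =>
    (LinearMap.congr_fun (LinearMap.rTensor_id (CoordGL C) M.carrier) (M.coact m)).symm

theorem freeCounit_tmul (a : CoordX C q) (m : M.carrier) :
    (freeCounit M).toLin (a ⊗ₜ[C] m) = a • m := freeLift_tmul _ _ _ _

instance : Epi (freeCounit M) := epi_of_surjective _ fun m =>
  ⟨(1 : CoordX C q) ⊗ₜ[C] m, (freeCounit_tmul M 1 m).trans (one_smul _ m)⟩

/-- On generators, the semilinear operator `inertia M` is induced by an `A`-linear endomorphism of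
the free cover. -/
theorem freeCounit_twistInertia (m : M.carrier) :
    (freeCounit M).toLin ((twistInertiaHom (structureSheafX C q) M.toComodule).toLin
      ((1 : CoordX C q) ⊗ₜ[C] m)) = inertia M m := by
  refine (congrArg (freeCounit M).toLin (twistInertia_tmul q M.coact (1 : CoordX C q) m)).trans ?_
  rw [inertia_apply]
  generalize M.coact m = t
  induction t with
  | zero =>
    rw [TensorProduct.tmul_zero, map_zero, map_zero, map_zero]
    exact map_zero (freeCounit M).toLin
  | add x y hx hy =>
    rw [map_add, ← hx, ← hy, TensorProduct.tmul_add, map_add, map_add]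
    exact map_add (freeCounit M).toLin _ _
  | tmul w h =>
    rw [TensorProduct.assoc_symm_tmul, evalφ_tmul, evalφ_tmul, TensorProduct.smul_tmul',
      smul_eq_mul, mul_one]
    exact freeCounit_tmul M _ _

/-- `inertia M` is semilinear over the scaling of `N` and so need not be a morphism. It is
nevertheless the restriction to the generators of a composite of morphisms, and such restrictions
are equivariant. -/
theorem coact_inertia (m : M.carrier) :
    M.coact (inertia M m) = (inertia M).rTensor (CoordGL C) (M.coact m) := by
  have h1 : inertia M = freeRestrict
      (twistInertiaHom (structureSheafX C q) M.toComodule ≫ freeCounit M) :=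
    LinearMap.ext fun m => (freeCounit_twistInertia M m).symm
  rw [h1]
  exact coact_freeRestrict (V := M.toComodule) _ m

end Coact

/-- The automorphism `(φ, N) ↦ (φ, q N)` of `X`. -/
noncomputable def scaleX (C : Type u) [Field C] (q : ℕ) : CoordX C q →ₐ[C] CoordX C q :=
  (Algebra.TensorProduct.productMap (AlgHom.id C (CoordX C q)) (CoordX.proj C q)).comp
    (CoordX.act C q)

theorem scaleX_apply (a : CoordX C q) : scaleX C q a = evalφ q (CoordX C q) (CoordX.act C q a) := by
  rw [scaleX, AlgHom.comp_apply]
  generalize CoordX.act C q a = t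
  induction t with
  | zero => simp
  | add x y hx hy => simp only [map_add, hx, hy]
  | tmul x h => simp [mul_comm]

theorem mapGL_scaleX : mapGL (scaleX C q) (CoordX.φ C q) = CoordX.φ C q := by
  have h1 : ∀ x : GL (Fin 2) (CoordX C q), mapGL (Algebra.TensorProduct.productMap
      (AlgHom.id C (CoordX C q)) (CoordX.proj C q))
        (mapGL (inL C (CoordX C q) (CoordGL C)) x) = x := by
    intro x; ext i j; simp [mapGL_apply]
  have h2 : mapGL (Algebra.TensorProduct.productMap
      (AlgHom.id C (CoordX C q)) (CoordX.proj C q))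
        (mapGL (inR C (CoordX C q) (CoordGL C)) (CoordGL.univ C)) = CoordX.φ C q := by
    ext i j; simp [mapGL_apply, CoordX.φ]
  rw [scaleX, mapGL_comp, CoordX.mapGL_act_φ, map_mul, map_mul, map_inv, h1, h2, inv_mul_cancel,
    one_mul]

theorem scaleX_proj (h : CoordGL C) : scaleX C q (CoordX.proj C q h) = CoordX.proj C q h := by
  have : (scaleX C q).comp (CoordX.proj C q) = CoordX.proj C q :=
    CoordGL.hom_ext (by rw [mapGL_comp]; exact mapGL_scaleX)
  exact AlgHom.congr_fun this h

/-- Translating functions by `φ` substitutes `φ⁻¹ N φ` for `N`, and the defining relation of `X`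
says that this is `q N`. -/
theorem map_scaleX_N (hq : (q : C) ≠ 0) :
    (CoordX.N C q).map (scaleX C q) = (q : C) • CoordX.N C q := by
  have h1 : ((CoordX.N C q).map (inL C (CoordX C q) (CoordGL C))).map
      (Algebra.TensorProduct.productMap (AlgHom.id C (CoordX C q)) (CoordX.proj C q)) =
        CoordX.N C q := by
    ext i j; simp
  have h2 : mapGL (Algebra.TensorProduct.productMap
      (AlgHom.id C (CoordX C q)) (CoordX.proj C q))
        (mapGL (inR C (CoordX C q) (CoordGL C)) (CoordGL.univ C)) = CoordX.φ C q := by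
    ext i j; simp [mapGL_apply, CoordX.φ]
  rw [scaleX, CoordX.map_comp_mat, CoordX.map_act_N, CoordX.map_sandwich, h1, h2]
  have h3 : (CoordX.φ C q)⁻¹.val * (CoordX.φ C q).val = 1 := by
    rw [← Units.val_mul, inv_mul_cancel]; rfl
  have h4 : CoordX.N C q = (q : C) • ((CoordX.φ C q).val * CoordX.N C q *
      (CoordX.φ C q)⁻¹.val) := by
    rw [CoordX.φ_N, smul_smul, mul_inv_cancel₀ hq, one_smul]
  conv_lhs => rw [h4]
  rw [Matrix.mul_smul, Matrix.smul_mul, ← mul_assoc, ← mul_assoc, h3, one_mul, mul_assoc, h3,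
    mul_one]

end Inertia

/-! ### Weights -/

section WeightSubmodule

open Polynomial

variable {k : Type*} [Field k]

/-- The polynomials that are products of factors `X - q ^ d` with `d ≥ b`. -/
noncomputable def weightMonoid (k : Type*) [Field k] (q b : ℕ) : Submonoid k[X] :=
  Submonoid.closure {p | ∃ d, b ≤ d ∧ p = X - C ((q : k) ^ d)}

theorem eval_weightMonoid_ne_zero {q b : ℕ} {c : k} (hc : ∀ d, b ≤ d → c ≠ (q : k) ^ d)
    {p : k[X]} (hp : p ∈ weightMonoid k q b) : p.eval c ≠ 0 := by
  induction hp using Submonoid.closure_induction with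
  | mem p hp =>
    obtain ⟨d, hd, rfl⟩ := hp
    simpa [sub_eq_zero] using hc d hd
  | one => simp
  | mul x y _ _ hx hy => simpa using ⟨hx, hy⟩

variable {M N : Type*} [AddCommGroup M] [Module k M] [AddCommGroup N] [Module k N]

/-- The vectors killed by a product of factors `T - q ^ d` with `d ≥ b`. -/
noncomputable def weightSubmodule (q b : ℕ) (T : M →ₗ[k] M) : Submodule k M where
  carrier := {m | ∃ p ∈ weightMonoid k q b, aeval T p m = 0}
  zero_mem' := ⟨1, one_mem _, by simp⟩
  add_mem' := by
    rintro x y ⟨p, hp, hpx⟩ ⟨r, hr, hry⟩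
    refine ⟨p * r, mul_mem hp hr, ?_⟩
    rw [map_add, map_mul, Module.End.mul_apply, Module.End.mul_apply, hry, map_zero, add_zero,
      ← Module.End.mul_apply, ← map_mul, mul_comm, map_mul, Module.End.mul_apply, hpx, map_zero]
  smul_mem' := by
    rintro c x ⟨p, hp, hpx⟩
    exact ⟨p, hp, by rw [map_smul, hpx, smul_zero]⟩

theorem mem_weightSubmodule {q b : ℕ} {T : M →ₗ[k] M} {m : M} :
    m ∈ weightSubmodule q b T ↔ ∃ p ∈ weightMonoid k q b, aeval T p m = 0 := Iff.rfl

theorem aeval_X_sub_C_apply (T : M →ₗ[k] M) (c : k) (m : M) :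
    aeval T (X - C c) m = T m - c • m := by
  rw [map_sub, aeval_X, aeval_C, LinearMap.sub_apply, Module.algebraMap_end_apply]

theorem mem_weightSubmodule_of_eq {q b : ℕ} {T : M →ₗ[k] M} {m : M} {d : ℕ} (hd : b ≤ d)
    (h : T m = (q : k) ^ d • m) : m ∈ weightSubmodule q b T :=
  ⟨X - C ((q : k) ^ d), Submonoid.subset_closure ⟨d, hd, rfl⟩, by
    rw [aeval_X_sub_C_apply, h, sub_self]⟩

theorem apply_aeval_of_comm {S : M →ₗ[k] M} {T : N →ₗ[k] N} (f : M →ₗ[k] N)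
    (h : ∀ m, f (S m) = T (f m)) (p : k[X]) (m : M) : f (aeval S p m) = aeval T p (f m) := by
  induction p using Polynomial.induction_on generalizing m with
  | C a => simp
  | add p r hp hr => simp [hp, hr]
  | monomial n a ih =>
    rw [pow_succ, ← mul_assoc, map_mul _ _ X, map_mul _ _ X, Module.End.mul_apply,
      Module.End.mul_apply, aeval_X, aeval_X, ih, h]

theorem apply_mem_weightSubmodule {q b : ℕ} {S : M →ₗ[k] M} {T : N →ₗ[k] N} (f : M →ₗ[k] N)
    (h : ∀ m, f (S m) = T (f m)) {m : M} (hm : m ∈ weightSubmodule q b S) :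
    f m ∈ weightSubmodule q b T := by
  obtain ⟨p, hp, hpm⟩ := hm
  exact ⟨p, hp, by rw [← apply_aeval_of_comm f h, hpm, map_zero]⟩

theorem mem_weightSubmodule_of_injective {q b : ℕ} {S : M →ₗ[k] M} {T : N →ₗ[k] N}
    (f : M →ₗ[k] N) (h : ∀ m, f (S m) = T (f m)) (hf : Function.Injective f) {m : M}
    (hm : f m ∈ weightSubmodule q b T) : m ∈ weightSubmodule q b S := by
  obtain ⟨p, hp, hpm⟩ := hm
  exact ⟨p, hp, hf (by rw [apply_aeval_of_comm f h, hpm, map_zero])⟩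

theorem aeval_apply_of_eigen {T : M →ₗ[k] M} {c : k} {m : M} (h : T m = c • m) (p : k[X]) :
    aeval T p m = p.eval c • m := by
  induction p using Polynomial.induction_on with
  | C a => simp
  | add p r hp hr => simp [hp, hr, add_smul]
  | monomial n a ih =>
    rw [pow_succ, ← mul_assoc, map_mul _ _ X, Module.End.mul_apply, aeval_X, h, map_smul, ih,
      smul_smul, eval_mul (q := X), eval_X, mul_comm c]

theorem eq_zero_of_mem_weightSubmodule {q b : ℕ} {T : M →ₗ[k] M} {c : k}
    (hc : ∀ d, b ≤ d → c ≠ (q : k) ^ d) {m : M} (hm : m ∈ weightSubmodule q b T)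
    (h : T m = c • m) : m = 0 := by
  obtain ⟨p, hp, hpm⟩ := hm
  rw [aeval_apply_of_eigen h] at hpm
  exact (smul_eq_zero.1 hpm).resolve_left (eval_weightMonoid_ne_zero hc hp)

/-- If `p(T) m = 0` and `p(c) ≠ 0`, write `p = (X - c) r + p(c)`. Then `r(T) m / p(c)` is a preimage
of `m` under `c - T`. -/
theorem bijective_smul_id_sub {q b : ℕ} {T : M →ₗ[k] M} {c : k}
    (hc : ∀ d, b ≤ d → c ≠ (q : k) ^ d) (hT : weightSubmodule q b T = ⊤) :
    Function.Bijective (c • (LinearMap.id : M →ₗ[k] M) - T) := by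
  constructor
  · refine (injective_iff_map_eq_zero (c • LinearMap.id - T)).2 fun m hm => ?_
    refine eq_zero_of_mem_weightSubmodule hc (hT ▸ Submodule.mem_top : m ∈ weightSubmodule q b T)
      ?_
    rw [LinearMap.sub_apply, sub_eq_zero] at hm
    exact hm.symm
  · intro m
    obtain ⟨p, hp, hpm⟩ := (mem_weightSubmodule (q := q) (b := b) (T := T) (m := m)).1
      (hT ▸ Submodule.mem_top)
    obtain ⟨r, hr⟩ : (X - C c) ∣ p - C (p.eval c) := by
      rw [dvd_iff_isRoot]; simp
    have h1 := eval_weightMonoid_ne_zero hc hp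
    have h2 : p = (X - C c) * r + C (p.eval c) := by rw [← hr, sub_add_cancel]
    refine ⟨(p.eval c)⁻¹ • aeval T r m, ?_⟩
    rw [h2, map_add, map_mul, LinearMap.add_apply, Module.End.mul_apply] at hpm
    simp only [map_sub, aeval_X, aeval_C, LinearMap.sub_apply, Module.algebraMap_end_apply] at hpm
    rw [map_smul, inv_smul_eq_iff₀ h1, LinearMap.sub_apply, LinearMap.smul_apply,
      LinearMap.id_apply, ← neg_sub, eq_comm, ← add_eq_zero_iff_eq_neg, add_comm]
    exact hpm

/-- Tensoring with an eigenvector of weight `e` shifts weights by `e`. -/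
theorem tmul_mem_weightSubmodule {q b : ℕ} {T : M →ₗ[k] M} {S : N →ₗ[k] N} {x : N} {e : ℕ}
    (hx : S x = (q : k) ^ e • x) {m : M} (hm : m ∈ weightSubmodule q b T) :
    x ⊗ₜ[k] m ∈ weightSubmodule q b (TensorProduct.map S T) := by
  -- Each factor `T - q ^ d` becomes `T - q ^ (e + d)` on the tensor product and contributes a
  -- scalar `q ^ e`. Since `e ≥ 0`, the bound `b` is preserved.
  have key : ∀ p ∈ weightMonoid k q b, ∃ r ∈ weightMonoid k q b, ∃ c : k, ∀ m : M,
      aeval (TensorProduct.map S T) r (x ⊗ₜ[k] m) = c • x ⊗ₜ[k] aeval T p m := by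
    intro p hp
    induction hp using Submonoid.closure_induction with
    | mem p hp =>
      obtain ⟨d, hd, rfl⟩ := hp
      refine ⟨X - C ((q : k) ^ (e + d)), Submonoid.subset_closure ⟨e + d, by omega, rfl⟩,
        (q : k) ^ e, fun m => ?_⟩
      rw [aeval_X_sub_C_apply, aeval_X_sub_C_apply, TensorProduct.map_tmul, hx,
        TensorProduct.tmul_sub, smul_sub, TensorProduct.tmul_smul, TensorProduct.smul_tmul',
        smul_smul, pow_add, TensorProduct.smul_tmul', TensorProduct.smul_tmul']
    | one => exact ⟨1, one_mem _, 1, by simp⟩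
    | mul p p' _ _ h h' =>
      obtain ⟨r, hr, c, h⟩ := h
      obtain ⟨r', hr', c', h'⟩ := h'
      refine ⟨r * r', mul_mem hr hr', c' * c, fun m => ?_⟩
      rw [map_mul, map_mul, Module.End.mul_apply, Module.End.mul_apply, h', map_smul,
        h, smul_smul]
  obtain ⟨p, hp, hpm⟩ := hm
  obtain ⟨r, hr, c, h⟩ := key p hp
  exact ⟨r, hr, by rw [h, hpm, TensorProduct.tmul_zero, smul_zero]⟩

end WeightSubmodule

/-! ### Weights of equivariant modules -/

section Weights

variable {C : Type u} [Field C] {q : ℕ}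

open EquivariantModule

theorem CoordX.induction_on {P : CoordX C q → Prop} (a : CoordX C q)
    (hproj : ∀ h, P (CoordX.proj C q h)) (hadd : ∀ a b, P a → P b → P (a + b))
    (hmul : ∀ a i j, P a → P (a * CoordX.N C q i j)) : P a := by
  obtain ⟨x, rfl⟩ := Ideal.Quotient.mk_surjective a
  induction x using MvPolynomial.induction_on with
  | C a => exact hproj a
  | add p r hp hr => exact hadd _ _ hp hr
  | mul_X p i hp => exact hmul _ i.1 i.2 hp

theorem scaleX_N (hq : (q : C) ≠ 0) (i j : Fin 2) :
    scaleX C q (CoordX.N C q i j) = (q : C) • CoordX.N C q i j :=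
  congrFun (congrFun (map_scaleX_N hq) i) j

/-- `A` is spanned by functions of `φ` times monomials in the entries of `N`, and such a product of
degree `e` in `N` is scaled by `q ^ e`. -/
theorem span_scaleX_eigen (hq : (q : C) ≠ 0) :
    Submodule.span C {a : CoordX C q | ∃ e : ℕ, scaleX C q a = (q : C) ^ e • a} = ⊤ := by
  refine eq_top_iff.2 fun a _ => ?_
  induction a using CoordX.induction_on with
  | hproj h => exact Submodule.subset_span ⟨0, by simp [scaleX_proj]⟩
  | hadd a b ha hb => exact add_mem (ha trivial) (hb trivial)
  | hmul a i j ha =>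
    replace ha := ha trivial
    clear * - ha hq
    induction ha using Submodule.span_induction with
    | mem x hx =>
      obtain ⟨e, he⟩ := hx
      refine Submodule.subset_span ⟨e + 1, ?_⟩
      rw [map_mul, he, scaleX_N hq, smul_mul_smul_comm, pow_succ]
    | zero => simp
    | add x y _ _ hx hy => rw [add_mul]; exact add_mem hx hy
    | smul c x _ hx => rw [smul_mul_assoc]; exact Submodule.smul_mem _ _ hx

/-- The equivariant modules all of whose weights are of the form `q ^ d` with `d ≥ b`. -/
def HasWeightsGE (F : QCohXModG C q) (b : ℕ) : Prop := weightSubmodule q b (inertia F) = ⊤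

theorem HasWeightsGE.of_mono {F G : QCohXModG C q} {b : ℕ} (hG : HasWeightsGE G b) (f : F ⟶ G)
    [Mono f] : HasWeightsGE F b :=
  eq_top_iff.2 fun m _ => mem_weightSubmodule_of_injective (f.toLin.restrictScalars C)
    (map_inertia f) (injective_of_mono f)
    (hG ▸ Submodule.mem_top : f.toLin m ∈ weightSubmodule q b (inertia G))

theorem HasWeightsGE.of_epi {F G : QCohXModG C q} {b : ℕ} (hF : HasWeightsGE F b) (f : F ⟶ G)
    [Epi f] : HasWeightsGE G b := by
  refine eq_top_iff.2 fun m _ => ?_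
  obtain ⟨m, rfl⟩ := surjective_of_epi f m
  exact apply_mem_weightSubmodule (f.toLin.restrictScalars C) (map_inertia f)
    (hF ▸ Submodule.mem_top : m ∈ weightSubmodule q b (inertia F))

theorem HasWeightsGE.hom_eq_zero {F W : QCohXModG C q} {b : ℕ} (hF : HasWeightsGE F b) {c : C}
    (hc : ∀ d, b ≤ d → c ≠ (q : C) ^ d) (hW : ∀ x, inertia W x = c • x) (f : F ⟶ W) : f = 0 := by
  ext m
  exact eq_zero_of_mem_weightSubmodule hc
    (apply_mem_weightSubmodule (f.toLin.restrictScalars C) (map_inertia f)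
      (hF ▸ Submodule.mem_top : m ∈ weightSubmodule q b (inertia F))) (hW _)

/-! ### The two actions of `φ` on the free cover -/

section Defect

variable (F : QCohXModG C q)

/-- The action of the universal `φ` on the generators of the free cover. -/
noncomputable def freeInertia : freeOn q F.toComodule ⟶ freeOn q F.toComodule :=
  freeLift (TensorProduct.mk C (CoordX C q) F.carrier 1 ∘ₗ inertia F) fun m =>
    (freeOn_coact_one_tmul F.toComodule (inertia F m)).trans
      ((congrArg _ (coact_inertia F m)).trans
        (LinearMap.rTensor_comp_apply (CoordGL C) (TensorProduct.mk C (CoordX C q) F.carrier 1)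
          (inertia F) (F.coact m)).symm)

theorem freeInertia_apply (z : CoordX C q ⊗[C] F.carrier) :
    (freeInertia F).toLin z = (inertia F).lTensor (CoordX C q) z := by
  change LinearMap.liftBaseChange (CoordX C q)
    (TensorProduct.mk C (CoordX C q) F.carrier 1 ∘ₗ inertia F) z = _
  induction z with
  | zero => simp
  | add x y hx hy => simp only [map_add, hx, hy]
  | tmul a m => simp [TensorProduct.smul_tmul']

/-- The difference of the two actions of the universal `φ` on the free cover. -/
noncomputable def inertiaDefect : freeOn q F.toComodule ⟶ freeOn q F.toComodule :=
  twistInertiaHom (structureSheafX C q) F.toComodule - freeInertia F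

theorem inertiaDefect_apply (z : CoordX C q ⊗[C] F.carrier) : (inertiaDefect F).toLin z =
    twistInertia q (CoordX C q) F.coact z - (inertia F).lTensor (CoordX C q) z := by
  refine Eq.trans ?_ ((congrArg (twistInertia q (CoordX C q) F.coact z - ·)
    (freeInertia_apply F z)))
  exact (sub_eq_add_neg (G := CoordX C q ⊗[C] F.carrier) _ _).symm

/-- Both actions send a generator `1 ⊗ m` to `inertia F m` after `a ⊗ m ↦ a m`. So `F` is a quotient
of the cokernel of the defect. -/
theorem inertiaDefect_freeCounit : inertiaDefect F ≫ freeCounit F = 0 := by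
  rw [inertiaDefect, Preadditive.sub_comp, sub_eq_zero]
  refine freeOn_hom_ext fun m => ?_
  refine (freeCounit_twistInertia F m).trans ?_
  refine Eq.trans ?_ (congrArg (freeCounit F).toLin
    (freeInertia_apply F ((1 : CoordX C q) ⊗ₜ[C] m))).symm
  exact ((freeCounit_tmul F 1 (inertia F m)).trans (one_smul _ _)).symm

theorem twistInertia_rTensor_scaleX {V : Type u} [AddCommGroup V] [Module C V]
    (d : V →ₗ[C] V ⊗[C] CoordGL C) (z : CoordX C q ⊗[C] V) :
    twistInertia q (CoordX C q) d ((scaleX C q).toLinearMap.rTensor V z) =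
      (scaleX C q).toLinearMap.rTensor V (twistInertia q (CoordX C q) d z) := by
  induction z with
  | zero => simp
  | add x y hx hy => simp only [map_add, hx, hy]
  | tmul x v =>
    rw [LinearMap.rTensor_tmul, twistInertia_tmul, twistInertia_tmul]
    generalize d v = t
    induction t with
    | zero => simp
    | add x y hx hy => simp only [TensorProduct.tmul_add, map_add, hx, hy]
    | tmul w h => simp [TensorProduct.smul_tmul', scaleX_proj]

theorem evalφ_tensorCoact {V : Type u} [AddCommGroup V] [Module C V]
    (d : V →ₗ[C] V ⊗[C] CoordGL C) (z : CoordX C q ⊗[C] V) :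
    evalφ q (CoordX C q ⊗[C] V) (tensorCoact (CoordX C q) V (CoordGL C)
      (CoordX.act C q).toLinearMap d z) =
      twistInertia q (CoordX C q) d ((scaleX C q).toLinearMap.rTensor V z) := by
  induction z with
  | zero => simp
  | add x y hx hy => simp only [map_add, hx, hy]
  | tmul a v =>
    rw [tensorCoact_tmul, LinearMap.rTensor_tmul, twistInertia_tmul, AlgHom.toLinearMap_apply,
      AlgHom.toLinearMap_apply, scaleX_apply]
    generalize CoordX.act C q a = t
    generalize d v = s
    induction t with
    | zero => simp
    | add x y hx hy =>
      simp only [map_add, LinearMap.add_apply, TensorProduct.add_tmul, hx, hy]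
    | tmul x h =>
      induction s with
      | zero => simp
      | add x y hx hy => simp only [map_add, TensorProduct.tmul_add, hx, hy]
      | tmul y k => simp [TensorProduct.smul_tmul', mul_comm, mul_left_comm]

/-- The group acts diagonally on `A ⊗ V`, so `φ` acts by the scaling of `N` on `A` together with its
linear action through `V`. -/
theorem inertia_freeOn (V : RightComodule C (CoordGL C)) (z : CoordX C q ⊗[C] V.carrier) :
    inertia (freeOn q V) z =
      twistInertia q (CoordX C q) V.coact ((scaleX C q).toLinearMap.rTensor V.carrier z) :=
  evalφ_tensorCoact V.coact z

theorem lTensor_rTensor_scaleX (z : CoordX C q ⊗[C] F.carrier) :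
    (inertia F).lTensor (CoordX C q) ((scaleX C q).toLinearMap.rTensor F.carrier z) =
      TensorProduct.map (scaleX C q).toLinearMap (inertia F) z := by
  rw [← LinearMap.comp_apply, LinearMap.lTensor_comp_rTensor]

theorem rTensor_lTensor_scaleX (z : CoordX C q ⊗[C] F.carrier) :
    (scaleX C q).toLinearMap.rTensor F.carrier ((inertia F).lTensor (CoordX C q) z) =
      TensorProduct.map (scaleX C q).toLinearMap (inertia F) z := by
  rw [← LinearMap.comp_apply, LinearMap.rTensor_comp_lTensor]

/-- Up to the defect, the action through the representation may be replaced by `inertia F`. The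
result `scaleX ⊗ inertia F` is an honest tensor product of operators, whose weights are controlled
by those of its factors. -/
theorem inertia_freeOn_sub (z : CoordX C q ⊗[C] F.carrier) :
    inertia (freeOn q F.toComodule) z -
      (inertiaDefect F).toLin ((scaleX C q).toLinearMap.rTensor F.carrier z) =
        TensorProduct.map (scaleX C q).toLinearMap (inertia F) z := by
  rw [← lTensor_rTensor_scaleX]
  refine (congrArg₂ (· - ·) (inertia_freeOn F.toComodule z) (inertiaDefect_apply F _)).trans ?_
  exact sub_sub_cancel (G := CoordX C q ⊗[C] F.carrier) _ _

/-- On the kernel of the defect the two actions coincide before scaling, and scaling commutes with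
the linear action of `φ`, whose coefficients do not involve `N`. -/
theorem inertia_freeOn_of_ker (z : CoordX C q ⊗[C] F.carrier) (hz : (inertiaDefect F).toLin z = 0) :
    inertia (freeOn q F.toComodule) z =
      TensorProduct.map (scaleX C q).toLinearMap (inertia F) z := by
  refine (inertia_freeOn F.toComodule z).trans ?_
  replace hz := sub_eq_zero.1 ((inertiaDefect_apply F z).symm.trans hz)
  refine (twistInertia_rTensor_scaleX F.coact z).trans ?_
  exact (congrArg _ hz).trans (rTensor_lTensor_scaleX F z)

variable {F} {b : ℕ}

theorem HasWeightsGE.tensor (hq : (q : C) ≠ 0) (hF : HasWeightsGE F b) :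
    weightSubmodule q b (TensorProduct.map (scaleX C q).toLinearMap (inertia F)) = ⊤ := by
  refine eq_top_iff.2 fun z hz => ?_
  clear hz
  induction z with
  | zero => exact zero_mem _
  | add x y hx hy => exact add_mem hx hy
  | tmul a m =>
    have ha : a ∈ Submodule.span C {a : CoordX C q | ∃ e : ℕ, scaleX C q a = (q : C) ^ e • a} :=
      span_scaleX_eigen (q := q) hq ▸ Submodule.mem_top
    induction ha using Submodule.span_induction with
    | mem x hx =>
      obtain ⟨e, he⟩ := hx
      exact tmul_mem_weightSubmodule (S := (scaleX C q).toLinearMap) he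
        (hF ▸ Submodule.mem_top : m ∈ weightSubmodule q b (inertia F))
    | zero => rw [TensorProduct.zero_tmul]; exact zero_mem _
    | add x y _ _ hx hy => rw [TensorProduct.add_tmul]; exact add_mem hx hy
    | smul c x _ hx => rw [← TensorProduct.smul_tmul']; exact Submodule.smul_mem _ _ hx

/-- Since `p` kills the defect, it intertwines `scaleX ⊗ inertia F` with `inertia Q`, and the former
has weights `≥ b` because `A` only has weights `q ^ e` with `e ≥ 0`. -/
theorem HasWeightsGE.of_epi_defect (hq : (q : C) ≠ 0) (hF : HasWeightsGE F b)
    {Q : QCohXModG C q} (p : freeOn q F.toComodule ⟶ Q) [Epi p] (hp : inertiaDefect F ≫ p = 0) :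
    HasWeightsGE Q b := by
  refine eq_top_iff.2 fun m _ => ?_
  obtain ⟨(m : CoordX C q ⊗[C] F.carrier), rfl⟩ := surjective_of_epi p m
  refine apply_mem_weightSubmodule (M := CoordX C q ⊗[C] F.carrier) (m := m)
    (S := TensorProduct.map (scaleX C q).toLinearMap (inertia F)) (p.toLin.restrictScalars C)
    (fun z => ?_) (hF.tensor hq ▸ Submodule.mem_top)
  have h2 : p.toLin ((inertiaDefect F).toLin ((scaleX C q).toLinearMap.rTensor F.carrier z)) = 0 :=
    congrArg (fun t => Hom.toLin t ((scaleX C q).toLinearMap.rTensor F.carrier z)) hp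
  refine (congrArg p.toLin (inertia_freeOn_sub F z)).symm.trans ?_
  refine (map_sub p.toLin _ _).trans ?_
  refine (congrArg₂ (· - ·) (map_inertia p _) h2).trans ?_
  exact sub_zero _

theorem HasWeightsGE.of_mono_defect (hq : (q : C) ≠ 0) (hF : HasWeightsGE F b)
    {K : QCohXModG C q} (i : K ⟶ freeOn q F.toComodule) [Mono i] (hi : i ≫ inertiaDefect F = 0) :
    HasWeightsGE K b := by
  refine eq_top_iff.2 fun m _ => ?_
  refine mem_weightSubmodule_of_injective (N := CoordX C q ⊗[C] F.carrier)
    (T := TensorProduct.map (scaleX C q).toLinearMap (inertia F)) (i.toLin.restrictScalars C)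
    (fun z => ?_) (injective_of_mono i) (hF.tensor hq ▸ Submodule.mem_top)
  exact (map_inertia i z).trans (inertia_freeOn_of_ker F _ (congrArg (fun t => Hom.toLin t z) hi))

/-- As `φ` acts on `W` by `c`, the composite of the defect with a map given by `g'` on generators is
given by `g' ∘ (c - inertia F)`. So `g'` is taken to be `g` after the inverse of `c - inertia F`,
which exists because `c` is not a weight of `F`. -/
theorem HasWeightsGE.exists_defect_comp (hF : HasWeightsGE F b) {W : QCohXModG C q} {c : C}
    (hc : ∀ d, b ≤ d → c ≠ (q : C) ^ d) (hW : ∀ x, inertia W x = c • x)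
    (g : freeOn q F.toComodule ⟶ W) : ∃ h, inertiaDefect F ≫ h = g := by
  let e := LinearEquiv.ofBijective _ (bijective_smul_id_sub hc hF)
  -- The inverse is equivariant because `inertia F` is, so `g'` does define a morphism.
  have he : ∀ m, F.coact (e.symm m) = e.symm.toLinearMap.rTensor (CoordGL C) (F.coact m) := by
    intro m
    obtain ⟨m, rfl⟩ := e.surjective m
    have h1 : ∀ x, F.coact (e x) = e.toLinearMap.rTensor (CoordGL C) (F.coact x) := by
      intro x
      have h2 : e.toLinearMap = c • LinearMap.id - inertia F := rfl
      have h3 : e x = c • x - inertia F x := rfl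
      rw [h2, h3, map_sub, map_smul, coact_inertia, LinearMap.rTensor_sub, LinearMap.rTensor_smul,
        LinearMap.rTensor_id]
      rfl
    rw [h1, LinearEquiv.symm_apply_apply, ← LinearMap.rTensor_comp_apply]
    simp
  let g' : F.carrier →ₗ[C] W.carrier := freeRestrict (V := F.toComodule) g ∘ₗ e.symm.toLinearMap
  have hg' : ∀ v, W.coact (g' v) = g'.rTensor (CoordGL C) (F.coact v) := fun v =>
    (coact_freeRestrict (V := F.toComodule) g (e.symm v)).trans
      ((congrArg _ (he v)).trans (LinearMap.rTensor_comp_apply (CoordGL C)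
        (freeRestrict (V := F.toComodule) g) e.symm.toLinearMap (F.coact v)).symm)
  let h : freeOn q F.toComodule ⟶ W := freeLift (V := F.toComodule) g' hg'
  refine ⟨h, freeOn_hom_ext fun (m : F.carrier) => ?_⟩
  have h1 : h.toLin ((twistInertiaHom (structureSheafX C q) F.toComodule).toLin
      ((1 : CoordX C q) ⊗ₜ[C] m)) = inertia W (g' m) := by
    refine (congrArg h.toLin (twistInertia_tmul q F.coact (1 : CoordX C q) m)).trans ?_
    rw [inertia_apply, hg']
    generalize F.coact m = t
    induction t with
    | zero =>
      rw [TensorProduct.tmul_zero, map_zero, map_zero, map_zero, map_zero]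
      exact map_zero h.toLin
    | add x y hx hy =>
      rw [map_add, map_add, ← hx, ← hy, TensorProduct.tmul_add, map_add, map_add]
      exact map_add h.toLin _ _
    | tmul w x =>
      rw [TensorProduct.assoc_symm_tmul, evalφ_tmul, LinearMap.rTensor_tmul, evalφ_tmul,
        TensorProduct.smul_tmul', smul_eq_mul, mul_one]
      exact freeLift_tmul (V := F.toComodule) g' hg' _ w
  have h2 : h.toLin ((freeInertia F).toLin ((1 : CoordX C q) ⊗ₜ[C] m)) = g' (inertia F m) := by
    refine (congrArg h.toLin (freeInertia_apply F ((1 : CoordX C q) ⊗ₜ[C] m))).trans ?_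
    exact (freeLift_tmul (V := F.toComodule) g' hg' 1 (inertia F m)).trans (one_smul _ _)
  have h3 : freeRestrict (V := F.toComodule) (inertiaDefect F ≫ h) m =
      inertia W (g' m) - g' (inertia F m) := by
    rw [inertiaDefect, Preadditive.sub_comp, ← h1, ← h2, sub_eq_add_neg, sub_eq_add_neg]
    rfl
  have h4 : g' (e m) = freeRestrict (V := F.toComodule) g m :=
    congrArg (freeRestrict (V := F.toComodule) g) (e.symm_apply_apply m)
  have h5 : e m = c • m - inertia F m := rfl
  rw [h3, hW, ← map_smul, ← map_sub, ← h5, h4]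

end Defect

end Weights

/-! ### Vanishing of extension groups -/

section ExtGeneral

universe v' u'

open Abelian

variable {𝒜 : Type u'} [Category.{v'} 𝒜] [Abelian 𝒜]

theorem shortExact_kernel {X Y : 𝒜} (f : X ⟶ Y) [Epi f] :
    (ShortComplex.mk (kernel.ι f) f (kernel.condition f)).ShortExact where
  exact := ShortComplex.exact_of_f_is_kernel _ (kernelIsKernel f)

theorem shortExact_cokernel {X Y : 𝒜} (f : X ⟶ Y) [Mono f] :
    (ShortComplex.mk f (cokernel.π f) (cokernel.condition f)).ShortExact where
  exact := ShortComplex.exact_of_g_is_cokernel _ (cokernelIsCokernel f)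

variable [HasExt.{w} 𝒜]

theorem Ext.subsingleton_zero {X Y : 𝒜} (h : ∀ f : X ⟶ Y, f = 0) : Subsingleton (Ext X Y 0) :=
  have : Subsingleton (X ⟶ Y) := ⟨fun f g => (h f).trans (h g).symm⟩
  Ext.homEquiv₀.subsingleton

/-- Dimension shifting for an endomorphism `v` of a projective object along which morphisms to `W`
extend. -/
theorem Ext.subsingleton_cokernel {P W : 𝒜} [Projective P] (v : P ⟶ P)
    (hv : ∀ g : P ⟶ W, ∃ h, v ≫ h = g) (n : ℕ)
    (hK : ∀ k, k < n → Subsingleton (Ext (kernel v) W k)) :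
    Subsingleton (Ext (cokernel v) W (n + 1)) := by
  have hP : ∀ (m : ℕ) (x : Ext P W (m + 1)), x = 0 := fun m x => Ext.eq_zero_of_projective x
  have hS : (ShortComplex.mk (Abelian.image.ι v) (cokernel.π v)
      (kernel.condition (cokernel.π v))).ShortExact := shortExact_kernel (cokernel.π v)
  refine subsingleton_of_forall_eq 0 fun x => ?_
  obtain ⟨y, rfl⟩ := Ext.contravariant_sequence_exact₃ hS W x (hP _ _) (add_comm 1 n)
  cases n with
  | zero =>
    obtain ⟨β, rfl⟩ := (Ext.mk₀_bijective _ _).2 y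
    -- In degree one the class is the boundary of a map `β` on the image of `v`. The hypothesis
    -- extends `β` to `P`, so the boundary vanishes.
    obtain ⟨h, hh⟩ := hv (Abelian.factorThruImage v ≫ β)
    have hβ : β = Abelian.image.ι v ≫ h := by
      rw [← cancel_epi (Abelian.factorThruImage v), ← hh, ← Category.assoc, Abelian.image.fac]
    have := hS.extClass_comp_assoc (Ext.mk₀ h) (h := add_zero 1)
    rw [Ext.mk₀_comp_mk₀] at this
    rw [hβ]
    exact this
  | succ k =>
    -- In higher degrees a second shift, along `0 → ker v → P → im v → 0`, lands in an extension
    -- group of the kernel.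
    have hS' : (ShortComplex.mk (kernel.ι v) (Abelian.factorThruImage v) (by
        rw [← cancel_mono (Abelian.image.ι v), Category.assoc, Abelian.image.fac, zero_comp,
          kernel.condition])).ShortExact :=
      { exact := ShortComplex.exact_of_f_is_kernel _ (KernelFork.IsLimit.ofι' _ _ fun l hl =>
          ⟨kernel.lift v l (by rw [← Abelian.image.fac v, ← Category.assoc, hl, zero_comp]),
            kernel.lift_ι _ _ _⟩)
        mono_f := inferInstanceAs (Mono (kernel.ι v))
        epi_g := inferInstanceAs (Epi (Abelian.factorThruImage v)) }
    obtain ⟨z, rfl⟩ := Ext.contravariant_sequence_exact₃ hS' W y (hP _ _) (add_comm 1 k)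
    have := hK k (Nat.lt_succ_self k)
    rw [Subsingleton.elim z 0, Ext.comp_zero, Ext.comp_zero]

/-- If a class `α` dies under `κ`, and there are no classes with values in the kernel of `κ` and
none of lower degree with values in the cokernel, then `α = 0`. -/
theorem Ext.eq_zero_of_comp_eq_zero {F K M L : 𝒜} (i : K ⟶ M) [Mono i] (κ : M ⟶ L)
    (w : i ≫ κ = 0) [Mono (cokernel.desc i κ w)] (n : ℕ) (hK : Subsingleton (Ext F K (n + 1)))
    (hQ : Subsingleton (Ext F (cokernel (cokernel.desc i κ w)) n)) (α : Ext F M (n + 1))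
    (hα : α.comp (Ext.mk₀ κ) (add_zero _) = 0) : α = 0 := by
  -- The image of `α` with values in the cokernel of `i` dies after the injection into `L`, so it is
  -- a boundary from the cokernel of that injection, where there are no classes.
  have h1 : (α.comp (Ext.mk₀ (cokernel.π i)) (add_zero _)).comp
      (Ext.mk₀ (cokernel.desc i κ w)) (add_zero _) = 0 := by
    rw [Ext.comp_assoc_of_third_deg_zero, Ext.mk₀_comp_mk₀, cokernel.π_desc, hα]
  obtain ⟨x, hx⟩ := Ext.covariant_sequence_exact₁ F (shortExact_cokernel (cokernel.desc i κ w))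
    _ h1 rfl
  rw [Subsingleton.elim (α := Ext F (cokernel (cokernel.desc i κ w)) n) x 0, Ext.zero_comp] at hx
  obtain ⟨y, rfl⟩ := Ext.covariant_sequence_exact₂ F (shortExact_cokernel i) α hx.symm
  rw [Subsingleton.elim (α := Ext F K (n + 1)) y 0, Ext.zero_comp]

/-- A natural transformation from the identity to an exact functor slides through extension
classes. -/
theorem Ext.exists_comp_natTrans [EnoughProjectives 𝒜] (T : 𝒜 ⥤ 𝒜) [T.PreservesZeroMorphisms]
    (hT : ∀ S : ShortComplex 𝒜, S.ShortExact → (S.map T).ShortExact) (ν : 𝟭 𝒜 ⟶ T) {M : 𝒜} (n : ℕ)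
    {F : 𝒜} (α : Ext F M n) : ∃ α' : Ext (T.obj F) (T.obj M) n,
      α.comp (Ext.mk₀ (ν.app M)) (add_zero n) = (Ext.mk₀ (ν.app F)).comp α' (zero_add n) := by
  induction n generalizing F with
  | zero =>
    obtain ⟨f, rfl⟩ := (Ext.mk₀_bijective _ _).2 α
    exact ⟨Ext.mk₀ (T.map f), by
      rw [Ext.mk₀_comp_mk₀, Ext.mk₀_comp_mk₀]
      exact congrArg Ext.mk₀ (ν.naturality f)⟩
  | succ n ih =>
    have hS := shortExact_kernel (Projective.π F)
    -- With a projective cover object in the middle, `α` is the extension class of the cover times a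
    -- class of lower degree. Induction handles the latter, and naturality of extension classes the
    -- former.
    obtain ⟨β, rfl⟩ := Ext.contravariant_sequence_exact₃ hS M α
      (Ext.eq_zero_of_projective (P := Projective.over F) _) (add_comm 1 n)
    obtain ⟨β', hβ'⟩ := ih β
    refine ⟨(hT _ hS).extClass.comp β' (add_comm 1 n), ?_⟩
    let S := ShortComplex.mk (kernel.ι (Projective.π F)) (Projective.π F) (kernel.condition _)
    let φ : S ⟶ S.map T :=
      { τ₁ := ν.app _
        τ₂ := ν.app _
        τ₃ := ν.app _
        comm₁₂ := (ν.naturality _).symm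
        comm₂₃ := (ν.naturality _).symm }
    have h1 := ShortComplex.ShortExact.extClass_naturality hS (hT _ hS) φ
    rw [Ext.comp_assoc_of_third_deg_zero, hβ', ← Ext.comp_assoc_of_second_deg_zero]
    refine (congrArg (fun t => Ext.comp t β' (add_comm 1 n)) h1).trans ?_
    exact Ext.comp_assoc _ _ _ _ _ (by omega)

end ExtGeneral

/-! ### Orthogonality of weights for extension groups -/

section Weights

open EquivariantModule Abelian

variable {C : Type u} [Field C] [CharZero C] {q : ℕ}

instance enoughProjectives_qCohXModG : EnoughProjectives (QCohXModG C q) where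
  presentation F := ⟨{ p := freeOn q F.toComodule, f := freeCounit F }⟩

variable [HasExt.{w} (QCohXModG C q)]

/-- There are no extensions between equivariant modules with disjoint weights. -/
theorem HasWeightsGE.ext_subsingleton (hq : (q : C) ≠ 0) {W : QCohXModG C q} {b : ℕ} {c : C}
    (hc : ∀ d, b ≤ d → c ≠ (q : C) ^ d) (hW : ∀ x, inertia W x = c • x) (n : ℕ)
    {F : QCohXModG C q} (hF : HasWeightsGE F b) : Subsingleton (Ext F W n) := by
  induction n using Nat.strong_induction_on generalizing F with
  | _ n ih =>
    cases n with
    | zero => exact Ext.subsingleton_zero fun f => hF.hom_eq_zero hc hW f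
    | succ n =>
      have hQ := hF.of_epi_defect hq (cokernel.π (inertiaDefect F)) (cokernel.condition _)
      have hK := hF.of_mono_defect hq (kernel.ι (inertiaDefect F)) (kernel.condition _)
      -- The shift involves only the kernel in degrees below `n`, to which the induction hypothesis
      -- applies, as the kernel again has weights `≥ b`.
      have hQ' := Ext.subsingleton_cokernel (W := W) (inertiaDefect F)
        (hF.exists_defect_comp hc hW) n (fun k hk => ih k (by omega) hK)
      let π : cokernel (inertiaDefect F) ⟶ F :=
        cokernel.desc (inertiaDefect F) (freeCounit F) (inertiaDefect_freeCounit F)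
      have : Epi (cokernel.π (inertiaDefect F) ≫ π) := by
        rw [cokernel.π_desc]; infer_instance
      have : Epi π := epi_of_epi (cokernel.π (inertiaDefect F)) π
      -- The kernel of `π` is a submodule of the cokernel of the defect, so its weights are also `≥
      -- b`; it accounts for the error in replacing that cokernel by `F`.
      have := ih n (Nat.lt_succ_self n) (hQ.of_mono (kernel.ι π))
      refine subsingleton_of_forall_eq 0 fun x => ?_
      obtain ⟨y, rfl⟩ := Ext.contravariant_sequence_exact₃ (shortExact_kernel π) W x
        (Subsingleton.elim (α := Ext (cokernel (inertiaDefect F)) W (n + 1)) _ _) (add_comm 1 n)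
      rw [Subsingleton.elim (α := Ext (kernel π) W n) y 0, Ext.comp_zero]

end Weights

/-! ### The structure sheaves -/

section StructureSheaves

variable {C : Type u} [Field C] {q : ℕ}

open EquivariantModule

theorem inertia_structureSheafX (a : CoordX C q) :
    inertia (structureSheafX C q) a = scaleX C q a := (scaleX_apply a).symm

theorem N_mem_idealX₀ (i j : Fin 2) : CoordX.N C q i j ∈ idealX₀ C q :=
  Ideal.subset_span ⟨(i, j), rfl⟩

variable (C q) in
/-- Restriction of functions to the locus `N = 0`. -/
noncomputable def CoordX.zeroSection : CoordX C q →ₐ[C] CoordGL C :=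
  CoordX.lift (CoordGL.univ C) 0 (by simp)

theorem CoordX.zeroSection_proj (h : CoordGL C) :
    CoordX.zeroSection C q (CoordX.proj C q h) = h := by
  have : (CoordX.zeroSection C q).comp (CoordX.proj C q) = AlgHom.id C (CoordGL C) := by
    rw [CoordX.zeroSection, CoordX.lift_proj]
    exact CoordGL.hom_ext (CoordGL.mapGL_lift _)
  exact AlgHom.congr_fun this h

theorem CoordX.zeroSection_N (i j : Fin 2) : CoordX.zeroSection C q (CoordX.N C q i j) = 0 :=
  congrFun (congrFun (CoordX.map_lift_N (C := C) (q := q) (CoordGL.univ C) 0 (by simp)) i) j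

theorem CoordX.proj_injective : Function.Injective (CoordX.proj C q) :=
  Function.LeftInverse.injective CoordX.zeroSection_proj

theorem sub_proj_zeroSection_mem (a : CoordX C q) :
    a - CoordX.proj C q (CoordX.zeroSection C q a) ∈ idealX₀ C q := by
  induction a using CoordX.induction_on with
  | hproj h => simp [CoordX.zeroSection_proj]
  | hadd a b ha hb =>
    rw [map_add, map_add, add_sub_add_comm]
    exact add_mem ha hb
  | hmul a i j ha =>
    rw [map_mul, CoordX.zeroSection_N, mul_zero, map_zero, sub_zero]
    exact Ideal.mul_mem_left _ _ (N_mem_idealX₀ i j)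

theorem zeroSection_eq_zero {a : CoordX C q} (ha : a ∈ idealX₀ C q) :
    CoordX.zeroSection C q a = 0 := by
  have : idealX₀ C q ≤ RingHom.ker (CoordX.zeroSection C q).toRingHom :=
    Ideal.span_le.2 (by rintro _ ⟨p, rfl⟩; exact CoordX.zeroSection_N p.1 p.2)
  exact this ha

theorem scaleX_sub_mem (hq : (q : C) ≠ 0) (a : CoordX C q) : scaleX C q a - a ∈ idealX₀ C q := by
  induction a using CoordX.induction_on with
  | hproj h => simp [scaleX_proj]
  | hadd a b ha hb =>
    rw [map_add, add_sub_add_comm]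
    exact add_mem ha hb
  | hmul a i j ha =>
    rw [map_mul, scaleX_N hq, mul_smul_comm, ← smul_mul_assoc, ← sub_mul]
    exact Ideal.mul_mem_left _ _ (N_mem_idealX₀ i j)

theorem mul_mem_weightSubmodule_scaleX (hq : (q : C) ≠ 0) {b : ℕ} (a : CoordX C q)
    {x : CoordX C q} (hx : x ∈ weightSubmodule q b (scaleX C q).toLinearMap) :
    a * x ∈ weightSubmodule q b (scaleX C q).toLinearMap := by
  have ha : a ∈ Submodule.span C {a : CoordX C q | ∃ e : ℕ, scaleX C q a = (q : C) ^ e • a} :=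
    span_scaleX_eigen (q := q) hq ▸ Submodule.mem_top
  induction ha using Submodule.span_induction with
  | mem y hy =>
    obtain ⟨e, he⟩ := hy
    refine apply_mem_weightSubmodule (LinearMap.mul' C (CoordX C q)) (fun t => ?_)
      (tmul_mem_weightSubmodule (S := (scaleX C q).toLinearMap) he hx)
    induction t with
    | zero => simp
    | add x y hx hy => simp only [map_add, hx, hy]
    | tmul x y => simp
  | zero => rw [zero_mul]; exact zero_mem _
  | add x y _ _ hx hy => rw [add_mul]; exact add_mem hx hy
  | smul c x _ hx => rw [smul_mul_assoc]; exact Submodule.smul_mem _ _ hx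

/-- The entries of `N` have weight `q`, and multiplication by functions never lowers the exponent.
-/
theorem mem_weightSubmodule_scaleX_of_mem (hq : (q : C) ≠ 0) {a : CoordX C q}
    (ha : a ∈ idealX₀ C q) : a ∈ weightSubmodule q 1 (scaleX C q).toLinearMap := by
  refine Submodule.span_induction (p := fun a _ => a ∈ weightSubmodule q 1
    (scaleX C q).toLinearMap) ?_ (zero_mem _) (fun x y _ _ hx hy => add_mem hx hy)
    (fun a x _ hx => mul_mem_weightSubmodule_scaleX hq a hx) ha
  rintro _ ⟨p, rfl⟩
  exact mem_weightSubmodule_of_eq (le_refl 1) (by rw [pow_one]; exact scaleX_N hq p.1 p.2)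

theorem hasWeightsGE_structureSheafX (hq : (q : C) ≠ 0) : HasWeightsGE (structureSheafX C q) 0 := by
  refine eq_top_iff.2 fun (a : CoordX C q) _ => ?_
  have h1 : (1 : CoordX C q) ∈ weightSubmodule q 0 (scaleX C q).toLinearMap :=
    mem_weightSubmodule_of_eq (le_refl 0) (by simp)
  have := mul_mem_weightSubmodule_scaleX hq a h1
  rw [mul_one] at this
  exact apply_mem_weightSubmodule (T := inertia (structureSheafX C q)) LinearMap.id
    (fun m => (inertia_structureSheafX m).symm) this

theorem surjective_projX₀ : Function.Surjective (projX₀ C q).toLin :=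
  Submodule.mkQ_surjective (idealX₀ C q)

instance : Epi (projX₀ C q) := epi_of_surjective _ surjective_projX₀

theorem projX₀_eq_zero_iff (a : CoordX C q) : (projX₀ C q).toLin a = 0 ↔ a ∈ idealX₀ C q :=
  Submodule.Quotient.mk_eq_zero _

theorem hasWeightsGE_structureSheafX₀ (hq : (q : C) ≠ 0) :
    HasWeightsGE (structureSheafX₀ C q) 0 :=
  (hasWeightsGE_structureSheafX hq).of_epi (projX₀ C q)

theorem inertia_structureSheafX₀ (hq : (q : C) ≠ 0) (x : (structureSheafX₀ C q).carrier) :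
    inertia (structureSheafX₀ C q) x = (1 : C) • x := by
  obtain ⟨(a : CoordX C q), rfl⟩ := surjective_projX₀ x
  refine (map_inertia (projX₀ C q) a).symm.trans ?_
  refine (congrArg (projX₀ C q).toLin (inertia_structureSheafX a)).trans ?_
  refine Eq.trans ?_ (one_smul C _).symm
  exact (Submodule.Quotient.eq _).2 (scaleX_sub_mem hq a)

theorem hasWeightsGE_kernel_projX₀ (hq : (q : C) ≠ 0) :
    HasWeightsGE (kernel (projX₀ C q)) 1 := by
  refine eq_top_iff.2 fun m _ => ?_
  refine mem_weightSubmodule_of_injective (N := CoordX C q) (T := (scaleX C q).toLinearMap)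
    ((kernel.ι (projX₀ C q)).toLin.restrictScalars C) (fun z => ?_)
    (injective_of_mono (kernel.ι (projX₀ C q))) ?_
  · exact (map_inertia (kernel.ι (projX₀ C q)) z).trans (inertia_structureSheafX _)
  · refine mem_weightSubmodule_scaleX_of_mem hq ((projX₀_eq_zero_iff _).1 ?_)
    exact congrArg (fun t => Hom.toLin t m) (kernel.condition (projX₀ C q))

theorem smul_id_apply (z : InvariantRing C) (a : CoordX C q) :
    (z • 𝟙 (structureSheafX C q)).toLin a = CoordX.proj C q z * a := rfl

theorem smul_projX₀_apply (z : InvariantRing C) (a : CoordX C q) :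
    (z • projX₀ C q).toLin a = (projX₀ C q).toLin (CoordX.proj C q z * a) := rfl

/-- The locus `N = 0` is a copy of `GL₂`, so restriction to it recovers `z`. -/
theorem smul_projX₀_injective {z : InvariantRing C} (hz : z • projX₀ C q = 0) : z = 0 := by
  have h1 : (z • projX₀ C q).toLin (1 : CoordX C q) = 0 :=
    congrArg (fun t => Hom.toLin t (1 : CoordX C q)) hz
  rw [smul_projX₀_apply, projX₀_eq_zero_iff, mul_one] at h1
  have h2 := zeroSection_eq_zero h1
  rw [CoordX.zeroSection_proj] at h2
  exact Subtype.ext h2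

variable [CharZero C]

theorem one_ne_natCast_pow (hq : 2 ≤ q) (d : ℕ) (hd : 1 ≤ d) : (1 : C) ≠ (q : C) ^ d := by
  rw [← Nat.cast_pow, ne_comm, Nat.cast_ne_one]
  exact (Nat.one_lt_pow (by omega) (by omega)).ne'

theorem inv_natCast_ne_pow (hq : 2 ≤ q) (d : ℕ) : (q : C)⁻¹ ≠ (q : C) ^ d := by
  have h0 : (q : C) ≠ 0 := by exact_mod_cast (by omega : q ≠ 0)
  intro h
  refine one_ne_natCast_pow (C := C) hq (d + 1) (by omega) ?_
  rw [pow_succ, ← h, inv_mul_cancel₀ h0]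

theorem natCast_ne_zero_of_two_le (hq : 2 ≤ q) : (q : C) ≠ 0 := by
  exact_mod_cast (by omega : q ≠ 0)

/-- Invariant functions on `X` are invariant functions of `φ`. -/
theorem exists_invariant_of_act_eq (hq : 2 ≤ q) {a : CoordX C q}
    (ha : CoordX.act C q a = a ⊗ₜ 1) : ∃ z : InvariantRing C, a = CoordX.proj C q z := by
  have hq0 := natCast_ne_zero_of_two_le (C := C) hq
  -- Evaluating the invariance at the group element `φ` shows that `a` is unchanged under `N ↦ q N`.
  have h1 : scaleX C q a = a := by rw [scaleX_apply, ha, evalφ_tmul, map_one, one_smul]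
  have h2 : a = CoordX.proj C q (CoordX.zeroSection C q a) := by
    -- The difference between `a` and its restriction to `N = 0` has weight `1`, yet it lies in an
    -- ideal with weights `q ^ d`, `d ≥ 1`.
    rw [← sub_eq_zero]
    refine eq_zero_of_mem_weightSubmodule (c := (1 : C)) (T := (scaleX C q).toLinearMap)
      (one_ne_natCast_pow hq) (mem_weightSubmodule_scaleX_of_mem hq0 (sub_proj_zeroSection_mem a))
      ?_
    rw [AlgHom.toLinearMap_apply, map_sub, scaleX_proj, h1, one_smul]
  refine ⟨⟨CoordX.zeroSection C q a, (mem_invariantRing C _).2 ?_⟩, h2⟩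
  rw [h2, act_proj_eq] at ha
  -- Restricting to `N = 0` transfers invariance from `X` back to `GL₂`.
  have h3 := congrArg (Algebra.TensorProduct.map (CoordX.zeroSection C q)
    (AlgHom.id C (CoordGL C))) ha
  rw [← AlgHom.comp_apply, ← Algebra.TensorProduct.map_comp, Algebra.TensorProduct.map_tmul,
    CoordX.zeroSection_proj] at h3
  have h4 : (CoordX.zeroSection C q).comp (CoordX.proj C q) = AlgHom.id C (CoordGL C) :=
    AlgHom.ext (CoordX.zeroSection_proj (q := q))
  rw [h4, AlgHom.comp_id, Algebra.TensorProduct.map_id] at h3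
  simpa using h3

theorem exists_smul_id_of_hom (hq : 2 ≤ q) (f : structureSheafX C q ⟶ structureSheafX C q) :
    ∃ z : InvariantRing C, z • 𝟙 (structureSheafX C q) = f := by
  obtain ⟨z, hz⟩ := exists_invariant_of_act_eq hq
    (a := f.toLin (1 : CoordX C q)) (coact_apply_one f)
  refine ⟨z, structureSheafX_hom_ext ?_⟩
  rw [smul_id_apply, mul_one]
  exact hz.symm

/-- Any morphism to `𝒪_{X₀}` from `𝒪_X` lifts to `𝒪_X` since the latter is projective. -/
theorem exists_smul_projX₀_of_hom (hq : 2 ≤ q) (f : structureSheafX C q ⟶ structureSheafX₀ C q) :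
    ∃ z : InvariantRing C, z • projX₀ C q = f := by
  obtain ⟨z, hz⟩ := exists_smul_id_of_hom hq (Projective.factorThru f (projX₀ C q))
  refine ⟨z, ?_⟩
  rw [← Projective.factorThru_comp f (projX₀ C q), ← hz, Linear.smul_comp, Category.id_comp]

end StructureSheaves

/-! ### Matrices with eigenvalues of ratio `q` -/

section RankOne

open Matrix

variable {R : Type*} [CommRing R]

/-- The spectral projections of a two by two matrix with eigenvalues `s` and `c s`. -/
structure SpectralPair (R : Type*) [CommRing R] where
  fst : Matrix (Fin 2) (Fin 2) R
  snd : Matrix (Fin 2) (Fin 2) R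
  add_eq : fst + snd = 1
  fst_snd : fst * snd = 0
  snd_fst : snd * fst = 0
  det_fst : fst.det = 0
  det_snd : snd.det = 0
  trace_fst : fst.trace = 1

namespace SpectralPair

/-- The image under a ring homomorphism. -/
def map {S : Type*} [CommRing S] (p : SpectralPair R) (f : R →+* S) : SpectralPair S where
  fst := p.fst.map f
  snd := p.snd.map f
  add_eq := by
    rw [← Matrix.map_add f (map_add f), p.add_eq, Matrix.map_one f (map_zero f) (map_one f)]
  fst_snd := by rw [← Matrix.map_mul, p.fst_snd, Matrix.map_zero f (map_zero f)]
  snd_fst := by rw [← Matrix.map_mul, p.snd_fst, Matrix.map_zero f (map_zero f)]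
  det_fst := by
    rw [← RingHom.mapMatrix_apply, ← RingHom.map_det, p.det_fst, map_zero]
  det_snd := by
    rw [← RingHom.mapMatrix_apply, ← RingHom.map_det, p.det_snd, map_zero]
  trace_fst := by
    have := congrArg f p.trace_fst
    rw [Matrix.trace_fin_two, map_add, map_one] at this
    rw [Matrix.trace_fin_two]
    exact this

variable (p : SpectralPair R)

theorem trace_snd : p.snd.trace = 1 := by
  have := congrArg Matrix.trace p.add_eq
  rw [Matrix.trace_add, p.trace_fst, Matrix.trace_one, Fintype.card_fin] at this
  push_cast at this
  linear_combination this

theorem fst_fst : p.fst * p.fst = p.fst := by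
  have := congrArg (p.fst * ·) p.add_eq
  simpa only [mul_add, p.fst_snd, add_zero, mul_one] using this

theorem snd_snd : p.snd * p.snd = p.snd := by
  have := congrArg (p.snd * ·) p.add_eq
  simpa only [mul_add, p.snd_fst, zero_add, mul_one] using this

/-- The off-diagonal component. -/
def corner (Y : Matrix (Fin 2) (Fin 2) R) : Matrix (Fin 2) (Fin 2) R := p.fst * Y * p.snd

theorem corner_map {S : Type*} [CommRing S] (f : R →+* S) (Y : Matrix (Fin 2) (Fin 2) R) :
    (p.map f).corner (Y.map f) = (p.corner Y).map f := by
  simp only [corner, map, Matrix.map_mul]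

theorem corner_smul (a : R) (Y : Matrix (Fin 2) (Fin 2) R) :
    p.corner (a • Y) = a • p.corner Y := by
  simp only [corner, Matrix.mul_smul, Matrix.smul_mul]

/-- The corner is of rank one. -/
theorem corner_mul_corner (Y Z : Matrix (Fin 2) (Fin 2) R) (i j k l : Fin 2) :
    p.corner Y i j * p.corner Z k l = p.corner Y k l * p.corner Z i j := by
  have h1 := p.det_fst
  have h2 := p.det_snd
  rw [Matrix.det_fin_two] at h1 h2
  -- Vanishing determinants make the projections of rank one, so their entries can be exchanged.
  have h3 : ∀ i a k c, p.fst i a * p.fst k c = p.fst k a * p.fst i c := by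
    intro i a k c
    fin_cases i <;> fin_cases a <;> fin_cases k <;> fin_cases c <;> simp <;>
      first | ring | linear_combination h1 | linear_combination -h1
  have h4 : ∀ i a k c, p.snd i a * p.snd k c = p.snd i c * p.snd k a := by
    intro i a k c
    fin_cases i <;> fin_cases a <;> fin_cases k <;> fin_cases c <;> simp <;>
      first | ring | linear_combination h2 | linear_combination -h2
  have key : ∀ (Y Z : Matrix (Fin 2) (Fin 2) R) (i j k l : Fin 2),
      p.corner Y i j * p.corner Z k l = ∑ d, ∑ c, ∑ b, ∑ a,
        (p.fst i a * p.fst k c) * (p.snd b j * p.snd d l) * (Y a b * Z c d) := by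
    intro Y Z i j k l
    simp only [corner, Matrix.mul_apply, Finset.sum_mul, Finset.mul_sum]
    exact Finset.sum_congr rfl fun b _ => Finset.sum_congr rfl fun a _ =>
      Finset.sum_congr rfl fun d _ => Finset.sum_congr rfl fun c _ => by ring
  rw [key, key]
  refine Finset.sum_congr rfl fun d _ => Finset.sum_congr rfl fun c _ =>
    Finset.sum_congr rfl fun b _ => Finset.sum_congr rfl fun a _ => ?_
  rw [h3 i a k c, h4 b j d l]

theorem corner_single (a b : Fin 2) :
    p.corner (Matrix.single a b 1) a b = p.fst a a * p.snd b b := by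
  simp [corner, Matrix.mul_apply, Matrix.single_apply, Fin.sum_univ_two]
  fin_cases a <;> fin_cases b <;> simp

/-- The sum is the product of the two traces. It provides a partition of unity for the line bundle
of corner matrices: each summand is an entry of a corner matrix by `corner_single`. -/
theorem sum_corner_single : ∑ a, ∑ b, p.fst a a * p.snd b b = 1 := by
  rw [← Finset.sum_mul_sum]
  have h1 := p.trace_fst
  have h2 := p.trace_snd
  rw [Matrix.trace] at h1 h2
  simp only [Matrix.diag_apply] at h1 h2
  rw [h1, h2, mul_one]

/-- The pair is adapted to the invertible matrix `P` if it consists of the projections to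
eigenspaces of `P` with eigenvalues `s` and `c s`. -/
def IsAdapted (P : GL (Fin 2) R) (c ci : R) : Prop :=
  ∃ s v : R, c * ci = 1 ∧ s * v = 1 ∧ P.val = s • p.fst + (c * s) • p.snd ∧
    P⁻¹.val = v • p.fst + (ci * v) • p.snd

variable {p} {P : GL (Fin 2) R} {c ci : R}

theorem IsAdapted.map (h : p.IsAdapted P c ci) {S : Type*} [CommRing S] (f : R →+* S) :
    (p.map f).IsAdapted (Matrix.GeneralLinearGroup.map f P) (f c) (f ci) := by
  obtain ⟨s, v, hc, hv, e1, e2⟩ := h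
  refine ⟨f s, f v, by rw [← map_mul, hc, map_one], by rw [← map_mul, hv, map_one], ?_, ?_⟩
  · ext i j
    have := congrArg f (congrFun (congrFun e1 i) j)
    simpa [SpectralPair.map] using this
  · have e : (Matrix.GeneralLinearGroup.map f P)⁻¹.val = P⁻¹.val.map f := by
      rw [← _root_.map_inv]; rfl
    rw [e, e2]
    ext i j
    simp [SpectralPair.map]

/-- Conjugation by `P` is diagonal on the four blocks cut out by the projections, with eigenvalues
the ratios `1`, `c⁻¹`, `c`, `1` of the eigenvalues of `P`; here `ci` is `c⁻¹`. -/
theorem IsAdapted.conj (h : p.IsAdapted P c ci) (Y : Matrix (Fin 2) (Fin 2) R) :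
    P.val * Y * P⁻¹.val =
    p.fst * Y * p.fst + ci • (p.fst * Y * p.snd) + c • (p.snd * Y * p.fst) + p.snd * Y * p.snd := by
  obtain ⟨s, v, hc, hv, e1, e2⟩ := h
  rw [e2, e1]
  have f1' : v * s = 1 := by rw [mul_comm, hv]
  have f2' : ci * v * s = ci := by linear_combination ci * hv
  have f3' : v * (c * s) = c := by linear_combination c * hv
  have f4' : ci * v * (c * s) = 1 := by linear_combination c * ci * hv + hc
  simp only [add_mul, mul_add, Matrix.smul_mul, Matrix.mul_smul, smul_smul, f1', f2',
    f3', f4', one_smul]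
  abel

theorem decomp (Y : Matrix (Fin 2) (Fin 2) R) :
    Y = p.fst * Y * p.fst + p.fst * Y * p.snd + p.snd * Y * p.fst + p.snd * Y * p.snd := by
  conv_lhs => rw [← one_mul Y, ← mul_one (1 * Y), ← p.add_eq]
  noncomm_ring

theorem IsAdapted.sub (h : p.IsAdapted P c ci) (Y : Matrix (Fin 2) (Fin 2) R) :
    P.val * Y * P⁻¹.val - ci • Y =
      (1 - ci) • (p.fst * Y * p.fst + p.snd * Y * p.snd) + (c - ci) • (p.snd * Y * p.fst) := by
  rw [h.conj Y]
  -- The fifth `Y` is the one in `ci • Y`; the first four already sit in blocks.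
  nth_rw 5 [decomp (p := p) Y]
  simp only [smul_add, sub_smul, one_smul]
  abel

theorem IsAdapted.corner_sub (h : p.IsAdapted P c ci) (Y : Matrix (Fin 2) (Fin 2) R) :
    p.corner (P.val * Y * P⁻¹.val - ci • Y) = 0 := by
  have e1 : p.fst * (p.fst * Y * p.fst) * p.snd = 0 := by
    rw [mul_assoc, mul_assoc _ p.fst, p.fst_snd, mul_zero, mul_zero]
  have e2 : p.fst * (p.snd * Y * p.snd) * p.snd = 0 := by
    rw [← mul_assoc, ← mul_assoc, p.fst_snd, zero_mul, zero_mul, zero_mul]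
  have e3 : p.fst * (p.snd * Y * p.fst) * p.snd = 0 := by
    rw [← mul_assoc, ← mul_assoc, p.fst_snd, zero_mul, zero_mul, zero_mul]
  rw [h.sub, corner, mul_add, add_mul, Matrix.mul_smul, Matrix.smul_mul, Matrix.mul_smul,
    Matrix.smul_mul, mul_add, add_mul, e1, e2, e3]
  simp

theorem IsAdapted.conj_corner (h : p.IsAdapted P c ci) (Y : Matrix (Fin 2) (Fin 2) R) :
    P.val * p.corner Y * P⁻¹.val = ci • p.corner Y := by
  have e1 : p.snd * p.corner Y = 0 := by
    rw [corner, ← mul_assoc, ← mul_assoc, p.snd_fst, zero_mul, zero_mul]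
  have e2 : p.corner Y * p.fst = 0 := by
    rw [corner, mul_assoc, p.snd_fst, mul_zero]
  have e3 : p.fst * p.corner Y * p.snd = p.corner Y := by
    rw [corner, ← mul_assoc, ← mul_assoc, p.fst_fst, mul_assoc _ p.snd, p.snd_snd]
  rw [h.conj, e1, e3, mul_assoc p.fst, e2]
  simp

/-- Eigenmatrices lie in the corner. -/
theorem IsAdapted.corner_eq (h : p.IsAdapted P c ci) (h1 : IsUnit (1 - ci)) (h2 : IsUnit (c - ci))
    {Y : Matrix (Fin 2) (Fin 2) R} (hY : P.val * Y * P⁻¹.val = ci • Y) : p.corner Y = Y := by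
  have h0 : (1 - ci) • (p.fst * Y * p.fst + p.snd * Y * p.snd) +
      (c - ci) • (p.snd * Y * p.fst) = 0 := by rw [← h.sub, hY, sub_self]
  have a1 : p.fst * Y * p.fst = 0 := by
    have := congrArg (p.fst * · * p.fst) h0
    simp only [mul_add, Matrix.mul_smul, Matrix.smul_mul, ← mul_assoc, p.fst_fst,
      p.fst_snd, zero_mul, mul_zero, add_zero, smul_zero] at this
    rw [mul_assoc _ p.fst p.fst, p.fst_fst] at this
    exact h1.smul_eq_zero.1 this
  have a2 : p.snd * Y * p.snd = 0 := by
    have := congrArg (p.snd * · * p.snd) h0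
    simp only [mul_add, add_mul, Matrix.mul_smul, Matrix.smul_mul, ← mul_assoc, p.snd_snd,
      p.snd_fst, zero_mul, mul_zero, zero_add] at this
    rw [mul_assoc _ p.snd p.snd, p.snd_snd, mul_assoc _ p.fst p.snd, p.fst_snd, mul_zero,
      smul_zero, add_zero] at this
    exact h1.smul_eq_zero.1 this
  have a3 : p.snd * Y * p.fst = 0 := by
    rw [a1, a2, add_zero, smul_zero, zero_add] at h0
    exact h2.smul_eq_zero.1 h0
  conv_rhs => rw [decomp (p := p) Y, a1, a2, a3]
  simp [corner]

/-- Outside the corner `Ad(P) - ci` acts on the blocks by the units `1 - ci` and `c - ci`, so `Z` is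
obtained by dividing blockwise. -/
theorem IsAdapted.exists_sub_corner (h : p.IsAdapted P c ci) (h1 : IsUnit (1 - ci))
    (h2 : IsUnit (c - ci)) (Y : Matrix (Fin 2) (Fin 2) R) :
    ∃ Z : Matrix (Fin 2) (Fin 2) R, Y - p.corner Y = P.val * Z * P⁻¹.val - ci • Z := by
  obtain ⟨x, hx⟩ := h1.exists_right_inv
  obtain ⟨y, hy⟩ := h2.exists_right_inv
  refine ⟨x • (p.fst * Y * p.fst + p.snd * Y * p.snd) + y • (p.snd * Y * p.fst), ?_⟩
  rw [h.sub]
  have b1 : p.fst * (x • (p.fst * Y * p.fst + p.snd * Y * p.snd) + y • (p.snd * Y * p.fst)) *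
      p.fst = x • (p.fst * Y * p.fst) := by
    simp only [mul_add, Matrix.mul_smul, Matrix.smul_mul, ← mul_assoc, p.fst_fst,
      p.fst_snd, zero_mul, add_zero, smul_zero]
    rw [mul_assoc _ p.fst p.fst, p.fst_fst]
  have b2 : p.snd * (x • (p.fst * Y * p.fst + p.snd * Y * p.snd) + y • (p.snd * Y * p.fst)) *
      p.snd = x • (p.snd * Y * p.snd) := by
    simp only [mul_add, add_mul, Matrix.mul_smul, Matrix.smul_mul, ← mul_assoc, p.snd_snd,
      p.snd_fst, zero_mul, zero_add]
    rw [mul_assoc _ p.snd p.snd, p.snd_snd, mul_assoc _ p.fst p.snd, p.fst_snd, mul_zero,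
      smul_zero, add_zero]
  have b3 : p.snd * (x • (p.fst * Y * p.fst + p.snd * Y * p.snd) + y • (p.snd * Y * p.fst)) *
      p.fst = y • (p.snd * Y * p.fst) := by
    simp only [mul_add, add_mul, Matrix.mul_smul, Matrix.smul_mul, ← mul_assoc, p.snd_snd,
      p.snd_fst, zero_mul, zero_add]
    rw [mul_assoc _ p.fst p.fst, p.fst_fst, mul_assoc _ p.snd p.fst, p.snd_fst, mul_zero,
      smul_zero, zero_add]
  rw [b1, b2, b3, ← smul_add, smul_smul, smul_smul, hx, hy, one_smul, one_smul]
  refine (congrArg (· - p.corner Y) (decomp (p := p) Y)).trans ?_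
  simp only [corner]
  abel

/-- An invertible matrix whose eigenvalues have ratio `c` has an adapted spectral pair. -/
theorem exists_isAdapted (P : GL (Fin 2) R) (c ci : R) (hc : c * ci = 1) (h1 : IsUnit (1 + c))
    (h2 : IsUnit (1 - c)) (hP : (1 + c) ^ 2 * P.val.det = c * P.val.trace ^ 2) :
    ∃ p : SpectralPair R, p.IsAdapted P c ci := by
  obtain ⟨e, he⟩ := h1.exists_right_inv
  obtain ⟨d, hd⟩ := h2.exists_right_inv
  obtain ⟨δ, hδ⟩ := ((Matrix.isUnit_iff_isUnit_det _).1 P.isUnit).exists_right_inv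
  set t := P.val.trace with ht
  set D := P.val.det with hD
  have htr : P.val 0 0 + P.val 1 1 = t := (Matrix.trace_fin_two _).symm
  have hdet : P.val 0 0 * P.val 1 1 - P.val 0 1 * P.val 1 0 = D := (Matrix.det_fin_two _).symm
  -- The eigenvalues are to be `s` and `c s`, so the trace forces `s = t / (1 + c)`. The hypothesis
  -- on `P` then gives `D = c s²`.
  obtain ⟨s, hs⟩ : ∃ s, s = t * e := ⟨_, rfl⟩
  have hst : (1 + c) * s = t := by rw [hs]; linear_combination t * he
  have hDs : D = c * s ^ 2 := by
    have : (e * (1 + c)) ^ 2 * D = c * (t * e) ^ 2 := by linear_combination e ^ 2 * hP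
    rw [hs, ← this, mul_comm e, he]; ring
  obtain ⟨v, hv⟩ : ∃ v, s * v = 1 := ⟨c * s * δ, by rw [← hδ, hDs]; ring⟩
  have CH : P.val * P.val = t • P.val - D • (1 : Matrix (Fin 2) (Fin 2) R) := by
    ext i j
    fin_cases i <;> fin_cases j <;>
      simp [Matrix.mul_apply, Fin.sum_univ_two] <;> rw [← htr] <;> try rw [← hdet]
    all_goals ring
  -- Lagrange interpolation: the projections are `(P - c s) / (s - c s)` and `(s - P) / (s - c s)`,
  -- and `v d` is the inverse of `s (1 - c)`.
  let p : SpectralPair R :=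
    { fst := (v * d) • (P.val - (c * s) • (1 : Matrix (Fin 2) (Fin 2) R))
      snd := (v * d) • (s • (1 : Matrix (Fin 2) (Fin 2) R) - P.val)
      add_eq := by
        rw [← smul_add, sub_add_sub_comm, add_comm P.val, add_sub_add_right_eq_sub, ← sub_smul,
          smul_smul]
        have : v * d * (s - c * s) = 1 := by
          linear_combination d * (1 - c) * hv + hd
        rw [this, one_smul]
      fst_snd := by
        rw [Matrix.smul_mul, Matrix.mul_smul]
        have : (P.val - (c * s) • (1 : Matrix (Fin 2) (Fin 2) R)) *
            (s • (1 : Matrix (Fin 2) (Fin 2) R) - P.val) = 0 := by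
          rw [sub_mul, mul_sub, mul_sub, CH, ← hst, hDs]
          ext i j
          simp
          ring
        rw [this, smul_zero, smul_zero]
      snd_fst := by
        rw [Matrix.smul_mul, Matrix.mul_smul]
        have : (s • (1 : Matrix (Fin 2) (Fin 2) R) - P.val) *
            (P.val - (c * s) • (1 : Matrix (Fin 2) (Fin 2) R)) = 0 := by
          rw [sub_mul, mul_sub, mul_sub, CH, ← hst, hDs]
          ext i j
          simp
          ring
        rw [this, smul_zero, smul_zero]
      det_fst := by
        rw [Matrix.det_smul, Matrix.det_fin_two]
        simp only [Matrix.sub_apply, Matrix.smul_apply, Matrix.one_apply, smul_eq_mul]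
        simp
        have : (P.val 0 0 - c * s) * (P.val 1 1 - c * s) - P.val 0 1 * P.val 1 0 = 0 := by
          linear_combination hdet + hDs - c * s * htr - c * s * (- hst)
        rw [this, mul_zero]
      det_snd := by
        rw [Matrix.det_smul, Matrix.det_fin_two]
        simp only [Matrix.sub_apply, Matrix.smul_apply, Matrix.one_apply, smul_eq_mul]
        simp
        have : (s - P.val 0 0) * (s - P.val 1 1) - P.val 0 1 * P.val 1 0 = 0 := by
          linear_combination hdet + hDs - s * htr - s * (- hst)
        rw [this, mul_zero]
      trace_fst := by
        rw [Matrix.trace_smul, Matrix.trace_sub, Matrix.trace_smul, Matrix.trace_one,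
          Fintype.card_fin, ← ht, ← hst, smul_eq_mul, smul_eq_mul]
        push_cast
        linear_combination d * (1 - c) * hv + hd }
  refine ⟨p, s, v, hc, hv, ?_⟩
  have e1 : P.val = s • p.fst + (c * s) • p.snd := by
    simp only [p, smul_smul, smul_sub]
    ext i j
    simp
    linear_combination - P.val i j * (d * (1 - c) * hv + hd)
  have e2 : P⁻¹.val = v • p.fst + (ci * v) • p.snd := by
    have : P.val * (v • p.fst + (ci * v) • p.snd) = 1 := by
      rw [e1, add_mul, mul_add, mul_add]
      simp only [Matrix.smul_mul, Matrix.mul_smul, p.fst_fst, p.fst_snd, p.snd_fst, p.snd_snd,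
        smul_zero, add_zero, zero_add, smul_smul]
      rw [← p.add_eq]
      have h3 : v * s = 1 := by rw [mul_comm, hv]
      have h4 : ci * v * (c * s) = 1 := by linear_combination c * ci * hv + hc
      simp only [h3, h4, one_smul]
    have h5 : P⁻¹.val * P.val = 1 := by rw [← Units.val_mul, inv_mul_cancel]; rfl
    rw [← mul_one P⁻¹.val, ← this, ← mul_assoc, h5, one_mul]
  exact ⟨e1, e2⟩

end SpectralPair

end RankOne

/-! ### Functions on `X` modulo `f` -/

section Spectral

open Matrix

variable {C : Type u} [Field C] {q : ℕ} {R : Type*} [CommRing R] [Algebra C R]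

/-- Spectral pairs adapted to an invertible matrix over a `C`-algebra, with eigenvalues of
ratio `q`. -/
def IsSpectral (q : ℕ) (p : SpectralPair R) (P : GL (Fin 2) R) : Prop :=
  p.IsAdapted P (algebraMap C R q) (algebraMap C R (q : C)⁻¹)

theorem isUnit_algebraMap_of_ne_zero {x : C} (hx : x ≠ 0) : IsUnit (algebraMap C R x) :=
  (IsUnit.mk0 x hx).map _

variable [CharZero C]

theorem isUnit_one_sub_inv (hq : 2 ≤ q) :
    IsUnit ((1 : R) - algebraMap C R (q : C)⁻¹) := by
  rw [← map_one (algebraMap C R), ← map_sub]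
  refine isUnit_algebraMap_of_ne_zero (sub_ne_zero.2 fun h => ?_)
  exact inv_natCast_ne_pow (C := C) hq 0 (by rw [pow_zero, h])

theorem isUnit_sub_inv (hq : 2 ≤ q) :
    IsUnit (algebraMap C R q - algebraMap C R (q : C)⁻¹) := by
  rw [← map_sub]
  refine isUnit_algebraMap_of_ne_zero (sub_ne_zero.2 fun h => ?_)
  exact inv_natCast_ne_pow (C := C) hq 1 (by rw [pow_one, ← h])

theorem exists_isSpectral (hq : 2 ≤ q) (P : GL (Fin 2) R)
    (hP : (1 + (q : R)) ^ 2 * P.val.det = (q : R) * P.val.trace ^ 2) :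
    ∃ p : SpectralPair R, IsSpectral (C := C) q p P := by
  refine SpectralPair.exists_isAdapted P _ _ ?_ ?_ ?_ ?_
  · rw [← map_mul, mul_inv_cancel₀ (natCast_ne_zero_of_two_le hq), map_one]
  · rw [← map_one (algebraMap C R), ← map_add]
    exact isUnit_algebraMap_of_ne_zero (by exact_mod_cast (by omega : 1 + q ≠ 0))
  · rw [← map_one (algebraMap C R), ← map_sub]
    refine isUnit_algebraMap_of_ne_zero (sub_ne_zero.2 fun h => ?_)
    exact one_ne_natCast_pow (C := C) hq 1 le_rfl (by rw [pow_one, ← h])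
  · rw [map_natCast]; exact hP

end Spectral

/-! ### The locus `f = 0` as a line bundle -/

section Quotient

open Matrix Polynomial

variable (C : Type u) [Field C] (q : ℕ)

/-- The ring of functions on the locus `f = 0` in `GL₂`. -/
abbrev CoordGLmod : Type u := CoordGL C ⧸ Ideal.span {(invariantF C q : CoordGL C)}

/-- The ring of functions on the locus `f = 0` in `X`. -/
abbrev CoordXmod : Type u :=
  CoordX C q ⧸ Ideal.span {CoordX.proj C q (invariantF C q : CoordGL C)}

/-- Reduction modulo `f` on `GL₂`. -/
noncomputable abbrev mkGL : CoordGL C →ₐ[C] CoordGLmod C q := Ideal.Quotient.mkₐ C _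

/-- Reduction modulo `f` on `X`. -/
noncomputable abbrev mkX : CoordX C q →ₐ[C] CoordXmod C q := Ideal.Quotient.mkₐ C _

/-- The projection `(φ, N) ↦ φ` on the loci `f = 0`. -/
noncomputable def projMod : CoordGLmod C q →ₐ[C] CoordXmod C q :=
  Ideal.Quotient.liftₐ _ ((mkX C q).comp (CoordX.proj C q)) (by
    intro a ha
    obtain ⟨b, rfl⟩ := Ideal.mem_span_singleton'.1 ha
    rw [AlgHom.comp_apply, map_mul]
    exact Ideal.Quotient.eq_zero_iff_mem.2 (Ideal.mem_span_singleton'.2 ⟨_, rfl⟩))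

variable {C q}

theorem mkGL_invariantF : mkGL C q (invariantF C q : CoordGL C) = 0 :=
  Ideal.Quotient.eq_zero_iff_mem.2 (Ideal.mem_span_singleton_self _)

theorem mkX_proj_invariantF : mkX C q (CoordX.proj C q (invariantF C q : CoordGL C)) = 0 :=
  Ideal.Quotient.eq_zero_iff_mem.2 (Ideal.mem_span_singleton_self _)

theorem det_mapGL {R S : Type*} [CommRing R] [CommRing S] [Algebra C R] [Algebra C S]
    (f : R →ₐ[C] S) (g : GL (Fin 2) R) : (mapGL f g).val.det = f g.val.det :=
  (AlgHom.map_det f g.val).symm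

theorem trace_mapGL {R S : Type*} [CommRing R] [CommRing S] [Algebra C R] [Algebra C S]
    (f : R →ₐ[C] S) (g : GL (Fin 2) R) : (mapGL f g).val.trace = f g.val.trace := by
  rw [Matrix.trace_fin_two, Matrix.trace_fin_two, map_add]
  rfl

theorem spectral_relation : (1 + (q : CoordGLmod C q)) ^ 2 *
    (mapGL (mkGL C q) (CoordGL.univ C)).val.det =
      (q : CoordGLmod C q) * (mapGL (mkGL C q) (CoordGL.univ C)).val.trace ^ 2 := by
  have h : mkGL C q ((1 + (q : CoordGL C)) ^ 2 * (CoordGL.univ C).val.det -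
      (q : CoordGL C) * (CoordGL.univ C).val.trace ^ 2) = 0 := mkGL_invariantF
  rw [map_sub, sub_eq_zero, map_mul, map_mul, map_pow, map_pow, map_add, map_one,
    map_natCast] at h
  rw [det_mapGL, trace_mapGL]
  exact h

theorem IsSpectral.map {R S : Type*} [CommRing R] [CommRing S] [Algebra C R] [Algebra C S]
    {p : SpectralPair R} {P : GL (Fin 2) R} (h : IsSpectral (C := C) q p P) (f : R →ₐ[C] S) :
    IsSpectral (C := C) q (p.map f.toRingHom) (mapGL f P) := by
  have := SpectralPair.IsAdapted.map h f.toRingHom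
  rw [AlgHom.toRingHom_eq_coe, RingHom.coe_coe, AlgHom.commutes, AlgHom.commutes] at this
  exact this

theorem algebraMap_smul_matrix {R : Type*} [CommRing R] [Algebra C R] (c : C)
    (Y : Matrix (Fin 2) (Fin 2) R) : algebraMap C R c • Y = c • Y := by
  ext i j
  simp [Algebra.smul_def]

variable {p : SpectralPair (CoordGLmod C q)}

/-- The family of points of `X` with `N` a multiple of a matrix in the corner. -/
noncomputable def cornerPoint
    (hp : IsSpectral (C := C) q p (mapGL (mkGL C q) (CoordGL.univ C)))
    (Y : Matrix (Fin 2) (Fin 2) (CoordGLmod C q)) : CoordX C q →ₐ[C] (CoordGLmod C q)[X] :=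
  CoordX.lift (mapGL (IsScalarTower.toAlgHom C (CoordGLmod C q) (CoordGLmod C q)[X])
      (mapGL (mkGL C q) (CoordGL.univ C)))
    ((X : (CoordGLmod C q)[X]) • (p.corner Y).map (IsScalarTower.toAlgHom C (CoordGLmod C q)
      (CoordGLmod C q)[X])) (by
    have h1 := SpectralPair.IsAdapted.conj_corner hp Y
    rw [algebraMap_smul_matrix] at h1
    rw [Matrix.mul_smul, Matrix.smul_mul, CoordX.map_point h1, smul_comm])

theorem cornerPoint_proj
    (hp : IsSpectral (C := C) q p (mapGL (mkGL C q) (CoordGL.univ C)))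
    (Y : Matrix (Fin 2) (Fin 2) (CoordGLmod C q))
    (h : CoordGL C) :
    cornerPoint hp Y (CoordX.proj C q h) = Polynomial.C (mkGL C q h) := by
  have h1 : (cornerPoint hp Y).comp (CoordX.proj C q) =
      (IsScalarTower.toAlgHom C (CoordGLmod C q) (CoordGLmod C q)[X]).comp (mkGL C q) := by
    rw [cornerPoint, CoordX.lift_proj]
    exact CoordGL.hom_ext (CoordGL.mapGL_lift _)
  exact AlgHom.congr_fun h1 h

theorem cornerPoint_N
    (hp : IsSpectral (C := C) q p (mapGL (mkGL C q) (CoordGL.univ C)))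
    (Y : Matrix (Fin 2) (Fin 2) (CoordGLmod C q))
    (i j : Fin 2) :
    cornerPoint hp Y (CoordX.N C q i j) = X * Polynomial.C (p.corner Y i j) := by
  have h1 : (CoordX.N C q).map (cornerPoint hp Y) = (X : (CoordGLmod C q)[X]) •
      (p.corner Y).map (IsScalarTower.toAlgHom C (CoordGLmod C q) (CoordGLmod C q)[X]) :=
    CoordX.map_lift_N _ _ _
  exact congrFun (congrFun h1 i) j

/-- Over `f = 0` the matrix `N` is an eigenmatrix of `Ad(φ)` with eigenvalue `q⁻¹`, and `q⁻¹` occurs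
only on the corner since `1 - q⁻¹` and `q - q⁻¹` are units. -/
theorem corner_N [CharZero C]
    (hp : IsSpectral (C := C) q p (mapGL (mkGL C q) (CoordGL.univ C)))
    (hq : 2 ≤ q) :
    (p.map (projMod C q).toRingHom).corner ((CoordX.N C q).map (mkX C q)) =
      (CoordX.N C q).map (mkX C q) := by
  have h1 := hp.map (projMod C q)
  have h2 : mapGL (projMod C q) (mapGL (mkGL C q) (CoordGL.univ C)) =
      mapGL (mkX C q) (CoordX.φ C q) := rfl
  rw [h2] at h1
  refine SpectralPair.IsAdapted.corner_eq h1 (isUnit_one_sub_inv hq) (isUnit_sub_inv hq) ?_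
  rw [algebraMap_smul_matrix]
  exact CoordX.map_point (CoordX.φ_N C q) (mkX C q)

/-- Both matrices lie in the same rank one corner, so they are proportional in the sense of
vanishing minors. Where `p.corner Y i j` is invertible, `N` is thus determined by its entry `N_ij`.
-/
theorem N_mul_corner [CharZero C]
    (hp : IsSpectral (C := C) q p (mapGL (mkGL C q) (CoordGL.univ C)))
    (Y : Matrix (Fin 2) (Fin 2) (CoordGLmod C q))
    (hq : 2 ≤ q) (i j k l : Fin 2) :
    mkX C q (CoordX.N C q i j) * projMod C q (p.corner Y k l) =
      mkX C q (CoordX.N C q k l) * projMod C q (p.corner Y i j) := by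
  have h1 := (p.map (projMod C q).toRingHom).corner_mul_corner ((CoordX.N C q).map (mkX C q))
    (Y.map (projMod C q).toRingHom) i j k l
  rw [corner_N hp hq, SpectralPair.corner_map] at h1
  exact h1

/-- Let `c` be the `(i, j)` entry of the corner of `Y`. Up to powers of `c`, every function is a
polynomial `s` in `N_ij` with coefficients depending on `φ`. The second equation evaluates the same
`s` on the explicit family `cornerPoint`, where `N_ij` becomes `c X`; there coefficients can be
compared. -/
theorem exists_pow_mul_eq [CharZero C]
    (hp : IsSpectral (C := C) q p (mapGL (mkGL C q) (CoordGL.univ C)))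
    (Y : Matrix (Fin 2) (Fin 2) (CoordGLmod C q))
    (hq : 2 ≤ q) (i j : Fin 2) (a : CoordX C q) :
    ∃ (n : ℕ) (s : (CoordGLmod C q)[X]),
      projMod C q (p.corner Y i j) ^ n * mkX C q a =
        s.eval₂ (projMod C q).toRingHom (mkX C q (CoordX.N C q i j)) ∧
      Polynomial.C (p.corner Y i j) ^ n * cornerPoint hp Y a =
        s.comp (Polynomial.C (p.corner Y i j) * X) := by
  induction a using CoordX.induction_on with
  | hproj h =>
    refine ⟨0, Polynomial.C (mkGL C q h), ?_, ?_⟩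
    · rw [pow_zero, one_mul, eval₂_C]; rfl
    · rw [pow_zero, one_mul, cornerPoint_proj, C_comp]
  | hadd a b ha hb =>
    obtain ⟨n, s, h1, h2⟩ := ha
    obtain ⟨m, t, h3, h4⟩ := hb
    refine ⟨n + m, Polynomial.C (p.corner Y i j) ^ m * s +
      Polynomial.C (p.corner Y i j) ^ n * t, ?_, ?_⟩
    · rw [eval₂_add, eval₂_mul, eval₂_mul, ← h1, ← h3, eval₂_pow, eval₂_pow, eval₂_C, map_add]
      simp only [AlgHom.toRingHom_eq_coe, RingHom.coe_coe]
      ring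
    · rw [add_comp, mul_comp, mul_comp, ← h2, ← h4, pow_comp, pow_comp, C_comp, map_add]
      ring
  | hmul a k l ha =>
    obtain ⟨n, s, h1, h2⟩ := ha
    refine ⟨n + 1, s * X * Polynomial.C (p.corner Y k l), ?_, ?_⟩
    · rw [eval₂_mul, eval₂_mul, ← h1, eval₂_X, eval₂_C, map_mul]
      have := N_mul_corner hp Y hq i j k l
      simp only [AlgHom.toRingHom_eq_coe, RingHom.coe_coe]
      linear_combination (-(projMod C q (p.corner Y i j)) ^ n * mkX C q a) * this
    · rw [mul_comp, mul_comp, ← h2, X_comp, C_comp, map_mul, cornerPoint_N]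
      ring

/-- On the explicit family `N_ij` becomes `c X`, and `X` can be cancelled. So `s(c X) c = 0`, which
kills each coefficient of `s` by a power of `c`, and hence `a` itself by a power of `c`. -/
theorem exists_pow_mul_eq_zero [CharZero C]
    (hp : IsSpectral (C := C) q p (mapGL (mkGL C q) (CoordGL.univ C)))
    (Y : Matrix (Fin 2) (Fin 2) (CoordGLmod C q))
    (hq : 2 ≤ q) (i j : Fin 2) (a : CoordX C q)
    (ha : mkX C q (a * CoordX.N C q i j) = 0) :
    ∃ n, projMod C q (p.corner Y i j) ^ n * mkX C q a = 0 := by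
  obtain ⟨n, s, h1, h2⟩ := exists_pow_mul_eq hp Y hq i j a
  have h3 : cornerPoint hp Y a * (X * Polynomial.C (p.corner Y i j)) = 0 := by
    rw [← cornerPoint_N hp, ← map_mul]
    obtain ⟨b, hb⟩ := Ideal.mem_span_singleton'.1 (Ideal.Quotient.eq_zero_iff_mem.1 ha)
    rw [← hb, map_mul, cornerPoint_proj, mkGL_invariantF, map_zero, mul_zero]
  have h4 : cornerPoint hp Y a * Polynomial.C (p.corner Y i j) = 0 := by
    have : (cornerPoint hp Y a * Polynomial.C (p.corner Y i j)) * X = 0 := by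
      rw [← h3]; ring
    ext m
    rw [← coeff_mul_X, this]
    simp
  have h5 : s.comp (Polynomial.C (p.corner Y i j) * X) * Polynomial.C (p.corner Y i j) = 0 := by
    rw [← h2, mul_assoc, h4, mul_zero]
  -- The coefficient in degree `m` of `s(c X) c` is `c ^ (m + 1)` times that of `s`, so the exponent
  -- `natDegree + 1` works for all coefficients.
  have h6 : Polynomial.C (p.corner Y i j ^ (s.natDegree + 1)) * s = 0 := by
    ext m
    rw [coeff_C_mul, coeff_zero]
    by_cases hm : m ≤ s.natDegree
    · obtain ⟨k, hk⟩ := Nat.exists_eq_add_of_le hm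
      have h7 := congrArg (fun t => Polynomial.coeff t m) h5
      simp only [coeff_mul_C, comp_C_mul_X_coeff, coeff_zero] at h7
      rw [hk]
      linear_combination p.corner Y i j ^ k * h7
    · rw [coeff_eq_zero_of_natDegree_lt (by omega), mul_zero]
  refine ⟨s.natDegree + 1 + n, ?_⟩
  have h8 := congrArg (fun t => eval₂ (projMod C q).toRingHom (mkX C q (CoordX.N C q i j)) t) h6
  simp only [eval₂_mul, eval₂_C, eval₂_zero] at h8
  rw [pow_add, mul_assoc, h1, ← h8, ← map_pow]
  rfl

/-- Modulo `f`, functions that kill `N` vanish. -/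
theorem mkX_eq_zero_of_mul_N [CharZero C] (hq : 2 ≤ q) (a : CoordX C q)
    (ha : ∀ i j, mkX C q (a * CoordX.N C q i j) = 0) : mkX C q a = 0 := by
  obtain ⟨p, hp⟩ := exists_isSpectral (C := C) hq (mapGL (mkGL C q) (CoordGL.univ C))
    spectral_relation
  let c : Fin 2 × Fin 2 → CoordXmod C q := fun x => projMod C q (p.fst x.1 x.1 * p.snd x.2 x.2)
  have h1 : ∀ x, ∃ n, c x ^ n * mkX C q a = 0 := by
    intro x
    have := exists_pow_mul_eq_zero hp (Matrix.single x.1 x.2 1) hq x.1 x.2 a (ha x.1 x.2)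
    rw [SpectralPair.corner_single] at this
    exact this
  choose n hn using h1
  -- The functions `c x` sum to one, hence so do combinations of their high powers, and an element
  -- killed by all these powers is zero.
  have h2 : Ideal.span (Set.range c) = ⊤ := by
    rw [Ideal.eq_top_iff_one]
    have h3 : ∑ x, c x = 1 := by
      rw [← map_sum, Fintype.sum_prod_type, p.sum_corner_single, map_one]
    rw [← h3]
    exact sum_mem fun x _ => Ideal.subset_span ⟨x, rfl⟩
  have h3 := Ideal.span_pow_eq_top _ h2 (∑ x, n x)
  have h4 : Ideal.span ((fun t => t ^ ∑ x, n x) '' Set.range c) ≤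
      Ideal.torsionOf (CoordXmod C q) (CoordXmod C q) (mkX C q a) := by
    refine Ideal.span_le.2 ?_
    rintro _ ⟨_, ⟨x, rfl⟩, rfl⟩
    refine (Ideal.mem_torsionOf_iff _ _).2 ?_
    obtain ⟨k, hk⟩ := Nat.exists_eq_add_of_le' (Finset.single_le_sum
      (fun y _ => Nat.zero_le (n y)) (Finset.mem_univ x))
    change c x ^ (∑ y, n y) * mkX C q a = 0
    rw [hk, pow_add, mul_assoc, hn, mul_zero]
  have h5 : (1 : CoordXmod C q) ∈ Ideal.torsionOf (CoordXmod C q) (CoordXmod C q) (mkX C q a) :=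
    h4 (h3 ▸ Submodule.mem_top)
  rw [Ideal.mem_torsionOf_iff, one_smul] at h5
  exact h5

end Quotient

/-! ### The adjoint representation -/

section TensorMatrix

open Matrix

variable {C : Type*} [Field C] (M : Type*) [AddCommGroup M] [Module C M]

/-- The identification of `M ⊗ 𝔤𝔩₂` with matrices with entries in `M`. -/
noncomputable def tensorMatrix :
    M ⊗[C] Matrix (Fin 2) (Fin 2) C ≃ₗ[C] Matrix (Fin 2) (Fin 2) M :=
  LinearEquiv.ofLinearMap
    (TensorProduct.lift (LinearMap.mk₂ C (fun m Y => Matrix.of fun i j => Y i j • m)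
      (fun m m' Y => by ext; simp) (fun c m Y => by ext; simp [smul_comm c])
      (fun m Y Y' => by ext; simp [add_smul]) (fun c m Y => by ext; simp [mul_smul])))
    { toFun := fun Z => ∑ i, ∑ j, Z i j ⊗ₜ Matrix.single i j (1 : C)
      map_add' := fun Z Z' => by simp [TensorProduct.add_tmul, Finset.sum_add_distrib]
      map_smul' := fun c Z => by simp [TensorProduct.smul_tmul'] }
    (by
      ext Z i j
      fin_cases i <;> fin_cases j <;> simp [Matrix.single_apply])
    (by
      refine TensorProduct.ext' fun m Y => ?_
      conv_rhs => rw [LinearMap.id_apply, Matrix.matrix_eq_sum_single Y]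
      simp only [TensorProduct.tmul_sum]
      simp [TensorProduct.smul_tmul, Matrix.smul_single])

theorem tensorMatrix_tmul (m : M) (Y : Matrix (Fin 2) (Fin 2) C) :
    tensorMatrix M (m ⊗ₜ[C] Y) = Matrix.of fun i j => Y i j • m := rfl

theorem tensorMatrix_symm_apply (Z : Matrix (Fin 2) (Fin 2) M) :
    (tensorMatrix (C := C) M).symm Z = ∑ i, ∑ j, Z i j ⊗ₜ Matrix.single i j (1 : C) := rfl

variable {M}

theorem tensorMatrix_rTensor {N : Type*} [AddCommGroup N] [Module C N] (f : M →ₗ[C] N)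
    (t : M ⊗[C] Matrix (Fin 2) (Fin 2) C) :
    tensorMatrix N (f.rTensor _ t) = (tensorMatrix M t).map f := by
  induction t with
  | zero => ext; simp
  | add x y hx hy => rw [map_add, map_add, map_add, hx, hy, Matrix.map_add f (map_add f)]
  | tmul m Y => ext; simp [tensorMatrix_tmul]

theorem tensorMatrix_smul {A : Type*} [CommRing A] [Algebra C A] [Module A M]
    [IsScalarTower C A M] (a : A) (t : M ⊗[C] Matrix (Fin 2) (Fin 2) C) :
    tensorMatrix M (a • t) = a • tensorMatrix M t := by
  induction t with
  | zero => simp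
  | add x y hx hy => rw [smul_add, map_add, map_add, hx, hy, smul_add]
  | tmul m Y =>
    ext i j
    simp [TensorProduct.smul_tmul', tensorMatrix_tmul, smul_comm a]

variable (M) in
/-- The identification of `𝔤𝔩₂ ⊗ L` with matrices with entries in `L`. -/
noncomputable def matrixTensor :
    Matrix (Fin 2) (Fin 2) C ⊗[C] M ≃ₗ[C] Matrix (Fin 2) (Fin 2) M :=
  (TensorProduct.comm C _ _).trans (tensorMatrix M)

theorem matrixTensor_tmul (m : M) (Y : Matrix (Fin 2) (Fin 2) C) :
    matrixTensor M (Y ⊗ₜ[C] m) = Matrix.of fun i j => Y i j • m := rfl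

theorem matrixTensor_lTensor {N : Type*} [AddCommGroup N] [Module C N] (f : M →ₗ[C] N)
    (t : Matrix (Fin 2) (Fin 2) C ⊗[C] M) :
    matrixTensor N (f.lTensor _ t) = (matrixTensor M t).map f := by
  induction t with
  | zero => ext; simp
  | add x y hx hy => rw [map_add, map_add, map_add, hx, hy, Matrix.map_add f (map_add f)]
  | tmul Y m => ext; simp [matrixTensor_tmul]

theorem matrixTensor_assoc {N : Type*} [AddCommGroup N] [Module C N]
    (s : Matrix (Fin 2) (Fin 2) C ⊗[C] M) (n : N) :
    matrixTensor (M ⊗[C] N) (TensorProduct.assoc C _ M N (s ⊗ₜ n)) =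
      (matrixTensor M s).map fun m => m ⊗ₜ n := by
  induction s with
  | zero => ext; simp
  | add x y hx hy =>
    rw [TensorProduct.add_tmul, map_add, map_add, map_add, hx, hy]
    ext; simp [TensorProduct.add_tmul]
  | tmul Y m => ext; simp [matrixTensor_tmul, TensorProduct.smul_tmul']

theorem rid_eq_matrixTensor (t : Matrix (Fin 2) (Fin 2) C ⊗[C] C) :
    TensorProduct.rid C _ t = matrixTensor C t := by
  induction t with
  | zero => simp
  | add x y hx hy => rw [map_add, map_add, hx, hy]
  | tmul Y c => ext; simp [matrixTensor_tmul, mul_comm]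

end TensorMatrix

section Adjoint

open Matrix

variable (C : Type u) [Field C]

/-- The coaction of the adjoint representation, `Y ↦ g Y g⁻¹`. -/
noncomputable def adjointCoact :
    Matrix (Fin 2) (Fin 2) C →ₗ[C] Matrix (Fin 2) (Fin 2) C ⊗[C] CoordGL C :=
  (matrixTensor (C := C) (CoordGL C)).symm.toLinearMap ∘ₗ
    { toFun := fun Y => (CoordGL.univ C).val * Y.map (algebraMap C (CoordGL C)) *
        (CoordGL.univ C)⁻¹.val
      map_add' := fun Y Z => by
        rw [Matrix.map_add _ (map_add _), mul_add, add_mul]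
      map_smul' := fun c Y => by
        have : (c • Y).map (algebraMap C (CoordGL C)) = c • Y.map (algebraMap C (CoordGL C)) := by
          ext i j
          rw [Matrix.map_apply, Matrix.smul_apply, Matrix.smul_apply, Matrix.map_apply,
            smul_eq_mul, map_mul, Algebra.smul_def]
        rw [this, Matrix.mul_smul, Matrix.smul_mul, RingHom.id_apply] }

variable {C}

theorem matrixTensor_adjointCoact (Y : Matrix (Fin 2) (Fin 2) C) :
    matrixTensor (CoordGL C) (adjointCoact C Y) =
      (CoordGL.univ C).val * Y.map (algebraMap C (CoordGL C)) * (CoordGL.univ C)⁻¹.val :=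
  LinearEquiv.apply_symm_apply _ _

theorem map_conj {R S : Type*} [CommRing R] [CommRing S] [Algebra C R] [Algebra C S]
    (f : R →ₐ[C] S) (g : GL (Fin 2) R) (Y : Matrix (Fin 2) (Fin 2) R) :
    (g.val * Y * g⁻¹.val).map f = (mapGL f g).val * Y.map f * (mapGL f g)⁻¹.val := by
  rw [Matrix.map_mul, Matrix.map_mul, mapGL_inv_val, mapGL_val]

theorem map_algebraMap_map {R S : Type*} [CommRing R] [CommRing S] [Algebra C R] [Algebra C S]
    (f : R →ₐ[C] S) (Y : Matrix (Fin 2) (Fin 2) C) :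
    (Y.map (algebraMap C R)).map f = Y.map (algebraMap C S) := by
  ext; simp

theorem matrixTensor_adjointCoact_rTensor
    (t : Matrix (Fin 2) (Fin 2) C ⊗[C] CoordGL C) :
    matrixTensor (CoordGL C ⊗[C] CoordGL C) (TensorProduct.assoc C _ _ _
      ((adjointCoact C).rTensor (CoordGL C) t)) =
      (mapGL (inL C (CoordGL C) (CoordGL C)) (CoordGL.univ C)).val *
        (matrixTensor (CoordGL C) t).map (inR C (CoordGL C) (CoordGL C)) *
        (mapGL (inL C (CoordGL C) (CoordGL C)) (CoordGL.univ C))⁻¹.val := by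
  induction t with
  | zero => ext; simp
  | add x y hx hy =>
    rw [map_add, map_add, map_add, hx, hy, map_add, Matrix.map_add _ (map_add _), mul_add, add_mul]
  | tmul Y h =>
    have h1 : (matrixTensor (CoordGL C) (Y ⊗ₜ[C] h)).map (inR C (CoordGL C) (CoordGL C)) =
        ((1 : CoordGL C) ⊗ₜ[C] h) • Y.map (algebraMap C (CoordGL C ⊗[C] CoordGL C)) := by
      ext; simp [matrixTensor_tmul, Algebra.algebraMap_eq_smul_one,
        Algebra.TensorProduct.one_def, TensorProduct.smul_tmul']
    rw [LinearMap.rTensor_tmul, matrixTensor_assoc, matrixTensor_adjointCoact, h1,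
      Matrix.mul_smul, Matrix.smul_mul, ← map_algebraMap_map (inL C (CoordGL C) (CoordGL C)),
      ← map_conj]
    ext i j
    rw [Matrix.map_apply, Matrix.smul_apply, Matrix.map_apply, smul_eq_mul,
      Algebra.TensorProduct.includeLeft_apply, Algebra.TensorProduct.tmul_mul_tmul, one_mul,
      mul_one]

variable (C) in
/-- The adjoint representation. -/
noncomputable def adjointRep : RightComodule C (CoordGL C) where
  carrier := Matrix (Fin 2) (Fin 2) C
  coact := adjointCoact C
  coassoc Y := by
    apply (matrixTensor (C := C) (CoordGL C ⊗[C] CoordGL C)).injective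
    have h1 := matrixTensor_lTensor (Bialgebra.comulAlgHom C (CoordGL C)).toLinearMap
      (adjointCoact C Y)
    refine (matrixTensor_adjointCoact_rTensor _).trans (Eq.trans ?_ h1.symm)
    rw [matrixTensor_adjointCoact, map_conj, map_algebraMap_map]
    refine Eq.trans ?_ (map_conj (Bialgebra.comulAlgHom C (CoordGL C)) _ _).symm
    rw [map_algebraMap_map, CoordGL.comulAlgHom_eq, CoordGL.mapGL_lift, _root_.mul_inv_rev]
    simp only [Units.val_mul, mul_assoc]
  counit Y := by
    rw [rid_eq_matrixTensor]
    have h1 := matrixTensor_lTensor (Bialgebra.counitAlgHom C (CoordGL C)).toLinearMap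
      (adjointCoact C Y)
    refine h1.trans ?_
    rw [matrixTensor_adjointCoact]
    refine (map_conj (Bialgebra.counitAlgHom C (CoordGL C)) _ _).trans ?_
    rw [map_algebraMap_map, CoordGL.counitAlgHom_eq, CoordGL.mapGL_lift]
    ext i j
    simp

end Adjoint

/-! ### Exactness of twisting by a representation -/

section TwistFunctor

open EquivariantModule

variable {k H A : Type u} [Field k] [CommRing H] [Bialgebra k H] [CommRing A] [Algebra k A]
  {act : A →ₐ[k] A ⊗[k] H}

/-- Twisting by a representation as a functor. -/
noncomputable def twistFunctor (V : RightComodule k H) :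
    EquivariantModule act ⥤ EquivariantModule act where
  obj M := twist M V
  map f := twistMap f V
  map_id _ := twist_hom_ext fun _ _ => rfl
  map_comp _ _ := twist_hom_ext fun _ _ => rfl

instance (V : RightComodule k H) :
    (twistFunctor (act := act) V).PreservesZeroMorphisms where
  map_zero _ _ := twist_hom_ext fun _ v => TensorProduct.zero_tmul _ v

theorem exists_of_shortExact {S : ShortComplex (EquivariantModule act)} (hS : S.ShortExact)
    (x : S.X₂.carrier) (hx : S.g.toLin x = 0) : ∃ y, S.f.toLin y = x := by
  have := hS.mono_f
  obtain ⟨l, hl⟩ := KernelFork.IsLimit.lift' hS.exact.fIsKernel (kerι S.g) (kerι_comp S.g)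
  exact ⟨l.toLin (⟨x, hx⟩ : LinearMap.ker S.g.toLin),
    congrArg (fun t => Hom.toLin t (⟨x, hx⟩ : LinearMap.ker S.g.toLin)) hl⟩

theorem shortExact_of_elements {S : ShortComplex (EquivariantModule act)}
    (hf : Function.Injective S.f.toLin) (hg : Function.Surjective S.g.toLin)
    (h : ∀ x, S.g.toLin x = 0 → ∃ y, S.f.toLin y = x) : S.ShortExact where
  exact := ShortComplex.exact_of_g_is_cokernel S (isCokernel S.f S.g S.zero hg h)
  mono_f := mono_of_injective _ hf
  epi_g := epi_of_surjective _ hg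

theorem shortExact_map_twistFunctor (V : RightComodule k H)
    (S : ShortComplex (EquivariantModule act)) (hS : S.ShortExact) :
    (S.map (twistFunctor V)).ShortExact := by
  have h1 := hS.mono_f
  have h2 := hS.epi_g
  refine shortExact_of_elements ?_ ?_ ?_
  · exact Module.Flat.rTensor_preserves_injective_linearMap (M := V.carrier)
      (S.f.toLin.restrictScalars k) (injective_of_mono S.f)
  · exact LinearMap.rTensor_surjective V.carrier (g := S.g.toLin.restrictScalars k)
      (surjective_of_epi S.g)
  · have hex : Function.Exact (S.f.toLin.restrictScalars k) (S.g.toLin.restrictScalars k) := by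
      intro x
      refine ⟨exists_of_shortExact hS x, ?_⟩
      rintro ⟨y, rfl⟩
      exact congrArg (fun t => Hom.toLin t y) S.zero
    exact fun x hx => (Module.Flat.rTensor_exact V.carrier hex x).1 hx

end TwistFunctor

/-! ### The natural transformation given by `N` -/

section Nu

open EquivariantModule Matrix

variable {C : Type u} [Field C] {q : ℕ}

/-- The identification of `(A ⊗ 𝔤𝔩₂) ⊗ L` with matrices over `A ⊗ L`. -/
noncomputable def tensorMatrixTensor (A L : Type u) [CommRing A] [Algebra C A] [CommRing L]
    [Algebra C L] : (A ⊗[C] Matrix (Fin 2) (Fin 2) C) ⊗[C] L ≃ₗ[C]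
      Matrix (Fin 2) (Fin 2) (A ⊗[C] L) :=
  (TensorProduct.rightComm C A (Matrix (Fin 2) (Fin 2) C) L).trans (tensorMatrix (A ⊗[C] L))

theorem tensorMatrixTensor_star {A L : Type u} [CommRing A] [Algebra C A] [CommRing L]
    [Algebra C L] (r : A ⊗[C] L) (s : Matrix (Fin 2) (Fin 2) C ⊗[C] L) :
    tensorMatrixTensor A L (star A (Matrix (Fin 2) (Fin 2) C) L r s) =
      r • (matrixTensor L s).map (inR C A L) := by
  induction r with
  | zero => simp
  | add x y hx hy => simp only [map_add, LinearMap.add_apply, add_smul, hx, hy]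
  | tmul a h =>
    induction s with
    | zero => ext; simp
    | add x y hx hy =>
      rw [map_add, map_add, hx, hy, map_add, Matrix.map_add _ (map_add _), smul_add]
    | tmul Y h' =>
      rw [EquivariantModule.star_tmul]
      ext i j
      simp [tensorMatrixTensor, tensorMatrix_tmul, matrixTensor_tmul, TensorProduct.smul_tmul']

variable (C q) in
/-- The universal `N`, as an element of the twist of the structure sheaf by the adjoint
representation. -/
noncomputable def tensorN : CoordX C q ⊗[C] Matrix (Fin 2) (Fin 2) C :=
  (tensorMatrix (CoordX C q)).symm (CoordX.N C q)

/-- The group conjugates `N` by `g⁻¹` as a function and by `g` through the adjoint representation,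
and the two cancel: `N` is an invariant section of `A ⊗ 𝔤𝔩₂`. -/
theorem tensorCoact_tensorN : tensorCoact (CoordX C q) (Matrix (Fin 2) (Fin 2) C) (CoordGL C)
    (CoordX.act C q).toLinearMap (adjointCoact C) (tensorN C q) = tensorN C q ⊗ₜ 1 := by
  apply (tensorMatrixTensor (C := C) (CoordX C q) (CoordGL C)).injective
  set G := mapGL (inR C (CoordX C q) (CoordGL C)) (CoordGL.univ C) with hG
  have h1 : G.val * G⁻¹.val = 1 := by rw [← Units.val_mul, mul_inv_cancel]; rfl
  have e1 : tensorMatrixTensor (CoordX C q) (CoordGL C) (tensorN C q ⊗ₜ 1) =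
      (CoordX.N C q).map (inL C (CoordX C q) (CoordGL C)) := by
    have : TensorProduct.rightComm C (CoordX C q) (Matrix (Fin 2) (Fin 2) C) (CoordGL C)
        (tensorN C q ⊗ₜ 1) = (inL C (CoordX C q) (CoordGL C)).toLinearMap.rTensor _
          (tensorN C q) := by
      generalize tensorN C q = t
      induction t with
      | zero => simp
      | add x y hx hy => rw [TensorProduct.add_tmul, map_add, map_add, hx, hy]
      | tmul x y => simp
    rw [tensorMatrixTensor, LinearEquiv.trans_apply, this, tensorMatrix_rTensor, tensorN,
      LinearEquiv.apply_symm_apply]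
    rfl
  have e2 : ∀ i j, tensorMatrixTensor (CoordX C q) (CoordGL C) (star _ _ _
      (CoordX.act C q (CoordX.N C q i j)) (adjointCoact C (Matrix.single i j 1))) =
      G.val * Matrix.single i j (CoordX.act C q (CoordX.N C q i j)) * G⁻¹.val := by
    intro i j
    rw [tensorMatrixTensor_star, matrixTensor_adjointCoact, map_conj, map_algebraMap_map,
      ← Matrix.smul_mul, ← Matrix.mul_smul, Matrix.map_single _ _ _ (algebraMap C _), map_one,
      Matrix.smul_single, smul_eq_mul, mul_one]
  rw [e1, tensorN, tensorMatrix_symm_apply]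
  simp only [map_sum, tensorCoact_tmul, AlgHom.toLinearMap_apply, e2]
  simp only [← Finset.sum_mul, ← Finset.mul_sum]
  have e3 : ∑ i, ∑ j, Matrix.single i j (CoordX.act C q (CoordX.N C q i j)) =
      (CoordX.N C q).map (CoordX.act C q) :=
    (Matrix.matrix_eq_sum_single _).symm
  rw [e3, CoordX.map_act_N, ← hG]
  rw [← mul_assoc, ← mul_assoc, h1, one_mul, mul_assoc, h1, mul_one]

variable (C q) in
/-- The map `m ↦ ∑ N_ij m ⊗ E_ij`. -/
noncomputable def nuLin (M : Type u) [AddCommGroup M] [Module C M] [Module (CoordX C q) M]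
    [IsScalarTower C (CoordX C q) M] :
    M →ₗ[CoordX C q] M ⊗[C] Matrix (Fin 2) (Fin 2) C :=
  ∑ i, ∑ j, (CoordX.N C q i j) •
    (TensorProduct.AlgebraTensorModule.mk C (CoordX C q) M
      (Matrix (Fin 2) (Fin 2) C)).flip (Matrix.single i j 1)

theorem nuLin_apply {M : Type u} [AddCommGroup M] [Module C M] [Module (CoordX C q) M]
    [IsScalarTower C (CoordX C q) M] (m : M) : nuLin C q M m =
      ∑ i, ∑ j, (CoordX.N C q i j • m) ⊗ₜ[C] Matrix.single i j (1 : C) := by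
  simp [nuLin, TensorProduct.smul_tmul']

/-- Equivariance of `m ↦ N m` follows from invariance of `N`. -/
theorem coact_nuLin (M : QCohXModG C q) (m : M.carrier) :
    tensorCoact M.carrier (Matrix (Fin 2) (Fin 2) C) (CoordGL C) M.coact (adjointCoact C)
      (nuLin C q M.carrier m) =
      ((nuLin C q M.carrier).restrictScalars C).rTensor (CoordGL C) (M.coact m) := by
  rw [nuLin_apply]
  simp only [map_sum, tensorCoact_tmul, M.coact_smul]
  generalize M.coact m = t
  induction t with
  | zero => simp
  | add x y hx hy =>
    simp only [map_add, LinearMap.add_apply, Finset.sum_add_distrib, hx, hy]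
  | tmul m h =>
    -- Multiplication by `m ⊗ h`, which carries the invariance of `N` in `A ⊗ 𝔤𝔩₂` over to `M ⊗
    -- 𝔤𝔩₂`.
    let B : (CoordX C q ⊗[C] Matrix (Fin 2) (Fin 2) C) ⊗[C] CoordGL C →ₗ[C]
        (M.carrier ⊗[C] Matrix (Fin 2) (Fin 2) C) ⊗[C] CoordGL C :=
      TensorProduct.map (((LinearMap.toSpanSingleton (CoordX C q) M.carrier m).restrictScalars
        C).rTensor _) (LinearMap.mulRight C h)
    have hB : ∀ (r : CoordX C q ⊗[C] CoordGL C) (s : Matrix (Fin 2) (Fin 2) C ⊗[C] CoordGL C),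
        star _ _ _ (TensorProduct.map₂ (Algebra.lsmul C C M.carrier).toLinearMap
          (LinearMap.mul C (CoordGL C)) r (m ⊗ₜ h)) s = B (star _ _ _ r s) := by
      intro r s
      induction r with
      | zero => simp
      | add x y hx hy => simp only [map_add, LinearMap.add_apply, hx, hy]
      | tmul a h' =>
        induction s with
        | zero => simp
        | add x y hx hy => simp only [map_add, hx, hy]
        | tmul Y h'' =>
          simp only [TensorProduct.map₂_apply_tmul, EquivariantModule.star_tmul, B,
            TensorProduct.map_tmul]
          simp [mul_right_comm]
    have h2 := congrArg B (tensorCoact_tensorN (C := C) (q := q))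
    rw [tensorN, tensorMatrix_symm_apply] at h2
    simp only [map_sum, tensorCoact_tmul, AlgHom.toLinearMap_apply] at h2
    simp only [hB]
    rw [h2, LinearMap.rTensor_tmul, LinearMap.restrictScalars_apply, nuLin_apply]
    simp only [TensorProduct.sum_tmul, map_sum, B, TensorProduct.map_tmul, LinearMap.rTensor_tmul]
    simp

/-- The morphism `m ↦ ∑ N_ij m ⊗ E_ij` to the twist by the adjoint representation. -/
noncomputable def nu (M : QCohXModG C q) : M ⟶ twist M (adjointRep C) where
  toLin := nuLin C q M.carrier
  comm m := coact_nuLin M m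

variable (C q) in
/-- The action of `N` as a natural transformation. -/
noncomputable def nuNatTrans :
    𝟭 (QCohXModG C q) ⟶ twistFunctor (adjointRep C) where
  app M := nu M
  naturality M M' f := by
    ext m
    have h1 : nuLin C q M'.carrier (f.toLin m) =
        TensorProduct.AlgebraTensorModule.map f.toLin LinearMap.id (nuLin C q M.carrier m) := by
      rw [nuLin_apply, nuLin_apply]
      simp
    exact h1

theorem tensorMatrix_nuLin (M : Type u) [AddCommGroup M] [Module C M] [Module (CoordX C q) M]
    [IsScalarTower C (CoordX C q) M] (m : M) :
    tensorMatrix M (nuLin C q M m) = Matrix.of fun i j => CoordX.N C q i j • m := by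
  rw [nuLin_apply]
  exact (tensorMatrix (C := C) M).apply_symm_apply (Matrix.of fun i j => CoordX.N C q i j • m)

end Nu

/-! ### Division by `f` -/

section DivF

open EquivariantModule Matrix

variable {C : Type u} [Field C] {q : ℕ}

theorem proj_invariantF : CoordX.proj C q (invariantF C q : CoordGL C) =
    (1 + (q : CoordX C q)) ^ 2 * (CoordX.φ C q).val.det -
      (q : CoordX C q) * (CoordX.φ C q).val.trace ^ 2 := by
  have h : CoordX.proj C q ((1 + (q : CoordGL C)) ^ 2 * (CoordGL.univ C).val.det -
      (q : CoordGL C) * (CoordGL.univ C).val.trace ^ 2) = (1 + (q : CoordX C q)) ^ 2 *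
        (mapGL (CoordX.proj C q) (CoordGL.univ C)).val.det -
      (q : CoordX C q) * (mapGL (CoordX.proj C q) (CoordGL.univ C)).val.trace ^ 2 := by
    rw [map_sub, map_mul, map_mul, map_pow, map_pow, map_add, map_one, map_natCast,
      ← det_mapGL, ← trace_mapGL]
  exact h

/-- Matrices `n` with `g n g⁻¹ = q⁻¹ n` are killed by `f(g)`. -/
theorem relation_smul_eq_zero [CharZero C] (hq : 2 ≤ q) {R : Type*} [CommRing R] [Algebra C R]
    (g : GL (Fin 2) R) (n : Matrix (Fin 2) (Fin 2) R)
    (h : g.val * n * g⁻¹.val = (q : C)⁻¹ • n) :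
    ((1 + (q : R)) ^ 2 * g.val.det - (q : R) * g.val.trace ^ 2) • n = 0 := by
  have hq0 := natCast_ne_zero_of_two_le (C := C) hq
  have hu1 : IsUnit ((q : R) - 1) := by
    rw [← map_natCast (algebraMap C R), ← map_one (algebraMap C R), ← map_sub]
    refine isUnit_algebraMap_of_ne_zero (sub_ne_zero.2 fun h => ?_)
    exact one_ne_natCast_pow (C := C) hq 1 le_rfl (by rw [pow_one, ← h])
  have hinv : g⁻¹.val * g.val = 1 := by rw [← Units.val_mul, inv_mul_cancel]; rfl
  have h1 : n * g.val = (q : R) • (g.val * n) := by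
    have h2 := congrArg (fun t => (q : C) • (t * g.val)) h
    beta_reduce at h2
    rw [mul_assoc _ _ g.val, hinv, mul_one, Matrix.smul_mul, smul_smul, mul_inv_cancel₀ hq0,
      one_smul] at h2
    rw [← h2, ← algebraMap_smul_matrix, map_natCast]
  have CH : g.val * g.val = g.val.trace • g.val - g.val.det • (1 : Matrix (Fin 2) (Fin 2) R) := by
    ext i j
    rw [Matrix.trace_fin_two, Matrix.det_fin_two]
    fin_cases i <;> fin_cases j <;> simp [Matrix.mul_apply, Fin.sum_univ_two] <;> ring
  set t := g.val.trace
  set d := g.val.det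
  have a1 : g.val * (g.val * n) = t • (g.val * n) - d • n := by
    rw [← mul_assoc, CH, sub_mul, Matrix.smul_mul, Matrix.smul_mul, one_mul]
  -- Cayley-Hamilton multiplied by `n` on the other side; moving `g` across `n` costs a factor `q`
  -- each time.
  have a2 : (q : R) ^ 2 • (g.val * (g.val * n)) = (t * q) • (g.val * n) - d • n := by
    have h2 : n * (g.val * g.val) = (q : R) ^ 2 • (g.val * (g.val * n)) := by
      rw [← mul_assoc, h1, Matrix.smul_mul, mul_assoc, h1, Matrix.mul_smul, smul_smul, pow_two]
    rw [← h2, CH, mul_sub, Matrix.mul_smul, Matrix.mul_smul, mul_one, h1, smul_smul]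
  have a3 : ((q : R) - 1) • (g.val * ((1 + (q : R)) • (g.val * n) - t • n)) = 0 := by
    rw [mul_sub, Matrix.mul_smul, Matrix.mul_smul]
    have h2 := congrArg₂ (· - ·) a2 a1
    beta_reduce at h2
    have h3 : (q : R) ^ 2 • (g.val * (g.val * n)) - g.val * (g.val * n) =
        (((q : R) - 1) * (1 + q)) • (g.val * (g.val * n)) := by
      module
    rw [h3] at h2
    rw [smul_sub, smul_smul, h2]
    module
  -- Subtracting the two forms of Cayley-Hamilton and cancelling `q - 1` and `g` gives `(1 + q) g n
  -- = t n`. Inserted into `a1`, multiplied by `(1 + q)²`, this leaves a relation between `d n` and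
  -- `t² n`, namely the claim.
  have a4 : (1 + (q : R)) • (g.val * n) = t • n := by
    have h2 := congrArg (g⁻¹.val * ·) (hu1.smul_eq_zero.1 a3)
    simp only [← mul_assoc, hinv, one_mul, mul_zero] at h2
    rw [sub_eq_zero] at h2
    exact h2
  have a5 := congrArg ((1 + (q : R)) ^ 2 • ·) a1
  have a6 : (1 + (q : R)) ^ 2 • (g.val * (g.val * n)) = t ^ 2 • n := by
    rw [pow_two, mul_smul, ← Matrix.mul_smul, a4, Matrix.mul_smul, smul_comm, a4, smul_smul,
      pow_two]
  have a7 : (1 + (q : R)) ^ 2 • (t • (g.val * n)) = ((1 + (q : R)) * t ^ 2) • n := by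
    rw [smul_comm, pow_two, mul_smul, a4, smul_smul, smul_smul]
    congr 1
    ring
  simp only [smul_sub, a6, a7] at a5
  rw [sub_smul, sub_eq_zero, mul_smul, mul_smul]
  have a8 : (1 + (q : R)) ^ 2 • (d • n) = ((1 + (q : R)) * t ^ 2) • n - t ^ 2 • n := by
    rw [a5]; abel
  rw [a8]
  module

theorem proj_invariantF_mul_eq_zero [CharZero C] (hq : 2 ≤ q) {a : CoordX C q}
    (ha : a ∈ idealX₀ C q) : CoordX.proj C q (invariantF C q : CoordGL C) * a = 0 := by
  refine Submodule.span_induction (p := fun a _ => CoordX.proj C q (invariantF C q : CoordGL C) *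
    a = 0) ?_ (mul_zero _) (fun x y _ _ hx hy => by rw [mul_add, hx, hy, add_zero])
    (fun r x _ hx => by rw [smul_eq_mul, mul_left_comm, hx, mul_zero]) ha
  rintro _ ⟨p, rfl⟩
  have := relation_smul_eq_zero hq _ _ (CoordX.φ_N C q)
  rw [proj_invariantF]
  exact congrFun (congrFun this p.1) p.2

/-- At the identity matrix `f` takes the value `(1 + q)² - 4 q = (q - 1)²`. -/
theorem invariantF_ne_zero [CharZero C] (hq : 2 ≤ q) : (invariantF C q : CoordGL C) ≠ 0 := by
  intro h
  have h1 : CoordGL.lift (C := C) (1 : GL (Fin 2) C) ((1 + (q : CoordGL C)) ^ 2 *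
    (CoordGL.univ C).val.det - (q : CoordGL C) * (CoordGL.univ C).val.trace ^ 2) = 0 :=
    (congrArg _ h).trans (map_zero _)
  rw [map_sub, map_mul, map_mul, map_pow, map_pow, map_add, map_one, map_natCast,
      ← det_mapGL, ← trace_mapGL, CoordGL.mapGL_lift] at h1
  simp only [Units.val_one, Matrix.det_one, Matrix.trace_one, Fintype.card_fin] at h1
  have h2 : ((q : C) - 1) ^ 2 = 0 := by
    push_cast at h1
    linear_combination h1
  have h3 := pow_eq_zero_iff (two_ne_zero) |>.1 h2
  exact one_ne_natCast_pow (C := C) hq 1 le_rfl (by rw [pow_one, ← sub_eq_zero.1 h3])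

/-- Multiplication by `f` factors through the functions on `X₀`. -/
theorem exists_divF [CharZero C] (hq : 2 ≤ q) : ∃ m : structureSheafX₀ C q ⟶ structureSheafX C q,
    projX₀ C q ≫ m = invariantF C q • 𝟙 (structureSheafX C q) := by
  refine exists_desc (kernel.ι (projX₀ C q)) (projX₀ C q) surjective_projX₀
    (exists_of_shortExact (shortExact_kernel (projX₀ C q))) _ ?_
  ext x
  refine proj_invariantF_mul_eq_zero hq ((projX₀_eq_zero_iff _).1 ?_)
  exact congrArg (fun t => Hom.toLin t x) (kernel.condition (projX₀ C q))

variable {m : structureSheafX₀ C q ⟶ structureSheafX C q}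

theorem divF_projX₀
    (hm : projX₀ C q ≫ m = invariantF C q • 𝟙 (structureSheafX C q))
    (a : CoordX C q) : m.toLin ((projX₀ C q).toLin a) =
    CoordX.proj C q (invariantF C q : CoordGL C) * a :=
  congrArg (fun t => Hom.toLin t a) hm

/-- If `f a = 0`, restrict to `N = 0`: there the functions form a domain in which `f` is not zero,
so `a` vanishes on `X₀`. -/
theorem mono_divF [CharZero C]
    (hm : projX₀ C q ≫ m = invariantF C q • 𝟙 (structureSheafX C q))
    (hq : 2 ≤ q) : Mono m := by
  refine mono_of_injective m ((injective_iff_map_eq_zero m.toLin).2 fun x hx => ?_)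
  obtain ⟨(a : CoordX C q), rfl⟩ := surjective_projX₀ x
  have h1 := (divF_projX₀ hm a).symm.trans hx
  have h2 := (congrArg (CoordX.zeroSection C q) h1).trans (map_zero _)
  rw [map_mul, CoordX.zeroSection_proj, mul_eq_zero] at h2
  have h3 := sub_proj_zeroSection_mem a
  rw [h2.resolve_left (invariantF_ne_zero hq), map_zero, sub_zero] at h3
  exact (projX₀_eq_zero_iff a).2 h3

/-- Composed with the projection, `g` becomes an invariant function `z`, and `z` kills `N` because
`g` is defined on `A / I`. By `mkX_eq_zero_of_mul_N`, `z` is a multiple of `f`. -/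
theorem exists_smul_divF_of_hom [CharZero C]
    (hm : projX₀ C q ≫ m = invariantF C q • 𝟙 (structureSheafX C q))
    (hq : 2 ≤ q)
    (g : structureSheafX₀ C q ⟶ structureSheafX C q) : ∃ z : InvariantRing C, z • m = g := by
  obtain ⟨z, hz⟩ := exists_smul_id_of_hom hq (projX₀ C q ≫ g)
  have h1 : ∀ i j, mkX C q (CoordX.proj C q z * CoordX.N C q i j) = 0 := by
    intro i j
    have h2 : CoordX.proj C q z * CoordX.N C q i j =
        g.toLin ((projX₀ C q).toLin (CoordX.N C q i j)) :=
      congrArg (fun t => Hom.toLin t (CoordX.N C q i j)) hz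
    rw [h2, (projX₀_eq_zero_iff _).2 (N_mem_idealX₀ i j)]
    exact (congrArg (mkX C q) (map_zero g.toLin)).trans (map_zero _)
  obtain ⟨b, hb⟩ := Ideal.mem_span_singleton'.1
    (Ideal.Quotient.eq_zero_iff_mem.1 (mkX_eq_zero_of_mul_N hq _ h1))
  have h2 := congrArg (CoordX.zeroSection C q) hb
  rw [map_mul, CoordX.zeroSection_proj, CoordX.zeroSection_proj] at h2
  -- The cofactor `b` is an arbitrary function on `X`. Its restriction to `N = 0` is a function on
  -- `GL₂` with `b' f = z`, and it is invariant because `f` can be cancelled.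
  set b' := CoordX.zeroSection C q b
  have h3 : b' ∈ InvariantRing C := by
    rw [mem_invariantRing]
    have h4 := (mem_invariantRing C z).1 z.2
    rw [← h2, map_mul, (mem_invariantRing C _).1 (invariantF C q).2] at h4
    have h5 : Function.Injective (LinearMap.mulRight C (invariantF C q : CoordGL C)) :=
      fun x y hxy => mul_right_cancel₀ (invariantF_ne_zero hq) hxy
    apply Module.Flat.rTensor_preserves_injective_linearMap (M := CoordGL C) _ h5
    have h6 : ∀ t : CoordGL C ⊗[C] CoordGL C,
        (LinearMap.mulRight C (invariantF C q : CoordGL C)).rTensor (CoordGL C) t =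
          t * ((invariantF C q : CoordGL C) ⊗ₜ 1) := by
      intro t
      induction t with
      | zero => simp
      | add x y hx hy => rw [map_add, add_mul, hx, hy]
      | tmul x y => simp
    rw [h6, h4, LinearMap.rTensor_tmul, LinearMap.mulRight_apply]
  refine ⟨⟨b', h3⟩, ?_⟩
  rw [← cancel_epi (projX₀ C q), ← hz, Linear.comp_smul, hm, smul_smul]
  congr 1
  exact Subtype.ext h2

theorem smul_divF_injective [CharZero C]
    (hm : projX₀ C q ≫ m = invariantF C q • 𝟙 (structureSheafX C q))
    (hq : 2 ≤ q) {z : InvariantRing C} (hz : z • m = 0) :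
    z = 0 := by
  have h1 : projX₀ C q ≫ (z • m) = 0 := by rw [hz, comp_zero]
  rw [Linear.comp_smul, hm, smul_smul] at h1
  have h2 : CoordX.proj C q ((z * invariantF C q : InvariantRing C) : CoordGL C) * 1 = 0 :=
    congrArg (fun t => Hom.toLin t (1 : CoordX C q)) h1
  rw [mul_one, map_eq_zero_iff _ CoordX.proj_injective] at h2
  exact Subtype.ext ((mul_eq_zero.1 h2).resolve_right (invariantF_ne_zero hq))

end DivF

/-! ### The quotient of the adjoint twist -/

section AdjointQuotient

open EquivariantModule Matrix

variable {C : Type u} [Field C] {q : ℕ}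

theorem tensorMatrix_evalφ (x : CoordX C q) (s : Matrix (Fin 2) (Fin 2) C ⊗[C] CoordGL C) :
    tensorMatrix (CoordX C q) (evalφ q (CoordX C q ⊗[C] Matrix (Fin 2) (Fin 2) C)
      ((TensorProduct.assoc C _ _ _).symm (x ⊗ₜ s))) =
      x • (matrixTensor (CoordGL C) s).map (CoordX.proj C q) := by
  induction s with
  | zero => ext; simp
  | add a b ha hb =>
    rw [TensorProduct.tmul_add, map_add, map_add, map_add, ha, hb, map_add,
      Matrix.map_add _ (map_add _), smul_add]
  | tmul Y h =>
    rw [TensorProduct.assoc_symm_tmul, evalφ_tmul, tensorMatrix_smul]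
    ext i j
    simp [tensorMatrix_tmul, matrixTensor_tmul, mul_comm]

theorem tensorMatrix_twistInertia (z : CoordX C q ⊗[C] Matrix (Fin 2) (Fin 2) C) :
    tensorMatrix (CoordX C q) (twistInertia q (CoordX C q) (adjointCoact C) z) =
      (CoordX.φ C q).val * tensorMatrix (CoordX C q) z * (CoordX.φ C q)⁻¹.val := by
  induction z with
  | zero => simp
  | add x y hx hy => rw [map_add, map_add, map_add, hx, hy, mul_add, add_mul]
  | tmul x Y =>
    rw [twistInertia_tmul, tensorMatrix_evalφ, matrixTensor_adjointCoact, map_conj,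
      map_algebraMap_map]
    have h1 : tensorMatrix (CoordX C q) (x ⊗ₜ[C] Y) =
        x • Y.map (algebraMap C (CoordX C q)) := by
      ext i j
      simp [tensorMatrix_tmul, Algebra.smul_def, mul_comm]
    rw [h1, Matrix.mul_smul, Matrix.smul_mul]
    rfl

theorem map_smul_matrix {R S : Type*} [CommRing R] [CommRing S] [Algebra C R] [Algebra C S]
    (f : R →ₐ[C] S) (c : C) (Y : Matrix (Fin 2) (Fin 2) R) : (c • Y).map f = c • Y.map f := by
  ext i j
  simp

variable (C q) in
/-- The difference of the action of the universal `φ` on the adjoint representation and of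
multiplication by `q⁻¹`, as a linear map. -/
noncomputable def adjointDefectLin : CoordX C q ⊗[C] Matrix (Fin 2) (Fin 2) C →ₗ[CoordX C q]
    CoordX C q ⊗[C] Matrix (Fin 2) (Fin 2) C :=
  { toFun := twistInertia q (CoordX C q) (adjointCoact C)
    map_add' := map_add _
    map_smul' := twistInertia_smul q (adjointCoact C) } -
  CoordX.proj C q (algebraMap C (CoordGL C) (q : C)⁻¹) • LinearMap.id

variable (C q) in
/-- The difference of the action of the universal `φ` on the adjoint representation and of
multiplication by `q⁻¹`. -/
noncomputable def adjointDefect :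
    twist (structureSheafX C q) (adjointRep C) ⟶ twist (structureSheafX C q) (adjointRep C) :=
  twistInertiaHom (structureSheafX C q) (adjointRep C) -
    algebraMap C (InvariantRing C) (q : C)⁻¹ • 𝟙 _

theorem adjointDefectLin_apply (z : CoordX C q ⊗[C] Matrix (Fin 2) (Fin 2) C) :
    adjointDefectLin C q z =
      twistInertia q (CoordX C q) (adjointCoact C) z - (q : C)⁻¹ • z := by
  have h1 : adjointDefectLin C q z = twistInertia q (CoordX C q) (adjointCoact C) z -
      CoordX.proj C q (algebraMap C (CoordGL C) (q : C)⁻¹) • z := rfl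
  rw [h1, AlgHom.commutes, algebraMap_smul]

theorem adjointDefect_toLin (z : CoordX C q ⊗[C] Matrix (Fin 2) (Fin 2) C) :
    (adjointDefect C q).toLin z = adjointDefectLin C q z :=
  (sub_eq_add_neg (twistInertia q (CoordX C q) (adjointCoact C) z)
    (CoordX.proj C q (algebraMap C (CoordGL C) (q : C)⁻¹) • z)).symm

theorem tensorMatrix_adjointDefectLin (z : CoordX C q ⊗[C] Matrix (Fin 2) (Fin 2) C) :
    tensorMatrix (CoordX C q) (adjointDefectLin C q z) =
      (CoordX.φ C q).val * tensorMatrix (CoordX C q) z * (CoordX.φ C q)⁻¹.val -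
        (q : C)⁻¹ • tensorMatrix (CoordX C q) z := by
  rw [adjointDefectLin_apply, map_sub, map_smul, tensorMatrix_twistInertia]

theorem exists_map_mkX_eq (Y : Matrix (Fin 2) (Fin 2) (CoordXmod C q)) :
    ∃ Z : Matrix (Fin 2) (Fin 2) (CoordX C q), Z.map (mkX C q) = Y := by
  choose Z hZ using fun i j => Ideal.Quotient.mkₐ_surjective C
    (Ideal.span {CoordX.proj C q (invariantF C q : CoordGL C)}) (Y i j)
  exact ⟨Matrix.of Z, Matrix.ext hZ⟩

/-- The elements of the twist by the adjoint representation which, modulo `f`, are in the image of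
`Ad(φ) - q⁻¹`. -/
def IsDefect (z : CoordX C q ⊗[C] Matrix (Fin 2) (Fin 2) C) : Prop :=
  ∃ Y : Matrix (Fin 2) (Fin 2) (CoordXmod C q), (tensorMatrix (CoordX C q) z).map (mkX C q) =
    (mapGL (mkX C q) (CoordX.φ C q)).val * Y * (mapGL (mkX C q) (CoordX.φ C q))⁻¹.val -
      (q : C)⁻¹ • Y

theorem map_mkX_adjointDefectLin (z : CoordX C q ⊗[C] Matrix (Fin 2) (Fin 2) C) :
    (tensorMatrix (CoordX C q) (adjointDefectLin C q z)).map (mkX C q) =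
      (mapGL (mkX C q) (CoordX.φ C q)).val * (tensorMatrix (CoordX C q) z).map (mkX C q) *
        (mapGL (mkX C q) (CoordX.φ C q))⁻¹.val -
      (q : C)⁻¹ • (tensorMatrix (CoordX C q) z).map (mkX C q) := by
  rw [tensorMatrix_adjointDefectLin, Matrix.map_sub _ (map_sub _), map_conj, map_smul_matrix]

/-- The condition modulo `f` is lifted to `A ⊗ 𝔤𝔩₂`, where it describes the submodule generated by
multiples of `f` and the image of `Ad(φ) - q⁻¹`. -/
theorem isDefect_iff (z : CoordX C q ⊗[C] Matrix (Fin 2) (Fin 2) C) : IsDefect z ↔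
    ∃ t s : CoordX C q ⊗[C] Matrix (Fin 2) (Fin 2) C,
      CoordX.proj C q (invariantF C q : CoordGL C) • t = z - adjointDefectLin C q s := by
  constructor
  · rintro ⟨Y, hY⟩
    obtain ⟨Z, rfl⟩ := exists_map_mkX_eq Y
    obtain ⟨s, rfl⟩ := (tensorMatrix (C := C) (CoordX C q)).surjective Z
    rw [← map_mkX_adjointDefectLin, ← sub_eq_zero, ← Matrix.map_sub _ (map_sub _), ← map_sub] at hY
    have h1 : ∀ i j, ∃ b, CoordX.proj C q (invariantF C q : CoordGL C) * b =
        tensorMatrix (CoordX C q) (z - adjointDefectLin C q s) i j := fun i j =>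
      Ideal.mem_span_singleton.1 (Ideal.Quotient.eq_zero_iff_mem.1
        (congrFun (congrFun hY i) j)) |>.imp fun b hb => hb.symm
    choose B hB using h1
    obtain ⟨w, hw⟩ := (tensorMatrix (C := C) (CoordX C q)).surjective (Matrix.of B)
    refine ⟨w, s, (tensorMatrix (C := C) (CoordX C q)).injective ?_⟩
    rw [tensorMatrix_smul, hw]
    exact Matrix.ext hB
  · rintro ⟨t, s, h⟩
    refine ⟨(tensorMatrix (CoordX C q) s).map (mkX C q), ?_⟩
    rw [← map_mkX_adjointDefectLin, ← sub_eq_zero, ← Matrix.map_sub _ (map_sub _), ← map_sub, ← h,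
      tensorMatrix_smul]
    ext i j
    rw [Matrix.map_apply, Matrix.smul_apply, smul_eq_mul, map_mul, mkX_proj_invariantF, zero_mul]
    rfl

variable (C q) in
-- `L` is formed by two successive cokernels, first of `Ad(φ) - q⁻¹` and then of multiplication by
-- `f`.
theorem exists_adjointQuotient : ∃ (L : QCohXModG C q)
    (c : twist (structureSheafX C q) (adjointRep C) ⟶ L), Epi c ∧
      ∀ z : CoordX C q ⊗[C] Matrix (Fin 2) (Fin 2) C, c.toLin z = 0 ↔ IsDefect z := by
  let c₁ := cokerπ (adjointDefect C q)
  let c₂ := cokerπ (invariantF C q • 𝟙 (cokerObj (adjointDefect C q)))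
  have h₁ : Function.Surjective c₁.toLin := cokerπ_surjective _
  have h₂ : Function.Surjective c₂.toLin := cokerπ_surjective _
  have h3 : ∀ z : CoordX C q ⊗[C] Matrix (Fin 2) (Fin 2) C, c₁.toLin z = 0 ↔
      ∃ s, adjointDefectLin C q s = z := fun z => by
    refine ⟨fun h => ?_, ?_⟩
    · obtain ⟨(s : CoordX C q ⊗[C] Matrix (Fin 2) (Fin 2) C), hs⟩ := cokerπ_eq_zero _ _ h
      exact ⟨s, (adjointDefect_toLin s).symm.trans hs⟩
    · rintro ⟨s, rfl⟩
      exact (congrArg c₁.toLin (adjointDefect_toLin s).symm).trans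
        (congrArg (fun t => Hom.toLin t s) (comp_cokerπ (adjointDefect C q)))
  have h4 : ∀ z t : CoordX C q ⊗[C] Matrix (Fin 2) (Fin 2) C,
      CoordX.proj C q (invariantF C q : CoordGL C) • c₁.toLin t = c₁.toLin z ↔
        ∃ s, CoordX.proj C q (invariantF C q : CoordGL C) • t = z - adjointDefectLin C q s := by
    intro z t
    have e1 : c₁.toLin (z - CoordX.proj C q (invariantF C q : CoordGL C) • t) =
        c₁.toLin z - CoordX.proj C q (invariantF C q : CoordGL C) • c₁.toLin t :=
      (map_sub c₁.toLin _ _).trans (congrArg _ (map_smul c₁.toLin _ t))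
    rw [eq_comm, ← sub_eq_zero, ← e1, h3]
    refine exists_congr fun s => ?_
    rw [eq_sub_iff_add_eq, eq_sub_iff_add_eq, add_comm]
  refine ⟨_, c₁ ≫ c₂, epi_of_surjective _ (h₂.comp h₁), fun z => ?_⟩
  rw [isDefect_iff]
  refine ⟨fun hz => ?_, ?_⟩
  · obtain ⟨y, hy⟩ := cokerπ_eq_zero _ _ hz
    obtain ⟨(t : CoordX C q ⊗[C] Matrix (Fin 2) (Fin 2) C), rfl⟩ := h₁ y
    exact ⟨t, (h4 z t).1 hy⟩
  · rintro ⟨t, h⟩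
    refine (congrArg c₂.toLin ((h4 z t).2 h).symm).trans ?_
    exact congrArg (fun r => Hom.toLin r (c₁.toLin t))
      (comp_cokerπ (invariantF C q • 𝟙 (cokerObj (adjointDefect C q))))

theorem map_mkX_nuLin (a : CoordX C q) :
    (tensorMatrix (CoordX C q) (nuLin C q (CoordX C q) a)).map (mkX C q) =
      mkX C q a • (CoordX.N C q).map (mkX C q) := by
  rw [tensorMatrix_nuLin]
  ext i j
  rw [Matrix.map_apply, Matrix.of_apply, smul_eq_mul, map_mul, mul_comm]
  rfl

variable (C q) in
theorem exists_isSpectral_mkX [CharZero C] (hq : 2 ≤ q) : ∃ p : SpectralPair (CoordGLmod C q),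
    IsSpectral (C := C) q p (mapGL (mkGL C q) (CoordGL.univ C)) ∧
      IsSpectral (C := C) q (p.map (projMod C q).toRingHom)
        (mapGL (mkX C q) (CoordX.φ C q)) := by
  obtain ⟨p, hp⟩ := exists_isSpectral (C := C) hq (mapGL (mkGL C q) (CoordGL.univ C))
    spectral_relation
  exact ⟨p, hp, hp.map (projMod C q)⟩

/-- Over `f = 0`, project to the corner: the image of `Ad(φ) - q⁻¹` has no component there, while
`N` equals its own corner. So `a N = 0`, and functions killing `N` vanish. This is the injectivity
of `A / f → L`. -/
theorem isDefect_nuLin_iff [CharZero C] (hq : 2 ≤ q) (a : CoordX C q) :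
    IsDefect (nuLin C q (CoordX C q) a) ↔ mkX C q a = 0 := by
  refine ⟨fun h => ?_, fun h => ⟨0, by rw [map_mkX_nuLin, h]; simp⟩⟩
  obtain ⟨Y, hY⟩ := h
  obtain ⟨p, hp, hp'⟩ := exists_isSpectral_mkX C q hq
  rw [map_mkX_nuLin] at hY
  have h1 := congrArg (p.map (projMod C q).toRingHom).corner hY
  rw [SpectralPair.corner_smul, corner_N hp hq, ← algebraMap_smul_matrix,
    SpectralPair.IsAdapted.corner_sub hp'] at h1
  refine mkX_eq_zero_of_mul_N hq a fun i j => ?_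
  rw [map_mul]
  exact congrFun (congrFun h1 i) j

/-- Tensors with `N_kl` are congruent to images of functions under `ν`. -/
theorem exists_isDefect_sub [CharZero C] (hq : 2 ≤ q) (k l : Fin 2)
    (Y : Matrix (Fin 2) (Fin 2) C) : ∃ a : CoordX C q,
      IsDefect (CoordX.N C q k l ⊗ₜ[C] Y - nuLin C q (CoordX C q) a) := by
  obtain ⟨p, hp, hp'⟩ := exists_isSpectral_mkX C q hq
  set Y' := Y.map (algebraMap C (CoordGLmod C q))
  have hY' : Y'.map (projMod C q) = Y.map (algebraMap C (CoordXmod C q)) :=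
    map_algebraMap_map (projMod C q) Y
  -- Modulo the image of `Ad(φ) - q⁻¹`, only the corner of `Y` matters, and rank one gives `N_kl
  -- corner(Y) = corner(Y)_kl N`. So `a` should lift the `(k, l)` entry of the corner.
  obtain ⟨a, ha⟩ := Ideal.Quotient.mkₐ_surjective C
    (Ideal.span {CoordX.proj C q (invariantF C q : CoordGL C)}) (projMod C q (p.corner Y' k l))
  obtain ⟨Z, hZ⟩ := SpectralPair.IsAdapted.exists_sub_corner hp' (isUnit_one_sub_inv hq)
    (isUnit_sub_inv hq) (Y.map (algebraMap C (CoordXmod C q)))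
  refine ⟨a, mkX C q (CoordX.N C q k l) • Z, ?_⟩
  rw [Matrix.mul_smul, Matrix.smul_mul, smul_comm (q : C)⁻¹, ← smul_sub, ← algebraMap_smul_matrix,
    ← hZ, map_sub, Matrix.map_sub _ (map_sub _), map_mkX_nuLin, smul_sub]
  have h1 : (tensorMatrix (CoordX C q) (CoordX.N C q k l ⊗ₜ[C] Y)).map (mkX C q) =
      mkX C q (CoordX.N C q k l) • Y.map (algebraMap C (CoordXmod C q)) := by
    ext i j
    simp [tensorMatrix_tmul, Algebra.smul_def, mul_comm]
  rw [h1, ← hY']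
  congr 1
  have h2 := SpectralPair.corner_map (p := p) (projMod C q).toRingHom Y'
  ext i j
  have h3 := N_mul_corner hp Y' hq k l i j
  refine Eq.trans ?_ (h3.symm.trans (congrArg (mkX C q (CoordX.N C q k l) * ·)
    (congrFun (congrFun h2 i) j).symm))
  rw [Matrix.smul_apply, smul_eq_mul, mul_comm]
  exact congrArg (mkX C q (CoordX.N C q i j) * ·) ha

/-- Linear maps that kill `ν` and the image of `Ad(φ) - q⁻¹` are invariant under the scaling of
`N`. -/
theorem map_rTensor_scaleX_sub [CharZero C] (hq : 2 ≤ q) {Q : Type*} [AddCommGroup Q]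
    [Module (CoordX C q) Q] (r : CoordX C q ⊗[C] Matrix (Fin 2) (Fin 2) C →ₗ[CoordX C q] Q)
    (hr : ∀ z, IsDefect z → r z = 0) (hν : ∀ a, r (nuLin C q (CoordX C q) a) = 0)
    (z : CoordX C q ⊗[C] Matrix (Fin 2) (Fin 2) C) :
    r ((scaleX C q).toLinearMap.rTensor _ z - z) = 0 := by
  -- It suffices that `r` kills `I ⊗ 𝔤𝔩₂`, since scaling is the identity modulo `I`. The generators
  -- `N_kl ⊗ Y` are killed because they are congruent to values of `ν`.
  have h1 : ∀ (a : CoordX C q) (Y : Matrix (Fin 2) (Fin 2) C), a ∈ idealX₀ C q →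
      r (a ⊗ₜ[C] Y) = 0 := by
    intro a Y ha
    refine Submodule.span_induction (p := fun a _ => r (a ⊗ₜ[C] Y) = 0) ?_ ?_ ?_ ?_ ha
    · rintro _ ⟨⟨k, l⟩, rfl⟩
      obtain ⟨b, hb⟩ := exists_isDefect_sub hq k l Y
      have h2 := hr _ hb
      rw [map_sub, hν, sub_zero] at h2
      exact h2
    · rw [TensorProduct.zero_tmul, map_zero]
    · intro a b _ _ ha hb
      rw [TensorProduct.add_tmul, map_add, ha, hb, add_zero]
    · intro c a _ ha
      rw [← TensorProduct.smul_tmul', map_smul, ha, smul_zero]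
  induction z with
  | zero => rw [map_zero, sub_zero, map_zero]
  | add x y hx hy => rw [map_add, add_sub_add_comm, map_add, hx, hy, add_zero]
  | tmul a Y =>
    rw [LinearMap.rTensor_tmul, ← TensorProduct.sub_tmul]
    exact h1 _ Y (scaleX_sub_mem (natCast_ne_zero_of_two_le hq) a)

theorem map_twistInertia_rTensor_scaleX [CharZero C] (hq : 2 ≤ q) {Q : Type*} [AddCommGroup Q]
    [Module C Q] [Module (CoordX C q) Q] [IsScalarTower C (CoordX C q) Q]
    (r : CoordX C q ⊗[C] Matrix (Fin 2) (Fin 2) C →ₗ[CoordX C q] Q)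
    (hr : ∀ z, IsDefect z → r z = 0) (hν : ∀ a, r (nuLin C q (CoordX C q) a) = 0)
    (z : CoordX C q ⊗[C] Matrix (Fin 2) (Fin 2) C) :
    r (twistInertia q (CoordX C q) (adjointCoact C) ((scaleX C q).toLinearMap.rTensor _ z)) =
      (q : C)⁻¹ • r z := by
  have h1 := map_rTensor_scaleX_sub hq r hr hν z
  set z' := (scaleX C q).toLinearMap.rTensor (Matrix (Fin 2) (Fin 2) C) z
  have h2 : r (adjointDefectLin C q z') = 0 :=
    hr _ ⟨(tensorMatrix (CoordX C q) z').map (mkX C q), map_mkX_adjointDefectLin z'⟩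
  rw [adjointDefectLin_apply, map_sub, sub_eq_zero, LinearMap.map_smul_of_tower] at h2
  rw [map_sub, sub_eq_zero] at h1
  rw [h2, h1]

/-- The linear map underlying a morphism from the adjoint twist. -/
noncomputable def twistToLin {Q : QCohXModG C q}
    (r : twist (structureSheafX C q) (adjointRep C) ⟶ Q) :
    CoordX C q ⊗[C] Matrix (Fin 2) (Fin 2) C →ₗ[CoordX C q] Q.carrier := r.toLin

theorem comp_eq_zero_apply {M N P : QCohXModG C q} {f : M ⟶ N} {g : N ⟶ P} (h : f ≫ g = 0)
    (x : M.carrier) : g.toLin (f.toLin x) = 0 :=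
  congrArg (fun t => Hom.toLin t x) h

theorem twistToLin_nuLin {Q : QCohXModG C q}
    (r : twist (structureSheafX C q) (adjointRep C) ⟶ Q)
    (hν : nu (structureSheafX C q) ≫ r = 0) (a : CoordX C q) :
    twistToLin r (nuLin C q (CoordX C q) a) = 0 := by
  have h1 : r.toLin ((nu (structureSheafX C q)).toLin a) = 0 := comp_eq_zero_apply hν a
  exact h1

/-- On quotients of the adjoint twist that kill `ν` and the image of `Ad(φ) - q⁻¹`, the universal
`φ` acts by `q⁻¹`. -/
theorem inertia_of_epi_twist [CharZero C] (hq : 2 ≤ q) {Q : QCohXModG C q}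
    (r : twist (structureSheafX C q) (adjointRep C) ⟶ Q) [Epi r]
    (hr : ∀ z, IsDefect z → twistToLin r z = 0)
    (hν : nu (structureSheafX C q) ≫ r = 0) (x : Q.carrier) :
    inertia Q x = (q : C)⁻¹ • x := by
  obtain ⟨(z : CoordX C q ⊗[C] Matrix (Fin 2) (Fin 2) C), rfl⟩ := surjective_of_epi r x
  have h1 := map_twistInertia_rTensor_scaleX hq (twistToLin r) hr (twistToLin_nuLin r hν) z
  have h2 : r.toLin (inertia _ z) = twistToLin r (twistInertia q (CoordX C q) (adjointCoact C)
      ((scaleX C q).toLinearMap.rTensor _ z)) :=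
    congrArg r.toLin (inertia_freeOn (adjointRep C) z)
  exact (map_inertia r z).symm.trans (h2.trans h1)

end AdjointQuotient

/-! ### Vanishing of higher extensions out of `𝒪_{X₀}` -/

section Vanishing

open EquivariantModule Abelian

variable {C : Type u} [Field C] {q : ℕ}

theorem nu_structureSheafX₀ : nu (structureSheafX₀ C q) = 0 := by
  ext x
  obtain ⟨(a : CoordX C q), rfl⟩ := surjective_projX₀ x
  refine (nuLin_apply (q := q) (M := (structureSheafX₀ C q).carrier) _).trans ?_
  refine Finset.sum_eq_zero fun i _ => Finset.sum_eq_zero fun j _ => ?_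
  have h1 : CoordX.N C q i j • (projX₀ C q).toLin a = 0 := by
    refine (map_smul (projX₀ C q).toLin (CoordX.N C q i j) a).symm.trans ?_
    exact (projX₀_eq_zero_iff _).2 (Ideal.mul_mem_right _ _ (N_mem_idealX₀ i j))
  rw [h1, TensorProduct.zero_tmul]

theorem mono_cokernel_desc {K M L : QCohXModG C q} (m : K ⟶ M) (κ : M ⟶ L) (w : m ≫ κ = 0)
    (h : ∀ x, κ.toLin x = 0 → ∃ y, m.toLin y = x) : Mono (cokernel.desc m κ w) := by
  refine mono_of_injective _ ((injective_iff_map_eq_zero (cokernel.desc m κ w).toLin).2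
    fun x hx => ?_)
  obtain ⟨a, rfl⟩ := surjective_of_epi (cokernel.π m) x
  obtain ⟨y, rfl⟩ := h a
    ((congrArg (fun t => Hom.toLin t a) (cokernel.π_desc m κ w)).symm.trans hx)
  exact congrArg (fun t => Hom.toLin t y) (cokernel.condition m)

variable [CharZero C]

theorem comp_cokernel_desc {𝒜 : Type*} [Category 𝒜] [Abelian 𝒜] {K M L T : 𝒜} (i : K ⟶ M)
    (ν : M ⟶ T) (c : T ⟶ L) (w : i ≫ ν ≫ c = 0) :
    ν ≫ c ≫ cokernel.π (cokernel.desc i (ν ≫ c) w) = 0 := by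
  have h1 := cokernel.π_desc i (ν ≫ c) w
  have h2 : (cokernel.π i ≫ cokernel.desc i (ν ≫ c) w) ≫
      cokernel.π (cokernel.desc i (ν ≫ c) w) = 0 := by
    rw [Category.assoc, cokernel.condition, comp_zero]
  rw [← Category.assoc]
  exact (congrArg (· ≫ _) h1).symm.trans h2

/-- The kernel of `𝒪_X → L` is exactly the ideal generated by `f`, which is the image of `m`; so the
cokernel of `m` embeds into `L`. The last two clauses are what `inertia_of_epi_twist` requires to
compute the weight of the remaining cokernel. -/
theorem exists_adjointQuotient_divF (hq : 2 ≤ q) :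
    ∃ (m : structureSheafX₀ C q ⟶ structureSheafX C q) (L : QCohXModG C q)
      (c : twist (structureSheafX C q) (adjointRep C) ⟶ L)
      (w : m ≫ nu (structureSheafX C q) ≫ c = 0), Mono m ∧ Mono (cokernel.desc m _ w) ∧ Epi c ∧
      (∀ z : CoordX C q ⊗[C] Matrix (Fin 2) (Fin 2) C, IsDefect z →
        twistToLin (c ≫ cokernel.π (cokernel.desc m _ w)) z = 0) ∧
      nu (structureSheafX C q) ≫ c ≫ cokernel.π (cokernel.desc m _ w) = 0 := by
  obtain ⟨m, hm⟩ := exists_divF (C := C) hq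
  obtain ⟨L, c, hc, hcz⟩ := exists_adjointQuotient C q
  have hκ : ∀ a : CoordX C q,
      (nu (structureSheafX C q) ≫ c).toLin a = 0 ↔ mkX C q a = 0 := fun a =>
    (hcz (nuLin C q (CoordX C q) a)).trans (isDefect_nuLin_iff hq a)
  have w : m ≫ nu (structureSheafX C q) ≫ c = 0 := by
    rw [← cancel_epi (projX₀ C q), comp_zero]
    ext (a : CoordX C q)
    refine (congrArg (nu (structureSheafX C q) ≫ c).toLin (divF_projX₀ hm a)).trans ((hκ _).2 ?_)
    rw [map_mul, mkX_proj_invariantF, zero_mul]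
  refine ⟨m, L, c, w, mono_divF hm hq, ?_, hc, fun z hz => ?_, comp_cokernel_desc m _ c w⟩
  · refine mono_cokernel_desc m _ w fun (a : CoordX C q) ha => ?_
    obtain ⟨b, hb⟩ := Ideal.mem_span_singleton.1
      (Ideal.Quotient.eq_zero_iff_mem.1 ((hκ a).1 ha))
    exact ⟨(projX₀ C q).toLin b, (divF_projX₀ hm b).trans hb.symm⟩
  · exact (congrArg (cokernel.π (cokernel.desc m _ w)).toLin ((hcz z).2 hz)).trans (map_zero _)

variable [HasExt.{w} (QCohXModG C q)]

/-- As `𝒪_X` is projective, the group is a quotient of `Ext^n(I, 𝒪_{X₀})`. That vanishes, as `I` has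
weights `q ^ d` with `d ≥ 1` and `𝒪_{X₀}` has weight `1`. -/
theorem ext_structureSheafX₀_structureSheafX₀ (hq : 2 ≤ q) (n : ℕ) :
    Subsingleton (Ext (structureSheafX₀ C q) (structureSheafX₀ C q) (n + 1)) := by
  have hq0 := natCast_ne_zero_of_two_le (C := C) hq
  have h1 : Subsingleton (Ext (kernel (projX₀ C q)) (structureSheafX₀ C q) n) :=
    HasWeightsGE.ext_subsingleton hq0 (one_ne_natCast_pow hq) (inertia_structureSheafX₀ hq0) n
      (hasWeightsGE_kernel_projX₀ hq0)
  refine subsingleton_of_forall_eq 0 fun x => ?_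
  obtain ⟨y, rfl⟩ := Ext.contravariant_sequence_exact₃ (shortExact_kernel (projX₀ C q)) _ x
    (Ext.eq_zero_of_projective (P := structureSheafX C q) _) (add_comm 1 n)
  rw [Subsingleton.elim (α := Ext (kernel (projX₀ C q)) _ n) y 0, Ext.comp_zero]

theorem ext_structureSheafX₀_structureSheafX (hq : 2 ≤ q) (n : ℕ) :
    Subsingleton (Ext (structureSheafX₀ C q) (structureSheafX C q) (n + 1)) := by
  obtain ⟨m, L, c, w, _, _, _, hz, hν⟩ := exists_adjointQuotient_divF (C := C) hq
  -- The target has weight `q⁻¹`, which is not a power `q ^ d` with `d ≥ 0`.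
  have hQ : Subsingleton (Ext (structureSheafX₀ C q)
      (cokernel (cokernel.desc m _ w)) n) :=
    HasWeightsGE.ext_subsingleton (natCast_ne_zero_of_two_le hq) (b := 0)
      (fun d _ => inv_natCast_ne_pow hq d)
      (inertia_of_epi_twist hq (c ≫ cokernel.π (cokernel.desc m _ w)) hz hν) n
      (hasWeightsGE_structureSheafX₀ (natCast_ne_zero_of_two_le hq))
  refine subsingleton_of_forall_eq 0 fun α => ?_
  refine Ext.eq_zero_of_comp_eq_zero m _ w n (ext_structureSheafX₀_structureSheafX₀ hq n) hQ α ?_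
  -- Moving `ν` from the target of `α` to its source, where it is zero, shows that `α` dies in the
  -- adjoint twist, hence in `L`.
  obtain ⟨α', hα'⟩ := Ext.exists_comp_natTrans (twistFunctor (adjointRep C))
    (shortExact_map_twistFunctor (adjointRep C)) (nuNatTrans C q) (n + 1) α
  have h1 : Ext.mk₀ ((nuNatTrans C q).app (structureSheafX₀ C q)) = 0 :=
    (congrArg Ext.mk₀ (nu_structureSheafX₀ (C := C) (q := q))).trans (Ext.mk₀_zero _ _)
  rw [h1, Ext.zero_comp] at hα'
  rw [← Ext.mk₀_comp_mk₀ (C := QCohXModG C q), ← Ext.comp_assoc_of_third_deg_zero]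
  refine (congrArg (fun t : Ext (structureSheafX₀ C q) (twist (structureSheafX C q) (adjointRep C))
    (n + 1) => Ext.comp t (Ext.mk₀ c) (add_zero (n + 1))) hα').trans ?_
  exact Ext.zero_comp _ _ (Ext.mk₀ c) _ _

end Vanishing

/-! ### Passage to the derived category -/

section Conclusion

open EquivariantModule Abelian

variable {C : Type u} [Field C] {q : ℕ} [HasDerivedCategory.{w} (QCohXModG C q)]

/-- For `i < 0` the object `G[i]` sits in the positive degree `-i`, and the t-structure allows no
maps to it from an object in degree `0`. -/
theorem subsingleton_extX_of_neg (F G : QCohXModG C q) {i : ℤ} (hi : i < 0) :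
    Subsingleton (ExtX F G i) := by
  refine subsingleton_of_forall_eq 0 fun f => ?_
  have := (DerivedCategory.TStructure.t (C := QCohXModG C q)).isGE_shift
    ((DerivedCategory.singleFunctor (QCohXModG C q) 0).obj G) 0 i (-i)
  exact (DerivedCategory.TStructure.t (C := QCohXModG C q)).zero f 0 (-i)

theorem subsingleton_extX {F G : QCohXModG C q}
    (h : ∀ (_ : HasExt.{w} (QCohXModG C q)) (n : ℕ), Subsingleton (Ext F G (n + 1))) {i : ℤ}
    (hi : i ≠ 0) : Subsingleton (ExtX F G i) := by
  rcases lt_or_gt_of_ne hi with hi | hi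
  · exact subsingleton_extX_of_neg F G hi
  · have hE : HasExt.{w} (QCohXModG C q) := hasExt_of_hasDerivedCategory _
    obtain ⟨n, rfl⟩ : ∃ n : ℕ, i = ((n + 1 : ℕ) : ℤ) := ⟨(i - 1).toNat, by omega⟩
    have := h hE n
    exact (Ext.homEquiv (X := F) (Y := G) (n := n + 1)).symm.subsingleton

/-- A morphism that generates the morphisms freely gives a basis of `Ext^0`. -/
theorem exists_basis_extX {F G : QCohXModG C q} (g : F ⟶ G)
    (h1 : ∀ f : F ⟶ G, ∃ z : InvariantRing C, z • g = f)
    (h2 : ∀ z : InvariantRing C, z • g = 0 → z = 0) :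
    ∃ b : Module.Basis Unit (InvariantRing C) (ExtX F G 0), b () = extXMk g := by
  let S := DerivedCategory.singleFunctor (QCohXModG C q) 0
  let L : (F ⟶ G) →ₗ[InvariantRing C] ExtX F G 0 :=
    { toFun := extXMk
      map_add' := fun f f' =>
        (congrArg (ShiftedHom.mk₀ (0 : ℤ) rfl) (S.map_add)).trans (ShiftedHom.mk₀_add _ _ _ _)
      map_smul' := fun z f =>
        (congrArg (ShiftedHom.mk₀ (0 : ℤ) rfl) (S.map_smul z f)).trans
          (ShiftedHom.mk₀_smul _ _ _) }
  -- The embedding of the abelian category in degree `0` is fully faithful.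
  have hL : Function.Bijective L :=
    (ShiftedHom.homEquiv (X := S.obj F) (Y := S.obj G) (0 : ℤ) rfl).bijective.comp
      ⟨S.map_injective, S.map_surjective⟩
  let e : InvariantRing C ≃ₗ[InvariantRing C] ExtX F G 0 :=
    LinearEquiv.ofBijective (L ∘ₗ LinearMap.toSpanSingleton (InvariantRing C) (F ⟶ G) g)
      ⟨hL.1.comp ((injective_iff_map_eq_zero _).2 h2), hL.2.comp h1⟩
  refine ⟨(Module.Basis.singleton Unit (InvariantRing C)).map e, ?_⟩
  rw [Module.Basis.map_apply, Module.Basis.singleton_apply]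
  exact congrArg extXMk (one_smul (InvariantRing C) g)

end Conclusion

theorem mainTheorem8 {C : Type u} [Field C] [CharZero C] (p r q : ℕ) (hp : p.Prime) (hr : 0 < r)
    (hq : q = p ^ r) [HasDerivedCategory.{w} (QCohXModG C q)] :
    -- vanishing of all `Ext^i` with `i ≠ 0`
    (∀ F ∈ ({structureSheafX C q, structureSheafX₀ C q} : Set (QCohXModG C q)),
      ∀ G ∈ ({structureSheafX C q, structureSheafX₀ C q} : Set (QCohXModG C q)),
        ∀ i : ℤ, i ≠ 0 → Subsingleton (ExtX F G i)) ∧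
    -- `Ext^0` is free of rank one over `ℨ`, with the indicated basis vectors
    (∃ b : Module.Basis Unit (InvariantRing C) (ExtX (structureSheafX C q) (structureSheafX C q) 0),
      b () = extXMk (𝟙 (structureSheafX C q))) ∧
    (∃ b : Module.Basis Unit (InvariantRing C)
        (ExtX (structureSheafX₀ C q) (structureSheafX₀ C q) 0),
      b () = extXMk (𝟙 (structureSheafX₀ C q))) ∧
    (∃ b : Module.Basis Unit (InvariantRing C)
        (ExtX (structureSheafX C q) (structureSheafX₀ C q) 0),
      b () = extXMk (projX₀ C q)) ∧
    -- multiplication by `f` factors uniquely through the projection, as `m`, and `m` is a basis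
    (∃ m : structureSheafX₀ C q ⟶ structureSheafX C q,
      (∀ m' : structureSheafX₀ C q ⟶ structureSheafX C q,
        projX₀ C q ≫ m' = invariantF C q • 𝟙 (structureSheafX C q) ↔ m' = m) ∧
      ∃ b : Module.Basis Unit (InvariantRing C)
          (ExtX (structureSheafX₀ C q) (structureSheafX C q) 0),
        b () = extXMk m) := by
  have hq2 : 2 ≤ q := hq ▸ hp.two_le.trans (Nat.le_self_pow hr.ne' p)
  refine ⟨?_, ?_, ?_, ?_, ?_⟩
  · rintro F (rfl | rfl) G hG i hi
    · exact subsingleton_extX (fun _ n => subsingleton_of_forall_eq 0 fun x =>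
        Abelian.Ext.eq_zero_of_projective x) hi
    · obtain rfl | rfl := hG
      · exact subsingleton_extX (fun _ => ext_structureSheafX₀_structureSheafX hq2) hi
      · exact subsingleton_extX (fun _ => ext_structureSheafX₀_structureSheafX₀ hq2) hi
  · refine exists_basis_extX _ (exists_smul_id_of_hom hq2) fun z hz => ?_
    refine smul_projX₀_injective (q := q) ?_
    rw [← Category.id_comp (projX₀ C q), ← Linear.smul_comp, hz, zero_comp]
  · refine exists_basis_extX _ (fun f => ?_) fun z hz => ?_
    · obtain ⟨z, hz⟩ := exists_smul_projX₀_of_hom hq2 (projX₀ C q ≫ f)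
      refine ⟨z, ?_⟩
      rw [← cancel_epi (projX₀ C q), ← hz, Linear.comp_smul, Category.comp_id]
    · refine smul_projX₀_injective (q := q) ?_
      rw [← Category.comp_id (projX₀ C q), ← Linear.comp_smul, hz, comp_zero]
  · exact exists_basis_extX _ (exists_smul_projX₀_of_hom hq2) fun z => smul_projX₀_injective
  · obtain ⟨m, hm⟩ := exists_divF (C := C) hq2
    refine ⟨m, fun m' => ⟨fun h => ?_, fun h => h ▸ hm⟩, ?_⟩
    · rw [← cancel_epi (projX₀ C q), h, hm]
    · exact exists_basis_extX m (exists_smul_divF_of_hom hm hq2) fun z => smul_divF_injective hm hq2
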